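/- **Terminology.** All spaces are nonempty metric spaces. A $k$-rough geodesic is a map $\gamma:[0,\ell]\to X$ with $\big|d(\gamma(s),\gamma(t))-|s-t|\big|\le k$ for all $s,t$; $X$ is $k$-roughly geodesic if any two points are joined by one. A quasitree is a geodesic space quasiisometric to a simplicial tree. A coarse median on a roughly geodesic hyperbolic space $X$ is a map $\mu:X^3\to X$ such that $\mu(x,y,z)$ is uniformly close to all sides of every uniform-quality rough geodesic triangle on $x,y,z$; a product of hyperbolic spaces gets the componentwise coarse median, and a map $f$ is quasimedian if $f(\mu(x,y,z))$ and $\mu(f(x),f(y),f(z))$ are uniformly close. A wall on a set $S$ is a bipartition of $S$ into two halfspaces; two walls cross if all four quarterspaces are nonempty; a chain is a set of walls that can be oriented so that the chosen halfspaces are linearly ordered by inclusion. An ultrafilter on a set $W$ of walls is a choice of a halfspace of each $h\in W$ such that every halfspace of a wall of $W$ that contains a chosen one is chosen; each $s\in S$ gives the ultrafilter $\phi_s$ of halfspaces containing $s$. For a family $\mathcal C$ of subsets of $W$ that contains all singletons and is closed under taking subsets, $d_{\mathcal C}(x,y)$ is the supremum of $|c|$ over the $c\in\mathcal C$ all of whose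 elements are oriented oppositely by $x$ and $y$. One calls $\mathcal C$ dualisable if $d_{\mathcal C}(\phi_s,\phi_t)<\infty$ for all $s,t\in S$, and $S_{\mathcal C}=\{x : d_{\mathcal C}(x,\phi_s)<\infty\ \forall s\in S\}$, with the metric $d_{\mathcal C}$. **Setting.** Let $X$ be a roughly geodesic hyperbolic space on which a group $G$ acts by isometries. Let $f:X\to\prod_{i=1}^m T_i$ be a $G$-equivariant, quasimedian, quasiisometric embedding in a product of $m$ quasitrees, with the $\ell^1$ metric, on which $G$ acts by isometries of the factors, possibly permuting them. (If $X$ has strong quasitree rank $m<\infty$, meaning that $m$ is the least number for which such an embedding exists, then this holds with that $m$.) Let $S=f(X)$. Call $K$ admissible for a quasitree $T$ if $K>100\delta$ for some $\delta$ such that $T$ is $\delta$-hyperbolic (four-point condition), and, whenever $p$ lies on a geodesic from $x$ to $y$ and $x,y$ are outside the closed $K$-ball $B$ about $p$, the points $x,y$ lie in different components of $T\smallsetminus B$. Choose an admissible $K_i$ for each $T_i$, with $K_i=K_j$ whenever some element of $G$ sends factor $i$ to factor $j$. Let $W_i$ be the set of walls $\{C,T_i\smallsetminus C\}$ and $\{C\cup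 B,T_i\smallsetminus(C\cup B)\}$, where $B$ is a closed $K_i$-ball and $C$ is a component of $T_i\smallsetminus B$. Let $\mathcal D_i$ be the set of finite chains in $W_i$ that are disparate: their elements are defined by balls with centres at pairwise distance at least $10K_i$. Let $W$ be the set of walls on $S$ induced by the $W_i$ via the projections $S\to T_i$. Let $\mathcal D$ be the set of chains of walls of $S$ of the form $\bigcup_{i=1}^m d_i\subset W$ with $d_i\in\mathcal D_i$. For $L\in\mathbf N$ let $\mathcal C=\mathcal C_L$ be the set of $L$-chains: those $c\in\mathcal D$ such that for all distinct $h,k\in c$, every $d\in\mathcal D$ whose elements all cross both $h$ and $k$ has $|d|\le L$. Say that $L_0\in\mathbf N$ bounds grids if $\min\{|d_1|,|d_2|\}\le L_0$ whenever $d_1\in\mathcal D_i$ and $d_2\in\mathcal D_j$ (possibly $i=j$) are such that each member of $d_1$ crosses, in $S$, each member of $d_2$. **Proposition.** Every sufficiently large $K$ is admissible for $T_i$, for each $i$. For every choice of the $K_i$ as above, some $L_0$ bounds grids; and for every $L_0$ that bounds grids and every $L\ge mL_0$, the family $\mathcal C=\mathcal C_L$ is a dualisable system on $(S,W)$, and the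 dual space $S_{\mathcal C}$ is a $3m$-roughly geodesic hyperbolic space that is $G$-equivariantly quasiisometric to $X$. More precisely, the action of $G$ on $S$ preserves $W$ and induces an isometric action of $G$ on $S_{\mathcal C}$, and $x\mapsto\phi_{f(x)}$ is a $G$-equivariant quasiisometry $X\to S_{\mathcal C}$. -/

import Mathlib

open scoped Pointwise

universe u v w

namespace DualQT

/-! ### Coarse geometry -/

section Coarse

/-- `γ : [0, ℓ] → X` is a `k`-rough geodesic from `x` to `y`: a `(1, k)`-quasiisometrically
embedded path. -/
def IsRoughGeodesic {X : Type*} [MetricSpace X] (k : ℝ) (x y : X) (ℓ : ℝ) (γ : ℝ → X) : Prop :=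
  0 ≤ ℓ ∧ γ 0 = x ∧ γ ℓ = y ∧
    ∀ s ∈ Set.Icc 0 ℓ, ∀ t ∈ Set.Icc 0 ℓ, abs (dist (γ s) (γ t) - abs (s - t)) ≤ k

/-- A `k`-roughly geodesic space. -/
def RoughlyGeodesic (X : Type*) [MetricSpace X] (k : ℝ) : Prop :=
  ∀ x y : X, ∃ (ℓ : ℝ) (γ : ℝ → X), IsRoughGeodesic k x y ℓ γ

/-- A geodesic space. -/
def Geodesic (X : Type*) [MetricSpace X] : Prop := RoughlyGeodesic X 0

/-- The Gromov product of `x` and `y` based at `p`. -/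
noncomputable def gromovProduct {X : Type*} [MetricSpace X] (x y p : X) : ℝ :=
  (dist x p + dist y p - dist x y) / 2

/-- Gromov's four-point `δ`-hyperbolicity. -/
def Hyperbolic (X : Type*) [MetricSpace X] (δ : ℝ) : Prop :=
  ∀ x y z p : X, min (gromovProduct x y p) (gromovProduct y z p) - δ ≤ gromovProduct x z p

/-- `f` is a quasiisometric embedding, for distance functions `dX` and `dY`. -/
def IsQuasiIsometricEmbedding {X Y : Type*} (dX : X → X → ℝ) (dY : Y → Y → ℝ) (f : X → Y) : Prop :=
  ∃ lam c : ℝ, 1 ≤ lam ∧ 0 ≤ c ∧ ∀ x y,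
    lam⁻¹ * dX x y - c ≤ dY (f x) (f y) ∧ dY (f x) (f y) ≤ lam * dX x y + c

/-- A quasiisometric embedding with coarsely dense image. -/
def IsQuasiIsometry {X Y : Type*} (dX : X → X → ℝ) (dY : Y → Y → ℝ) (f : X → Y) : Prop :=
  IsQuasiIsometricEmbedding dX dY f ∧ ∃ c : ℝ, ∀ y, ∃ x, dY (f x) y ≤ c

/-- A quasitree: a geodesic metric space quasiisometric to (the vertex set of) a simplicial tree. -/
def IsQuasitree (T : Type w) [MetricSpace T] : Prop :=
  Geodesic T ∧ ∃ (V : Type w) (Γ : SimpleGraph V) (f : T → V),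
    Γ.IsTree ∧ IsQuasiIsometry dist (fun a b => (Γ.dist a b : ℝ)) f

/-- `μ` is a choice of coarse median: `μ x y z` is uniformly close to all the sides of every rough
geodesic triangle with vertices `x`, `y`, `z`, with a bound depending only on the quality of the
triangle. -/
def IsCoarseMedian {X : Type*} [MetricSpace X] (μ : X → X → X → X) : Prop :=
  ∀ k : ℝ, ∃ C : ℝ, ∀ x y z p q : X,
    ((p = x ∧ q = y) ∨ (p = y ∧ q = z) ∨ (p = z ∧ q = x)) →
      ∀ (ℓ : ℝ) (γ : ℝ → X), IsRoughGeodesic k p q ℓ γ →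
        ∃ t ∈ Set.Icc 0 ℓ, dist (μ x y z) (γ t) ≤ C

/-- The `ℓ¹` distance on a finite product of metric spaces. -/
noncomputable def l1Dist {m : ℕ} {T : Fin m → Type w} [∀ i, MetricSpace (T i)]
    (a b : ∀ i, T i) : ℝ := ∑ i, dist (a i) (b i)

/-- `f` is quasimedian, with respect to a coarse median on `X` and the componentwise coarse median
on the product. -/
def IsQuasimedian {X : Type u} {m : ℕ} {T : Fin m → Type w}
    [∀ i, MetricSpace (T i)] (μX : X → X → X → X) (μT : ∀ i, T i → T i → T i → T i)
    (f : X → ∀ i, T i) : Prop :=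
  ∃ δ : ℝ, ∀ x y z,
    l1Dist (fun i => μT i (f x i) (f y i) (f z i)) (f (μX x y z)) ≤ δ

end Coarse

/-! ### Walls, ultrafilters, dual spaces -/

section Walls

/-- A wall: a bipartition `{A, Aᶜ}` of `S`, whose two members are its halfspaces. -/
def Wall (S : Type*) : Type _ := {h : Set (Set S) // ∃ A : Set S, h = {A, Aᶜ}}

namespace Wall

variable {S : Type*}

/-- `A` is a halfspace of `h`. -/
def IsHalf (h : Wall S) (A : Set S) : Prop := A ∈ h.1

/-- The wall `{A, Aᶜ}`. -/
def ofSet (A : Set S) : Wall S := ⟨{A, Aᶜ}, A, rfl⟩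

/-- The wall induced on `S'` by a map `e : S' → S`. -/
def comap {S' : Type*} (e : S' → S) (h : Wall S) : Wall S' :=
  ⟨(fun A => e ⁻¹' A) '' h.1, by
    obtain ⟨A, hA⟩ := h.2
    exact ⟨e ⁻¹' A, by rw [hA, Set.image_pair, Set.preimage_compl]⟩⟩

/-- The translate of a wall by a group element. -/
def smul {G : Type*} [Group G] [MulAction G S] (g : G) (h : Wall S) : Wall S :=
  ⟨(fun A => g • A) '' h.1, by
    obtain ⟨A, hA⟩ := h.2
    exact ⟨g • A, by rw [hA, Set.image_pair, Set.smul_set_compl]⟩⟩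

/-- Two walls cross if all four quarterspaces are nonempty. -/
def Crosses (h k : Wall S) : Prop :=
  ∀ A B : Set S, h.IsHalf A → k.IsHalf B → (A ∩ B).Nonempty

theorem existsUnique_half (h : Wall S) (s : S) : ∃! A, h.IsHalf A ∧ s ∈ A := by
  obtain ⟨A, hA⟩ := h.2
  unfold IsHalf
  rw [hA]
  by_cases hs : s ∈ A
  · refine ⟨A, ⟨by simp, hs⟩, ?_⟩
    rintro B ⟨hB | hB, hsB⟩
    · exact hB
    · rw [Set.mem_singleton_iff] at hB
      subst hB
      exact absurd hs hsB
  · refine ⟨Aᶜ, ⟨by simp, hs⟩, ?_⟩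
    rintro B ⟨hB | hB, hsB⟩
    · subst hB
      exact absurd hsB hs
    · exact hB

/-- The halfspace of `h` containing `s`. -/
noncomputable def halfAt (h : Wall S) (s : S) : Set S := (h.existsUnique_half s).choose

theorem halfAt_isHalf (h : Wall S) (s : S) : h.IsHalf (h.halfAt s) :=
  (h.existsUnique_half s).choose_spec.1.1

theorem mem_halfAt (h : Wall S) (s : S) : s ∈ h.halfAt s :=
  (h.existsUnique_half s).choose_spec.1.2

theorem eq_halfAt (h : Wall S) (s : S) (A : Set S) (hA : h.IsHalf A) (hs : s ∈ A) :
    A = h.halfAt s :=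
  (h.existsUnique_half s).choose_spec.2 A ⟨hA, hs⟩

end Wall

/-- A set of walls is a chain if its members can be oriented so that the chosen halfspaces are
linearly ordered by inclusion. For a finite set, this means that it can be enumerated as
`h₁, …, hₙ`, with pairwise nested halfspaces, so that `hᵢ` separates `hᵢ₋₁` from `hᵢ₊₁`. -/
def IsWallChain {S : Type*} (c : Set (Wall S)) : Prop :=
  ∃ o : Wall S → Set S, (∀ h ∈ c, h.IsHalf (o h)) ∧
    ∀ h ∈ c, ∀ k ∈ c, o h ⊆ o k ∨ o k ⊆ o h

/-- A set `W` of walls on `S`, with a collection `𝒟` of subsets of `W` that is closed under taking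
subsets and contains all the singletons. -/
structure WallSystem (S : Type*) where
  /-- the set `W` of walls -/
  walls : Set (Wall S)
  /-- the collection `𝒟` of subsets of `W` -/
  coll : Set (Set (Wall S))
  subset_walls : ∀ c ∈ coll, c ⊆ walls
  mem_of_subset : ∀ c ∈ coll, ∀ c' ⊆ c, c' ∈ coll
  singleton_mem : ∀ h ∈ walls, {h} ∈ coll

/-- An ultrafilter on a set `W` of walls: a choice of halfspace for each wall, such that if a chosen
halfspace is contained in a halfspace `B` of a wall of `W`, then `B` is also chosen. -/
@[ext]
structure WallUltrafilter {S : Type*} (W : Set (Wall S)) where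
  /-- the chosen halfspaces -/
  half : W → Set S
  isHalf : ∀ h : W, h.1.IsHalf (half h)
  upward : ∀ (h₁ h₂ : W) (B : Set S), h₂.1.IsHalf B → half h₁ ⊆ B → half h₂ = B

/-- The ultrafilter `φ_s` of halfspaces containing the point `s`. -/
noncomputable def principal {S : Type*} (W : Set (Wall S)) (s : S) : WallUltrafilter W where
  half h := h.1.halfAt s
  isHalf h := h.1.halfAt_isHalf s
  upward h₁ h₂ B hB hsub := (h₂.1.eq_halfAt s B hB (hsub (h₁.1.mem_halfAt s))).symm

/-- A set `c` of walls separates `x` from `y` if they orient every element of `c` oppositely. -/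
def Separates {S : Type*} {W : Set (Wall S)} (c : Set (Wall S)) (x y : WallUltrafilter W) : Prop :=
  ∀ h : W, h.1 ∈ c → x.half h ≠ y.half h

namespace WallSystem

variable {S : Type*} (𝒟 : WallSystem S)

/-- `d_𝒟(x, y)`, the supremum of the cardinalities of the elements of `𝒟` separating `x` from
`y`. -/
noncomputable def edist (x y : WallUltrafilter 𝒟.walls) : ℕ∞ :=
  ⨆ c ∈ {c | c ∈ 𝒟.coll ∧ Separates c x y}, c.encard

/-- The system is dualisable if `d_𝒟` is finite on points of `S`. -/
def IsDualisable : Prop :=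
  ∀ s t : S, 𝒟.edist (principal 𝒟.walls s) (principal 𝒟.walls t) < ⊤

/-- The `𝒟`-dual of `S`. -/
def Dual : Type _ :=
  {x : WallUltrafilter 𝒟.walls // ∀ s : S, 𝒟.edist x (principal 𝒟.walls s) < ⊤}

variable {𝒟}

theorem edist_self (x : WallUltrafilter 𝒟.walls) : 𝒟.edist x x = 0 := by
  unfold edist
  simp only [ENat.iSup_eq_zero]
  rintro c ⟨hc, hs⟩
  rw [Set.encard_eq_zero, Set.eq_empty_iff_forall_notMem]
  intro h hh
  exact hs ⟨h, 𝒟.subset_walls c hc hh⟩ hh rfl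

theorem edist_comm (x y : WallUltrafilter 𝒟.walls) : 𝒟.edist x y = 𝒟.edist y x := by
  have : ∀ c, Separates c x y ↔ Separates c y x := fun c =>
    ⟨fun h k hk => (h k hk).symm, fun h k hk => (h k hk).symm⟩
  unfold edist
  simp only [this]

theorem edist_triangle (x y z : WallUltrafilter 𝒟.walls) :
    𝒟.edist x z ≤ 𝒟.edist x y + 𝒟.edist y z := by
  refine iSup₂_le ?_
  rintro c ⟨hc, hs⟩
  set a : Set (Wall S) := {h | h ∈ c ∧ ∃ hh : h ∈ 𝒟.walls, x.half ⟨h, hh⟩ ≠ y.half ⟨h, hh⟩} with ha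
  have h1 : a.encard ≤ 𝒟.edist x y :=
    le_iSup₂_of_le a ⟨𝒟.mem_of_subset c hc a fun h hh => hh.1, fun h hh => hh.2.2⟩ le_rfl
  have h2 : (c \ a).encard ≤ 𝒟.edist y z := by
    refine le_iSup₂_of_le (c \ a) ⟨𝒟.mem_of_subset c hc _ Set.sdiff_subset, ?_⟩ le_rfl
    intro h hh heq
    by_cases hxy : x.half h = y.half h
    · exact hs h hh.1 (hxy.trans heq)
    · exact hh.2 ⟨hh.1, h.2, hxy⟩
  calc c.encard ≤ (a ∪ c \ a).encard := Set.encard_le_encard (by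
        intro h hh
        by_cases hha : h ∈ a
        · exact Or.inl hha
        · exact Or.inr ⟨hh, hha⟩)
    _ ≤ a.encard + (c \ a).encard := Set.encard_union_le _ _
    _ ≤ _ := add_le_add h1 h2

theorem eq_of_edist_eq_zero (x y : WallUltrafilter 𝒟.walls) (h : 𝒟.edist x y = 0) : x = y := by
  apply WallUltrafilter.ext
  funext k
  by_contra hne
  have h1 : ({k.1} : Set (Wall S)).encard ≤ 𝒟.edist x y := by
    refine le_iSup₂_of_le {k.1} ⟨𝒟.singleton_mem k.1 k.2, ?_⟩ le_rfl
    intro h' hh'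
    have : h' = k := Subtype.ext hh'
    rw [this]
    exact hne
  rw [h, Set.encard_singleton] at h1
  exact absurd h1 (by simp)

theorem edist_lt_top [Nonempty S] (x y : 𝒟.Dual) : 𝒟.edist x.1 y.1 < ⊤ := by
  obtain ⟨s⟩ := ‹Nonempty S›
  refine lt_of_le_of_lt (edist_triangle x.1 (principal 𝒟.walls s) y.1) ?_
  rw [edist_comm (principal 𝒟.walls s)]
  exact WithTop.add_lt_top.2 ⟨x.2 s, y.2 s⟩

/-- The dual space, with the metric `d_𝒟`. -/
noncomputable instance [Nonempty S] : MetricSpace 𝒟.Dual where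
  dist x y := ((𝒟.edist x.1 y.1).toNat : ℝ)
  dist_self x := by simp [edist_self]
  dist_comm x y := by simp only [edist_comm]
  dist_triangle x y z := by
    have h := ENat.toNat_le_toNat (edist_triangle x.1 y.1 z.1)
      (WithTop.add_lt_top.2 ⟨edist_lt_top x y, edist_lt_top y z⟩).ne
    rw [ENat.toNat_add (edist_lt_top x y).ne (edist_lt_top y z).ne] at h
    exact_mod_cast h
  eq_of_dist_eq_zero := by
    intro x y h
    have h' : (𝒟.edist x.1 y.1).toNat = 0 := by exact_mod_cast h
    rcases (ENat.toNat_eq_zero).1 h' with h0 | h0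
    · exact Subtype.ext (eq_of_edist_eq_zero _ _ h0)
    · exact absurd h0 (edist_lt_top x y).ne

end WallSystem

end Walls

/-! ### The walls of a quasitree -/

section Quasitree

variable (T : Type w) [MetricSpace T]

/-- `K` is an admissible radius for `T`: it exceeds `100δ`, where `T` is `δ`-hyperbolic, and balls of
radius `K` disconnect `T` where they should: whenever `p` lies on a geodesic from `x` to `y` and
`x`, `y` are outside the `K`-ball about `p`, they are in distinct components of its complement. -/
def IsAdmissibleRadius (K : ℝ) : Prop :=
  (∃ δ : ℝ, Hyperbolic T δ ∧ 100 * δ < K) ∧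
    ∀ x y p : T, dist x p + dist p y = dist x y →
      x ∉ Metric.closedBall p K → y ∉ Metric.closedBall p K →
        y ∉ connectedComponentIn (Metric.closedBall p K)ᶜ x

variable {T}

/-- The walls `(C, T ∖ C)` and `(C ∪ B, T ∖ (C ∪ B))`, where `B` is the `K`-ball about `p` and `C`
is a component of `T ∖ B`. -/
def ballWalls (K : ℝ) (p : T) : Set (Wall T) :=
  {h | ∃ q ∉ Metric.closedBall p K,
    h = Wall.ofSet (connectedComponentIn (Metric.closedBall p K)ᶜ q) ∨
    h = Wall.ofSet (connectedComponentIn (Metric.closedBall p K)ᶜ q ∪ Metric.closedBall p K)}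

/-- The finite chains of walls that are disparate: their members are defined by `K`-balls whose
centres are pairwise at distance at least `10K`. -/
def disparateChains (K : ℝ) : Set (Set (Wall T)) :=
  {c | c.Finite ∧ IsWallChain c ∧ ∃ p : Wall T → T, (∀ h ∈ c, h ∈ ballWalls K (p h)) ∧
    ∀ h ∈ c, ∀ k ∈ c, h ≠ k → 10 * K ≤ dist (p h) (p k)}

theorem IsWallChain.mono {S : Type*} {c c' : Set (Wall S)} (hc : IsWallChain c) (h : c' ⊆ c) :
    IsWallChain c' := by
  obtain ⟨o, h1, h2⟩ := hc
  exact ⟨o, fun k hk => h1 k (h hk), fun k hk l hl => h2 k (h hk) l (h hl)⟩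

theorem isWallChain_singleton {S : Type*} (h : Wall S) : IsWallChain {h} := by
  obtain ⟨A, hA⟩ := h.2
  refine ⟨fun _ => A, ?_, fun _ _ _ _ => Or.inl subset_rfl⟩
  rintro k rfl
  unfold Wall.IsHalf
  rw [hA]
  simp

theorem disparateChains_mono {K : ℝ} {c c' : Set (Wall T)} (hc : c ∈ disparateChains K)
    (h : c' ⊆ c) : c' ∈ disparateChains K := by
  obtain ⟨h0, h1, p, h2, h3⟩ := hc
  exact ⟨h0.subset h, h1.mono h, p, fun k hk => h2 k (h hk),
    fun k hk l hl => h3 k (h hk) l (h hl)⟩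

theorem singleton_mem_disparateChains {K : ℝ} {p : T} {h : Wall T} (hh : h ∈ ballWalls K p) :
    {h} ∈ disparateChains K := by
  refine ⟨Set.finite_singleton h, isWallChain_singleton h, fun _ => p, ?_, ?_⟩
  · rintro k rfl
    exact hh
  · rintro k rfl l rfl hne
    exact absurd rfl hne

theorem empty_mem_disparateChains {K : ℝ} {p : T} : (∅ : Set (Wall T)) ∈ disparateChains K :=
  ⟨Set.finite_empty, ⟨fun _ => ∅, by simp, by simp⟩, fun _ => p, by simp, by simp⟩

end Quasitree

/-! ### The systems of walls on a subset of a product of quasitrees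

Here `S` comes with coordinate maps `π i : S → T i`. -/

section Product

variable {m : ℕ} {T : Fin m → Type w} [∀ i, MetricSpace (T i)] {S : Type*}
  (π : ∀ i, S → T i) (K : Fin m → ℝ)

/-- The set `W` of walls on `S` induced by the walls of the factors. -/
def inducedWalls : Set (Wall S) :=
  {h | ∃ (i : Fin m) (p : T i), ∃ k ∈ ballWalls (K i) p, h = k.comap (π i)}

/-- The collection `𝒟¹` of unions of one disparate chain of each factor. -/
def unionsOfChains : Set (Set (Wall S)) :=
  {c | ∃ d : ∀ i, Set (Wall (T i)), (∀ i, d i ∈ disparateChains (K i)) ∧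
    c = ⋃ i, Wall.comap (π i) '' d i}

/-- The collection `𝒟` of elements of `𝒟¹` that are chains of walls of `S`. -/
def chainUnions : Set (Set (Wall S)) :=
  {c | c ∈ unionsOfChains π K ∧ IsWallChain c}

/-- The collection `𝒞` of `L`-chains: those `c ∈ 𝒟` such that every `d ∈ 𝒟` whose elements all cross
two given members of `c` has cardinality at most `L`. -/
def lChains (L : ℕ) : Set (Set (Wall S)) :=
  {c | c ∈ chainUnions π K ∧ ∀ h ∈ c, ∀ k ∈ c, h ≠ k → ∀ d ∈ chainUnions π K,
    (∀ l ∈ d, l.Crosses h ∧ l.Crosses k) → d.encard ≤ L}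

/-- If `d₁ ∈ 𝒟_i` and `d₂ ∈ 𝒟_j` form a grid, which means that each member of `d₁` crosses each
member of `d₂` in `S`, then `min {|d₁|, |d₂|} ≤ L`. -/
def GridBound (L : ℕ) : Prop :=
  ∀ i j : Fin m, ∀ d₁ ∈ disparateChains (T := T i) (K i), ∀ d₂ ∈ disparateChains (T := T j) (K j),
    (∀ h ∈ d₁, ∀ k ∈ d₂, (h.comap (π i)).Crosses (k.comap (π j))) →
      min d₁.encard d₂.encard ≤ L

variable {π K}

theorem unionsOfChains_mono {c c' : Set (Wall S)} (hc : c ∈ unionsOfChains π K) (h : c' ⊆ c) :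
    c' ∈ unionsOfChains π K := by
  obtain ⟨d, hd, rfl⟩ := hc
  refine ⟨fun i => {k | k ∈ d i ∧ k.comap (π i) ∈ c'},
    fun i => disparateChains_mono (hd i) fun k hk => hk.1, ?_⟩
  ext l
  constructor
  · intro hl
    obtain ⟨i, k, hk, rfl⟩ := Set.mem_iUnion.1 (h hl)
    exact Set.mem_iUnion.2 ⟨i, k, ⟨hk, hl⟩, rfl⟩
  · intro hl
    obtain ⟨i, k, hk, rfl⟩ := Set.mem_iUnion.1 hl
    exact hk.2

theorem subset_inducedWalls {c : Set (Wall S)} (hc : c ∈ unionsOfChains π K) :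
    c ⊆ inducedWalls π K := by
  obtain ⟨d, hd, rfl⟩ := hc
  intro l hl
  obtain ⟨i, k, hk, rfl⟩ := Set.mem_iUnion.1 hl
  obtain ⟨-, -, p, hp, -⟩ := hd i
  exact ⟨i, p k, k, hp k hk, rfl⟩

theorem singleton_mem_unionsOfChains [Nonempty S] {h : Wall S} (hh : h ∈ inducedWalls π K) :
    {h} ∈ unionsOfChains π K := by
  obtain ⟨i, p, k, hk, rfl⟩ := hh
  obtain ⟨s⟩ := ‹Nonempty S›
  refine ⟨Function.update (fun _ => ∅) i {k}, ?_, ?_⟩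
  · intro j
    by_cases hj : j = i
    · subst hj
      rw [Function.update_self]
      exact singleton_mem_disparateChains hk
    · rw [Function.update_of_ne hj]
      exact empty_mem_disparateChains (p := π j s)
  · ext l
    constructor
    · rintro rfl
      refine Set.mem_iUnion.2 ⟨i, k, ?_, rfl⟩
      rw [Function.update_self]
      rfl
    · intro hl
      obtain ⟨j, k', hk', rfl⟩ := Set.mem_iUnion.1 hl
      by_cases hj : j = i
      · subst hj
        rw [Function.update_self] at hk'
        rw [Set.mem_singleton_iff.1 hk']
        rfl
      · rw [Function.update_of_ne hj] at hk'
        exact absurd hk' (Set.notMem_empty _)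

variable (π K)

/-- The set of walls `W` on `S` with the collection `𝒞` of `L`-chains. -/
def lChainSystem [Nonempty S] (L : ℕ) : WallSystem S where
  walls := inducedWalls π K
  coll := lChains π K L
  subset_walls := fun _ hc => subset_inducedWalls hc.1.1
  mem_of_subset := fun _ hc _ h =>
    ⟨⟨unionsOfChains_mono hc.1.1 h, hc.1.2.mono h⟩,
      fun k hk l hl => hc.2 k (h hk) l (h hl)⟩
  singleton_mem := fun h hh =>
    ⟨⟨singleton_mem_unionsOfChains hh, isWallChain_singleton h⟩, by
      rintro k rfl l rfl hne
      exact absurd rfl hne⟩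

end Product

/-! ### The image of an equivariant map -/

section Image

variable {X : Type u} {P : Type w} {G : Type v} [Group G] [MulAction G X] [MulAction G P]

/-- The image of an equivariant map, with its action of `G`. -/
def image (f : X → P) (hf : ∀ (g : G) (x : X), f (g • x) = g • f x) : SubMulAction G P where
  carrier := Set.range f
  smul_mem' := by
    rintro g _ ⟨x, rfl⟩
    exact ⟨g • x, hf g x⟩

/-- A point of `X`, seen in the image. -/
def toImage (f : X → P) (hf : ∀ (g : G) (x : X), f (g • x) = g • f x) (x : X) : image f hf :=
  ⟨f x, x, rfl⟩

instance [Nonempty X] (f : X → P) (hf : ∀ (g : G) (x : X), f (g • x) = g • f x) :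
    Nonempty (image f hf) :=
  ⟨toImage f hf (Classical.arbitrary X)⟩

end Image

end DualQT

namespace DualQT

/-! ### Trees and quasitrees -/

section Tree

open SimpleGraph

variable {V : Type*} {Γ : SimpleGraph V}

/-! One observation drives every estimate. A wall defined by a `K`-ball about `p` can separate `u`
from `v` only if every connected set joining them meets the ball; applied to a geodesic, this puts
`p` coarsely between `u` and `v` (`Geodesic.dist_add_le_of_halfAt_ne`). So walls with distant
centres are nested, and the number of walls of a disparate chain that separate `x` from both `a` and
`b` is at most linear in the Gromov product of `a` and `b` at `x` (`ncard_le_gromovProduct`).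
Conversely, quasitrees have plenty of walls: pulling back a tree metric shows that a connected set
joining the ends of a geodesic passes near each of its points (`IsQuasitree.exists_bottleneck`), so
large balls separate and large radii are admissible.

The geometry of the dual follows from an abstract property, `IsGluable`: members of the system are
`L`-chains, and two of them, one after the other between two ultrafilters, can be concatenated after
deleting at most `M` walls. Switching the walls between `x` and `y` in order of depth gives a rough
geodesic (`IsGluable.roughlyGeodesic`). The majority vote of three ultrafilters is a coarse median,
so Gromov products are coarsely distances to medians (`IsGluable.abs_gromovProduct_sub_le`). If
hyperbolicity failed badly, a large chain would cross two walls of another chain, against the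
`L`-chain condition (`IsGluable.hyperbolic`). The system of the theorem is gluable with `M = 3 * m`,
since three deletions in each factor suffice (`lChains_glue`).

Hyperbolicity of `X` enters through grids. Choose points in the four corners of a grid. Two of the
medians of this quadrilateral are close in `X`, and `f` sends them close to medians in the factors.
In one of the two families of walls, these medians lie near opposite sides, so all but boundedly
many walls of that family separate two close points (`exists_gridBound`).

It remains to compare distances. The counting estimate bounds the dual distance from above. From
below, place walls along a geodesic of one factor and keep every `(L₀ + 1)`-st: a wall crossing two
of these crosses all those between, and the grid bound turns the selection into an `L`-chain
(`exists_lChain_separating`). For coarse density, a point of the dual is shown to lie coarsely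
between two images of points of `X`; the image of a rough geodesic joining them has a point at the
right distance, and hyperbolicity of the dual makes the two close (`principalDual_coarselyDense`).
Equivariance is transport of structure. -/

theorem tree_exists_geodesic_cons (hΓ : Γ.IsTree) {p x : V} (h : p ≠ x) :
    ∃ (n : V) (_ : Γ.Adj p n) (w : Γ.Walk n x), w.IsPath ∧ w.length = Γ.dist n x ∧
      Γ.dist p x = Γ.dist n x + 1 := by
  obtain ⟨w, hw⟩ := hΓ.connected.exists_walk_length_eq_dist p x
  cases w with
  | nil => exact absurd rfl h
  | @cons _ n _ hadj w =>
    have h1 : Γ.dist n x ≤ w.length := Γ.dist_le w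
    have h2 : Γ.dist p x ≤ Γ.dist n x + 1 := by
      have := hΓ.connected.dist_triangle (u := p) (v := n) (w := x)
      rw [SimpleGraph.dist_eq_one_iff_adj.2 hadj] at this
      omega
    rw [Walk.length_cons] at hw
    have h3 : w.length = Γ.dist n x := by omega
    exact ⟨n, hadj, w, w.isPath_of_length_eq_dist h3, h3, by omega⟩

/-- The reversed path from `p` to `x` followed by the path from `p` to `y` does not backtrack at
`p`, so in a tree it is a path. Paths in a tree are unique, so it is the shortest one. -/
theorem tree_dist_add_of_ne (hΓ : Γ.IsTree) {p n n' x y : V} (hn : Γ.Adj p n) (hn' : Γ.Adj p n')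
    (hne : n ≠ n') (w : Γ.Walk n x) (w' : Γ.Walk n' y) (hw : w.length = Γ.dist n x)
    (hw' : w'.length = Γ.dist n' y) (h : Γ.dist p x = Γ.dist n x + 1)
    (h' : Γ.dist p y = Γ.dist n' y + 1) :
    Γ.dist x y = Γ.dist p x + Γ.dist p y := by
  have a1 : (Walk.cons hn w).IsPath := Walk.isPath_of_length_eq_dist _ (by simp [hw, h])
  have a2 : (Walk.cons hn' w').IsPath := Walk.isPath_of_length_eq_dist _ (by simp [hw', h'])
  have hp : ((Walk.cons hn w).reverse.append (Walk.cons hn' w')).IsPath := by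
    have b1 := (hΓ.isAcyclic.isPath_iff_isChain _).1 a1.reverse
    have b2 := (hΓ.isAcyclic.isPath_iff_isChain _).1 a2
    rw [hΓ.isAcyclic.isPath_iff_isChain, Walk.edges_append]
    refine List.isChain_append.2 ⟨b1, b2, ?_⟩
    intro e he e' he'
    simp only [Walk.edges_reverse, Walk.edges_cons, List.reverse_cons, List.getLast?_append,
      List.getLast?_singleton, Option.mem_def, Option.some_or, Option.some.injEq,
      List.head?_cons] at he he'
    subst he he'
    intro heq
    rw [Sym2.eq_iff] at heq
    rcases heq with ⟨-, h⟩ | ⟨h, -⟩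
    · exact hne h
    · exact hn'.ne h
  obtain ⟨q, hq, hql⟩ := hΓ.connected.exists_path_of_dist x y
  have := (hΓ.isAcyclic.subsingleton_path x y).elim ⟨_, hp⟩ ⟨q, hq⟩
  have hlen := congrArg (fun r : Γ.Path x y => r.1.length) this
  simp only [Walk.length_append, Walk.length_reverse, Walk.length_cons] at hlen
  omega

/-- Move `p` towards the other points. While the first edges from `p` to `x`, `y`, `z` agree, a step
along them lowers all three distances by one and changes both sides equally. Once the edge towards
`y` differs from another, `p` lies on a geodesic from `y`, and the triangle inequality suffices. -/
theorem tree_four_point (hΓ : Γ.IsTree) (x y z p : V) :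
    Γ.dist x z + Γ.dist p y ≤ max (Γ.dist x y + Γ.dist p z) (Γ.dist y z + Γ.dist p x) := by
  induction hN : Γ.dist p x + Γ.dist p y + Γ.dist p z using Nat.strong_induction_on
    generalizing p with
  | _ N ih =>
  have htri := fun a b c : V => hΓ.connected.dist_triangle (u := a) (v := b) (w := c)
  by_cases hx : p = x
  · subst hx; exact le_max_of_le_left (by omega)
  by_cases hz : p = z
  · subst hz
    rw [Γ.dist_comm (u := x), Γ.dist_comm (u := p) (v := y)]
    exact le_max_of_le_right (by omega)
  by_cases hy : p = y
  · subst hy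
    have := htri x p z
    rw [dist_self]
    exact le_max_of_le_left (by omega)
  obtain ⟨a, ha, w, hw, hwl, hax⟩ := tree_exists_geodesic_cons hΓ hx
  obtain ⟨b, hb, w', hw', hwl', hby⟩ := tree_exists_geodesic_cons hΓ hy
  obtain ⟨c, hc, w'', hw'', hwl'', hcz⟩ := tree_exists_geodesic_cons hΓ hz
  by_cases hab : a = b
  · by_cases hbc : b = c
    · subst hab hbc
      have := ih _ (by omega) a rfl
      rw [le_max_iff] at this ⊢
      omega
    · have h1 := tree_dist_add_of_ne hΓ hb hc hbc w' w'' hwl' hwl'' hby hcz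
      have := htri x p z
      rw [Γ.dist_comm (u := x) (v := p)] at this
      exact le_max_of_le_right (by omega)
  · have h1 := tree_dist_add_of_ne hΓ ha hb hab w w' hwl hwl' hax hby
    have := htri x p z
    rw [Γ.dist_comm (u := x) (v := p)] at this
    exact le_max_of_le_left (by omega)

end Tree

/-! ### Geodesics as connected sets. -/

section Segments

variable {T : Type*} [MetricSpace T]

theorem Geodesic.exists_segment (hT : Geodesic T) (x y : T) :
    ∃ Z : Set T, IsPreconnected Z ∧ x ∈ Z ∧ y ∈ Z ∧
      (∀ z ∈ Z, dist x z + dist z y = dist x y) ∧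
      (∀ z ∈ Z, ∀ z' ∈ Z, dist z z' = |dist x z - dist x z'|) ∧
      ∀ r ∈ Set.Icc 0 (dist x y), ∃ z ∈ Z, dist x z = r := by
  obtain ⟨ℓ, γ, hℓ, h0, h1, hγ⟩ := hT x y
  have hd : ∀ s ∈ Set.Icc 0 ℓ, ∀ t ∈ Set.Icc 0 ℓ, dist (γ s) (γ t) = |s - t| := fun s hs t ht => by
    have := abs_nonpos_iff.1 (hγ s hs t ht)
    linarith
  have hl : ℓ ∈ Set.Icc 0 ℓ := ⟨hℓ, le_rfl⟩
  have hz : (0 : ℝ) ∈ Set.Icc 0 ℓ := ⟨le_rfl, hℓ⟩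
  have hx : ∀ s ∈ Set.Icc 0 ℓ, dist x (γ s) = s := fun s hs => by
    rw [← h0, hd 0 hz s hs, zero_sub, abs_neg, abs_of_nonneg hs.1]
  have hxy : dist x y = ℓ := by rw [← h1, hx ℓ hl]
  have hcont : ContinuousOn γ (Set.Icc 0 ℓ) := by
    refine LipschitzOnWith.continuousOn (K := 1) (LipschitzOnWith.of_dist_le_mul ?_)
    intro s hs t ht
    rw [hd s hs t ht, Real.dist_eq]
    simp
  refine ⟨γ '' Set.Icc 0 ℓ, isPreconnected_Icc.image γ hcont, ⟨0, hz, h0⟩, ⟨ℓ, hl, h1⟩, ?_, ?_, ?_⟩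
  · rintro _ ⟨s, hs, rfl⟩
    rw [hx s hs, ← h1, hd s hs ℓ hl, h1, hxy, abs_of_nonpos (by linarith [hs.2])]
    ring
  · rintro _ ⟨s, hs, rfl⟩ _ ⟨t, ht, rfl⟩
    rw [hx s hs, hx t ht, hd s hs t ht]
  · intro r hr
    rw [hxy] at hr
    exact ⟨γ r, ⟨r, hr, rfl⟩, hx r hr⟩

end Segments

/-! ### The bottleneck property, hyperbolicity and admissible radii. -/

section Quasitree

variable {T : Type w} [MetricSpace T]

/-- `D` is a `0`-hyperbolic pseudometric on `T` that is quasiisometric to the metric. -/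
structure TreeLike (D : T → T → ℝ) (lam c : ℝ) : Prop where
  one_le : 1 ≤ lam
  nonneg : 0 ≤ c
  self : ∀ x, D x x = 0
  comm : ∀ x y, D x y = D y x
  tri : ∀ x y z, D x z ≤ D x y + D y z
  four : ∀ x y z p, D x z + D p y ≤ max (D x y + D p z) (D y z + D p x)
  lower : ∀ x y, dist x y ≤ lam * (D x y + c)
  upper : ∀ x y, D x y ≤ lam * dist x y + c

theorem IsQuasitree.exists_treeLike (hT : IsQuasitree T) :
    ∃ (D : T → T → ℝ) (lam c : ℝ), TreeLike D lam c := by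
  obtain ⟨-, V, Γ, f, hΓ, ⟨lam, c, hl, hc, h⟩, -⟩ := hT
  refine ⟨fun x y => (Γ.dist (f x) (f y) : ℝ), lam, c, hl, hc, by simp, fun x y => ?_,
    fun x y z => ?_, fun x y z p => ?_, fun x y => ?_, fun x y => (h x y).2⟩
  · rw [Γ.dist_comm]
  · exact_mod_cast hΓ.connected.dist_triangle
  · exact_mod_cast tree_four_point hΓ (f x) (f y) (f z) (f p)
  · have h1 := (h x y).1
    have h2 : lam⁻¹ * dist x y ≤ Γ.dist (f x) (f y) + c := by linarith
    rwa [inv_mul_le_iff₀ (by linarith)] at h2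

namespace TreeLike

variable {D : T → T → ℝ} {lam c : ℝ}

/-- Twice the Gromov product for `D`. -/
def gp (D : T → T → ℝ) (p a b : T) : ℝ := D a p + D b p - D a b

theorem gp_ultra (hD : TreeLike D lam c) (p a b e : T) {r : ℝ} (h : r ≤ gp D p a b)
    (h' : r ≤ gp D p b e) : r ≤ gp D p a e := by
  have h4 := hD.four a b e p
  unfold gp at *
  rw [hD.comm p b, hD.comm p e, hD.comm p a] at h4
  rcases le_max_iff.1 h4 with h4 | h4 <;> linarith

theorem gp_ultra_lt (hD : TreeLike D lam c) (p a b e : T) {r : ℝ} (h : r < gp D p a b)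
    (h' : r < gp D p b e) : r < gp D p a e :=
  (lt_min h h').trans_le (hD.gp_ultra p a b e (min_le_left _ _) (min_le_right _ _))

theorem gp_comm (hD : TreeLike D lam c) (p a b : T) : gp D p a b = gp D p b a := by
  unfold gp
  rw [hD.comm a b]
  ring

theorem le_gp_of_dist_le_one (hD : TreeLike D lam c) (p a b : T) (h : dist a b ≤ 1) :
    2 * D a p - 2 * (lam + c) ≤ gp D p a b := by
  have h1 := hD.upper a b
  have h2 : lam * dist a b ≤ lam * 1 := mul_le_mul_of_nonneg_left h (by linarith [hD.one_le])
  have h3 := hD.tri a b p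
  unfold gp
  linarith

/-- Descending from `a` to `p` inside `Z`, one passes height `r` on the branch of `a`. Otherwise the
points of `Z` on that branch above height `r` would be closed under steps of length at most 1, and
connectedness would carry the branch to `p`, where the product with `a` is 0. -/
theorem exists_mem_near_of_gp (hD : TreeLike D lam c) {p a : T} {Z : Set T} (hZ : IsPreconnected Z)
    (ha : a ∈ Z) (hp : p ∈ Z) {r : ℝ} (hr : 0 < r) (hra : r ≤ D a p) :
    ∃ z ∈ Z, 2 * r ≤ gp D p z a ∧ D z p < r + (lam + c) := by
  by_contra! hcon
  have hstep : ∀ z ∈ Z, ∀ z' ∈ Z, dist z z' ≤ 1 → 2 * r ≤ gp D p z a → 2 * r ≤ gp D p z' a := by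
    intro z hz z' hz' hd h
    have h1 := hcon z hz h
    have h2 := hD.le_gp_of_dist_le_one p z z' hd
    exact hD.gp_ultra p z' z a (by rw [hD.gp_comm]; linarith) h
  have key := hZ.induction₂' (fun z z' => 2 * r ≤ gp D p z a → 2 * r ≤ gp D p z' a)
    (fun z hz => by
      have : Metric.ball z 1 ∈ nhdsWithin z Z := nhdsWithin_le_nhds (Metric.ball_mem_nhds z one_pos)
      filter_upwards [this, self_mem_nhdsWithin] with z' hz' hz'Z
      have hd := (Metric.mem_ball.1 hz').le
      exact ⟨hstep z hz z' hz'Z (by rwa [dist_comm]), hstep z' hz'Z z hz hd⟩)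
    (fun x y z _ _ _ h h' h'' => h' (h h'')) ha hp
  have h1 : 2 * r ≤ gp D p a a := by
    unfold gp
    rw [hD.self a]
    linarith
  have h2 := key h1
  unfold gp at h2
  rw [hD.self p, hD.comm p a] at h2
  linarith

/-- If `x` and `y` share a branch up to height `r` over `p`, both halves of the geodesic contain a
point of that branch near height `r`. These points are close to each other, yet on opposite sides of
`p`, so they are close to `p`, which bounds `r`. -/
theorem exists_gp_le (hD : TreeLike D lam c) (hT : Geodesic T) :
    ∃ R : ℝ, ∀ x p y : T, dist x p + dist p y = dist x y → gp D p x y ≤ R := by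
  refine ⟨2 * (lam * (lam * (2 * (lam + c) + c)) + c), fun x p y hb => ?_⟩
  have hl := hD.one_le
  have hc := hD.nonneg
  by_contra! hR
  set r := gp D p x y / 2 with hr
  have hr0 : 0 < r := by
    have : 0 ≤ lam * (lam * (2 * (lam + c) + c)) := by positivity
    linarith
  have hrx : r ≤ D x p := by
    have := hD.tri y x p
    rw [hD.comm y x] at this
    unfold gp at hr
    linarith
  have hry : r ≤ D y p := by
    have := hD.tri x y p
    unfold gp at hr
    linarith
  obtain ⟨Z, hZ, hxZ, hpZ, hZb, -⟩ := hT.exists_segment x p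
  obtain ⟨Y, hY, hpY, hyY, hYb, -⟩ := hT.exists_segment p y
  obtain ⟨z, hz, hz1, hz2⟩ := hD.exists_mem_near_of_gp hZ hxZ hpZ hr0 hrx
  obtain ⟨z', hz', hz1', hz2'⟩ := hD.exists_mem_near_of_gp hY hyY hpY hr0 hry
  have h1 : 2 * r ≤ gp D p z y := hD.gp_ultra p z x y hz1 (by linarith)
  have h2 : 2 * r ≤ gp D p z z' := hD.gp_ultra p z y z' h1 (by rwa [hD.gp_comm])
  have h3 : D z z' ≤ 2 * (lam + c) := by
    unfold gp at h2
    linarith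
  have h4 : dist z p ≤ dist z z' := by
    have e1 := hZb z hz
    have e2 := hYb z' hz'
    have e3 := dist_triangle4 x z z' y
    have e4 : 0 ≤ dist p z' := dist_nonneg
    linarith
  have h5 : dist z z' ≤ lam * (2 * (lam + c) + c) :=
    (hD.lower z z').trans (mul_le_mul_of_nonneg_left (by linarith) (by linarith))
  have h6 : D z p ≤ lam * (lam * (2 * (lam + c) + c)) + c :=
    (hD.upper z p).trans (by gcongr; exact h4.trans h5)
  have h7 : r ≤ D z p := by
    have := hD.tri x z p
    rw [hD.comm x z] at this
    unfold gp at hz1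
    linarith
  linarith

/-- A set that stays far from `p` cannot change branch in a small step. Being connected it stays in
one branch, so the product of its points `x` and `y` would exceed the bound of `exists_gp_le`. -/
theorem exists_bottleneck (hD : TreeLike D lam c) (hT : Geodesic T) :
    ∃ B : ℝ, 0 ≤ B ∧ ∀ x p y : T, dist x p + dist p y = dist x y →
      ∀ Z : Set T, IsPreconnected Z → x ∈ Z → y ∈ Z → ∃ z ∈ Z, dist z p ≤ B := by
  obtain ⟨R, hR⟩ := hD.exists_gp_le hT
  have hl := hD.one_le
  have hc := hD.nonneg
  refine ⟨max 0 (lam * (R / 2 + c + (lam + c))), le_max_left _ _, fun x p y hb Z hZ hx hy => ?_⟩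
  by_contra! hcon
  have hstep : ∀ z ∈ Z, ∀ z', dist z z' ≤ 1 → R < gp D p z z' := by
    intro z hz z' hd
    have h1 := hD.le_gp_of_dist_le_one p z z' hd
    have h2 := ((le_max_right _ _).trans_lt (hcon z hz)).trans_le (hD.lower z p)
    have h3 := lt_of_mul_lt_mul_left h2 (by linarith)
    linarith
  have key := hZ.induction₂ (fun z z' => R < gp D p z z')
    (fun z hz => by
      have : Metric.ball z 1 ∈ nhdsWithin z Z := nhdsWithin_le_nhds (Metric.ball_mem_nhds z one_pos)
      filter_upwards [this] with z' hz'
      exact hstep z hz z' (by rw [dist_comm]; exact (Metric.mem_ball.1 hz').le))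
    (fun x y z _ _ _ h h' => hD.gp_ultra_lt p x y z h h')
    (fun x y _ _ h => by rwa [hD.gp_comm]) hx hy
  exact absurd (hR x p y hb) (not_le.2 key)

end TreeLike

/-- Every connected set that joins the ends of a geodesic comes within `B` of its points. -/
theorem IsQuasitree.exists_bottleneck (hT : IsQuasitree T) :
    ∃ B : ℝ, 0 ≤ B ∧ ∀ x p y : T, dist x p + dist p y = dist x y →
      ∀ Z : Set T, IsPreconnected Z → x ∈ Z → y ∈ Z → ∃ z ∈ Z, dist z p ≤ B := by
  obtain ⟨D, lam, c, hD⟩ := hT.exists_treeLike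
  exact hD.exists_bottleneck hT.1

/-- The bottleneck property makes triangles `B`-slim. The point `q` of a geodesic from `x` to `z`
where the sides towards `p` part is within `2 * B` of realising the Gromov product; a point `q'` of
another side, within `B` of `q`, is at least as far from `p` as one of the two other products. -/
theorem Geodesic.hyperbolic_of_bottleneck (hT : Geodesic T) {B : ℝ}
    (hB : ∀ x p y : T, dist x p + dist p y = dist x y →
      ∀ Z : Set T, IsPreconnected Z → x ∈ Z → y ∈ Z → ∃ z ∈ Z, dist z p ≤ B) :
    Hyperbolic T (3 * B) := by
  have slim : ∀ x y z q : T, dist x q + dist q z = dist x z → ∃ q', dist q' q ≤ B ∧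
      (dist x q' + dist q' y = dist x y ∨ dist y q' + dist q' z = dist y z) := by
    intro x y z q hq
    obtain ⟨Z, hZ, hxZ, hyZ, hZb, -⟩ := hT.exists_segment x y
    obtain ⟨Y, hY, hyY, hzY, hYb, -⟩ := hT.exists_segment y z
    obtain ⟨q', hq', hd⟩ := hB x q z hq (Z ∪ Y) (hZ.union y hyZ hyY hY) (Or.inl hxZ) (Or.inr hzY)
    exact ⟨q', hd, hq'.imp (hZb q') (hYb q')⟩
  intro x y z p
  have hr : (dist x z + dist x p - dist z p) / 2 ∈ Set.Icc 0 (dist x z) := by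
    have h1 := dist_triangle z x p
    have h2 := dist_triangle x z p
    rw [dist_comm z x] at h1
    exact ⟨by linarith, by linarith⟩
  obtain ⟨Z, -, -, -, hZb, -, hZr⟩ := hT.exists_segment x z
  obtain ⟨q, hqZ, hq⟩ := hZr _ hr
  have hqb := hZb q hqZ
  have hqp : dist q p ≤ gromovProduct x z p + 2 * B := by
    unfold gromovProduct
    obtain ⟨q', hd, h | h⟩ := slim x p z q hqb
    · have h1 := dist_triangle x q' q
      have h2 := dist_triangle q q' p
      rw [dist_comm q q'] at h2
      linarith
    · have h1 := dist_triangle q q' z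
      have h2 := dist_triangle q q' p
      rw [dist_comm q q'] at h1 h2
      rw [dist_comm p q', dist_comm p z] at h
      linarith
  obtain ⟨q', hd, h⟩ := slim x y z q hqb
  have hq'p := dist_triangle q' q p
  have : min (gromovProduct x y p) (gromovProduct y z p) ≤ dist q' p := by
    unfold gromovProduct
    rcases h with h | h
    · refine (min_le_left _ _).trans ?_
      have h1 := dist_triangle x q' p
      have h2 := dist_triangle y q' p
      rw [dist_comm y q'] at h2
      linarith
    · refine (min_le_right _ _).trans ?_
      have h1 := dist_triangle y q' p
      have h2 := dist_triangle z q' p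
      rw [dist_comm z q'] at h2
      linarith
  linarith

theorem IsQuasitree.exists_isAdmissibleRadius (hT : IsQuasitree T) :
    ∃ K₀ : ℝ, ∀ K ≥ K₀, IsAdmissibleRadius T K := by
  obtain ⟨B, hB0, hB⟩ := hT.exists_bottleneck
  -- The factor 300 is 100 times the hyperbolicity constant `3 * B`; for the separation property, `K
  -- ≥ B` is enough.
  refine ⟨300 * B + 1, fun K hK => ⟨⟨3 * B, hT.1.hyperbolic_of_bottleneck hB, by linarith⟩, ?_⟩⟩
  intro x y p hb hx hy hmem
  obtain ⟨z, hz, hd⟩ := hB x p y hb _ isPreconnected_connectedComponentIn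
    (mem_connectedComponentIn hx) hmem
  have := connectedComponentIn_subset _ _ hz
  rw [Set.mem_compl_iff, Metric.mem_closedBall] at this
  linarith

end Quasitree

/-! ### Walls and ultrafilters -/

namespace Wall

variable {S : Type*} {h k l e : Wall S} {A B : Set S}

theorem isHalf_ofSet : (ofSet A).IsHalf B ↔ B = A ∨ B = Aᶜ := by
  simp [IsHalf, ofSet]

theorem eq_ofSet (hA : h.IsHalf A) : h = ofSet A := by
  obtain ⟨B, hB⟩ := h.2
  apply Subtype.ext
  change h.1 = {A, Aᶜ}
  unfold IsHalf at hA
  rw [hB] at hA ⊢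
  rcases hA with rfl | hA
  · rfl
  · rw [Set.mem_singleton_iff] at hA
    subst hA
    rw [compl_compl, Set.pair_comm]

theorem IsHalf.compl (hA : h.IsHalf A) : h.IsHalf Aᶜ := by
  rw [eq_ofSet hA, isHalf_ofSet]
  exact Or.inr rfl

theorem IsHalf.eq_or_eq_compl (hA : h.IsHalf A) (hB : h.IsHalf B) : B = A ∨ B = Aᶜ := by
  rwa [eq_ofSet hA, isHalf_ofSet] at hB

theorem eq_of_isHalf (hA : h.IsHalf A) (hk : k.IsHalf A) : h = k := by
  rw [eq_ofSet hA, eq_ofSet hk]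

theorem exists_isHalf (h : Wall S) : ∃ A, h.IsHalf A := by
  obtain ⟨A, hA⟩ := h.2
  exact ⟨A, by unfold IsHalf; rw [hA]; exact Or.inl rfl⟩

theorem halfAt_eq_iff (hA : h.IsHalf A) (s t : S) :
    h.halfAt s = h.halfAt t ↔ (s ∈ A ↔ t ∈ A) := by
  have hs : ∀ s, s ∈ A → h.halfAt s = A := fun s hs => (h.eq_halfAt s A hA hs).symm
  have hs' : ∀ s, s ∉ A → h.halfAt s = Aᶜ := fun s hs => (h.eq_halfAt s Aᶜ hA.compl hs).symm
  have hne : A ≠ Aᶜ := fun heq => by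
    by_cases h : s ∈ A
    · exact (heq ▸ h : s ∈ Aᶜ) h
    · exact h (heq.symm ▸ (show s ∈ Aᶜ from h))
  by_cases h1 : s ∈ A <;> by_cases h2 : t ∈ A
  · simp [hs _ h1, hs _ h2, h1, h2]
  · simp [hs _ h1, hs' _ h2, h1, h2, hne]
  · simp [hs' _ h1, hs _ h2, h1, h2, hne.symm]
  · simp [hs' _ h1, hs' _ h2, h1, h2]

theorem isHalf_comap {S' : Type*} {f : S' → S} {B : Set S'} :
    (h.comap f).IsHalf B ↔ ∃ A, h.IsHalf A ∧ f ⁻¹' A = B :=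
  Iff.rfl

theorem IsHalf.comap {S' : Type*} (f : S' → S) (hA : h.IsHalf A) : (h.comap f).IsHalf (f ⁻¹' A) :=
  ⟨A, hA, rfl⟩

theorem halfAt_comap_eq_iff {S' : Type*} (f : S' → S) (s t : S') :
    (h.comap f).halfAt s = (h.comap f).halfAt t ↔ h.halfAt (f s) = h.halfAt (f t) := by
  rw [halfAt_eq_iff ((h.halfAt_isHalf (f s)).comap f), halfAt_eq_iff (h.halfAt_isHalf (f s))]
  rfl

theorem Crosses.symm (hhk : h.Crosses k) : k.Crosses h := fun A B hA hB => by
  rw [Set.inter_comm]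
  exact hhk B A hB hA

theorem not_crosses_of_subset (hA : h.IsHalf A) (hB : k.IsHalf B) (hAB : A ⊆ B) :
    ¬ h.Crosses k := fun hc => by
  obtain ⟨s, hs, hs'⟩ := hc A Bᶜ hA hB.compl
  exact hs' (hAB hs)

theorem Crosses.between {C : Set S} (hh : l.Crosses h) (hk : l.Crosses k) (hA : h.IsHalf A)
    (hB : e.IsHalf B) (hC : k.IsHalf C) (hAB : A ⊆ B) (hBC : B ⊆ C) : l.Crosses e := by
  intro P Q hP hQ
  rcases hB.eq_or_eq_compl hQ with rfl | rfl
  · exact (hh P A hP hA).mono (Set.inter_subset_inter_right _ hAB)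
  · exact (hk P Cᶜ hP hC.compl).mono
      (Set.inter_subset_inter_right _ (Set.compl_subset_compl.2 hBC))

end Wall

theorem IsWallChain.not_crosses {S : Type*} {c : Set (Wall S)} (hc : IsWallChain c) {h k : Wall S}
    (hh : h ∈ c) (hk : k ∈ c) : ¬ h.Crosses k := by
  obtain ⟨o, ho, hn⟩ := hc
  rcases hn h hh k hk with h1 | h1
  · exact Wall.not_crosses_of_subset (ho h hh) (ho k hk) h1
  · exact fun hc => Wall.not_crosses_of_subset (ho k hk) (ho h hh) h1 hc.symm

namespace WallUltrafilter

variable {S : Type*} {W : Set (Wall S)}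

open Classical in
/-- The chosen halfspace of a wall, `∅` for walls outside `W`. -/
noncomputable def side (x : WallUltrafilter W) (h : Wall S) : Set S :=
  if hh : h ∈ W then x.half ⟨h, hh⟩ else ∅

theorem side_of_mem (x : WallUltrafilter W) {h : Wall S} (hh : h ∈ W) :
    x.side h = x.half ⟨h, hh⟩ := dif_pos hh

theorem isHalf_side (x : WallUltrafilter W) {h : Wall S} (hh : h ∈ W) : h.IsHalf (x.side h) := by
  rw [x.side_of_mem hh]
  exact x.isHalf ⟨h, hh⟩

theorem side_upward (x : WallUltrafilter W) {h k : Wall S} (hh : h ∈ W) (hk : k ∈ W) {B : Set S}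
    (hB : k.IsHalf B) (hsub : x.side h ⊆ B) : x.side k = B := by
  rw [x.side_of_mem hk]
  rw [x.side_of_mem hh] at hsub
  exact x.upward ⟨h, hh⟩ ⟨k, hk⟩ B hB hsub

theorem side_eq_or (x y : WallUltrafilter W) {h : Wall S} (hh : h ∈ W) :
    y.side h = x.side h ∨ y.side h = (x.side h)ᶜ :=
  (x.isHalf_side hh).eq_or_eq_compl (y.isHalf_side hh)

theorem side_eq_compl (x y : WallUltrafilter W) {h : Wall S} (hh : h ∈ W)
    (hne : x.side h ≠ y.side h) : y.side h = (x.side h)ᶜ :=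
  (x.side_eq_or y hh).resolve_left (Ne.symm hne)

theorem side_principal {h : Wall S} (hh : h ∈ W) (s : S) :
    (principal W s).side h = h.halfAt s :=
  side_of_mem _ hh

/-- If the two chosen halfspaces were disjoint, the first would lie in the complement of the second,
which would then be chosen as well. -/
theorem side_inter_nonempty [Nonempty S] (x : WallUltrafilter W) {h k : Wall S} (hh : h ∈ W)
    (hk : k ∈ W) : (x.side h ∩ x.side k).Nonempty := by
  by_contra hcon
  rw [Set.not_nonempty_iff_eq_empty, ← Set.disjoint_iff_inter_eq_empty,
    Set.disjoint_left] at hcon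
  have h1 : x.side k = (x.side k)ᶜ :=
    x.side_upward hh hk (x.isHalf_side hk).compl fun s hs => hcon hs
  obtain ⟨s⟩ := ‹Nonempty S›
  by_cases hs : s ∈ x.side k
  · exact (h1 ▸ hs : s ∈ (x.side k)ᶜ) hs
  · exact hs (h1.symm ▸ (show s ∈ (x.side k)ᶜ from hs))

theorem side_nonempty [Nonempty S] (x : WallUltrafilter W) {h : Wall S} (hh : h ∈ W) :
    (x.side h).Nonempty :=
  (x.side_inter_nonempty hh hh).mono Set.inter_subset_left

theorem separates_iff {c : Set (Wall S)} (hc : c ⊆ W) {x y : WallUltrafilter W} :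
    Separates c x y ↔ ∀ h ∈ c, x.side h ≠ y.side h := by
  constructor
  · intro h k hk
    rw [x.side_of_mem (hc hk), y.side_of_mem (hc hk)]
    exact h ⟨k, hc hk⟩ hk
  · intro h k hk
    have := h k.1 hk
    rwa [x.side_of_mem k.2, y.side_of_mem k.2] at this

/-- Two noncrossing walls that separate `x` from `y` are nested in the order from `x` to `y`. -/
theorem side_subset_or_subset [Nonempty S] (x y : WallUltrafilter W) {h k : Wall S} (hh : h ∈ W)
    (hk : k ∈ W) (hxy : x.side h ≠ y.side h) (hxy' : x.side k ≠ y.side k) (hc : ¬ h.Crosses k) :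
    x.side h ⊆ x.side k ∨ x.side k ⊆ x.side h := by
  unfold Wall.Crosses at hc
  push Not at hc
  obtain ⟨A, B, hA, hB, hAB⟩ := hc
  rw [← Set.disjoint_iff_inter_eq_empty, Set.disjoint_left] at hAB
  have h1 := x.side_inter_nonempty hh hk
  have h2 := y.side_inter_nonempty hh hk
  rw [x.side_eq_compl y hh hxy, x.side_eq_compl y hk hxy'] at h2
  rcases (x.isHalf_side hh).eq_or_eq_compl hA with rfl | rfl <;>
    rcases (x.isHalf_side hk).eq_or_eq_compl hB with rfl | rfl
  · obtain ⟨s, hs, hs'⟩ := h1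
    exact absurd hs' (hAB hs)
  · exact Or.inl fun s hs => by_contra fun hs' => hAB hs hs'
  · exact Or.inr fun s hs => by_contra fun hs' => hAB hs' hs
  · obtain ⟨s, hs, hs'⟩ := h2
    exact absurd hs' (hAB hs)

theorem side_total [Nonempty S] (x y : WallUltrafilter W) {c : Set (Wall S)} (hcW : c ⊆ W)
    (hc : IsWallChain c) (hs : Separates c x y) {h k : Wall S} (hh : h ∈ c) (hk : k ∈ c) :
    x.side h ⊆ x.side k ∨ x.side k ⊆ x.side h :=
  x.side_subset_or_subset y (hcW hh) (hcW hk) ((separates_iff hcW).1 hs h hh)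
    ((separates_iff hcW).1 hs k hk) (hc.not_crosses hh hk)

theorem eq_of_side_eq (x : WallUltrafilter W) {h k : Wall S} (hh : h ∈ W) (hk : k ∈ W)
    (heq : x.side h = x.side k) : h = k :=
  Wall.eq_of_isHalf (x.isHalf_side hh) (heq ▸ x.isHalf_side hk)

theorem exists_greatest [Nonempty S] (x y : WallUltrafilter W) {c : Set (Wall S)} (hcW : c ⊆ W)
    (hc : IsWallChain c) (hs : Separates c x y) (hf : c.Finite) (hne : c.Nonempty) :
    ∃ k ∈ c, ∀ h ∈ c, x.side h ⊆ x.side k := by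
  obtain ⟨k, hk, hmax⟩ := hf.exists_maximalFor x.side c hne
  refine ⟨k, hk, fun h hh => ?_⟩
  rcases x.side_total y hcW hc hs hh hk with h1 | h1
  · exact h1
  · exact hmax hh h1

theorem exists_least [Nonempty S] (x y : WallUltrafilter W) {c : Set (Wall S)} (hcW : c ⊆ W)
    (hc : IsWallChain c) (hs : Separates c x y) (hf : c.Finite) (hne : c.Nonempty) :
    ∃ k ∈ c, ∀ h ∈ c, x.side k ⊆ x.side h := by
  obtain ⟨k, hk, hmax⟩ := hf.exists_minimalFor x.side c hne
  refine ⟨k, hk, fun h hh => ?_⟩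
  rcases x.side_total y hcW hc hs hk hh with h1 | h1
  · exact h1
  · exact hmax hh h1

/-- Walls that cut four ultrafilters into four quarters cross. -/
theorem crosses_of_four [Nonempty S] (x y z t : WallUltrafilter W) {h k : Wall S} (hh : h ∈ W)
    (hk : k ∈ W) (h1 : y.side h = x.side h) (h2 : y.side k ≠ x.side k) (h3 : z.side h ≠ x.side h)
    (h4 : z.side k = x.side k) (h5 : t.side h ≠ x.side h) (h6 : t.side k ≠ x.side k) :
    h.Crosses k := by
  intro A B hA hB
  have e2 := x.side_eq_compl y hk h2.symm
  have e3 := x.side_eq_compl z hh h3.symm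
  have e5 := x.side_eq_compl t hh h5.symm
  have e6 := x.side_eq_compl t hk h6.symm
  rcases (x.isHalf_side hh).eq_or_eq_compl hA with rfl | rfl <;>
    rcases (x.isHalf_side hk).eq_or_eq_compl hB with rfl | rfl
  · exact x.side_inter_nonempty hh hk
  · rw [← e2, ← h1]; exact y.side_inter_nonempty hh hk
  · rw [← e3, ← h4]; exact z.side_inter_nonempty hh hk
  · rw [← e5, ← e6]; exact t.side_inter_nonempty hh hk

open Classical in
/-- The median of three ultrafilters: each wall is oriented by majority. -/
noncomputable def median (x y z : WallUltrafilter W) : WallUltrafilter W where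
  half h := if x.half h = y.half h then x.half h else z.half h
  isHalf h := by split_ifs; exacts [x.isHalf h, z.isHalf h]
  -- A majority halfspace is chosen by two of the three ultrafilters, and these two also choose `B`.
  upward h k B hB hsub := by
    have two : ∀ u v : WallUltrafilter W, u.half h ⊆ B → v.half h ⊆ B →
        u.half k = B ∧ v.half k = B := fun u v hu hv =>
      ⟨u.upward h k B hB hu, v.upward h k B hB hv⟩
    by_cases hxy : x.half h = y.half h
    · rw [if_pos hxy] at hsub
      obtain ⟨h1, h2⟩ := two x y hsub (hxy ▸ hsub)
      rw [if_pos (h1.trans h2.symm), h1]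
    · rw [if_neg hxy] at hsub
      have hz : z.half k = B := z.upward h k B hB hsub
      split_ifs with hk
      · rcases (x.isHalf h).eq_or_eq_compl (z.isHalf h) with h1 | h1
        · exact x.upward h k B hB (h1 ▸ hsub)
        · have h2 : y.half h = (x.half h)ᶜ :=
            ((x.isHalf h).eq_or_eq_compl (y.isHalf h)).resolve_left (Ne.symm hxy)
          rw [hk]
          exact y.upward h k B hB (by rwa [h2, ← h1])
      · exact hz

theorem side_median_of_eq (x y z : WallUltrafilter W) {h : Wall S} (hh : h ∈ W)
    (hxy : x.side h = y.side h) : (median x y z).side h = x.side h := by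
  rw [x.side_of_mem hh, y.side_of_mem hh] at hxy
  rw [x.side_of_mem hh, side_of_mem _ hh]
  exact if_pos hxy

theorem side_median_of_ne (x y z : WallUltrafilter W) {h : Wall S} (hh : h ∈ W)
    (hxy : x.side h ≠ y.side h) : (median x y z).side h = z.side h := by
  rw [x.side_of_mem hh, y.side_of_mem hh] at hxy
  rw [z.side_of_mem hh, side_of_mem _ hh]
  exact if_neg hxy

theorem median_comm (x y z : WallUltrafilter W) : median x y z = median y x z := by
  apply WallUltrafilter.ext
  funext h
  simp only [median]
  by_cases hxy : x.half h = y.half h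
  · rw [if_pos hxy, if_pos hxy.symm, hxy]
  · rw [if_neg hxy, if_neg (Ne.symm hxy)]

theorem median_rotate (x y z : WallUltrafilter W) : median x y z = median y z x := by
  apply WallUltrafilter.ext
  funext h
  simp only [median]
  rcases (x.isHalf h).eq_or_eq_compl (y.isHalf h) with h1 | h1 <;>
    rcases (x.isHalf h).eq_or_eq_compl (z.isHalf h) with h2 | h2 <;> rw [h1, h2]
  all_goals simp
  exact fun h3 => h3.symm

end WallUltrafilter

/-! ### Duals of gluable systems -/

namespace WallSystem

open WallUltrafilter

variable {S : Type*} {𝒟 : WallSystem S}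

theorem encard_le_edist {u v : WallUltrafilter 𝒟.walls} {c : Set (Wall S)} (hc : c ∈ 𝒟.coll)
    (hs : Separates c u v) : c.encard ≤ 𝒟.edist u v :=
  le_iSup₂_of_le c ⟨hc, hs⟩ le_rfl

theorem finite_of_separates {u v : WallUltrafilter 𝒟.walls} (huv : 𝒟.edist u v < ⊤)
    {c : Set (Wall S)} (hc : c ∈ 𝒟.coll) (hs : Separates c u v) : c.Finite :=
  Set.encard_lt_top_iff.1 ((encard_le_edist hc hs).trans_lt huv)

theorem edist_le_edist {u v u' v' : WallUltrafilter 𝒟.walls}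
    (h : ∀ c ∈ 𝒟.coll, Separates c u v → Separates c u' v') : 𝒟.edist u v ≤ 𝒟.edist u' v' :=
  iSup₂_le fun c hc => encard_le_edist hc.1 (h c hc.1 hc.2)

/-- The largest cardinality of a chain between `x` and `w`, when `w` separates `x` from `y`. -/
noncomputable def depth (x y : WallUltrafilter 𝒟.walls) (w : Wall S) : ℕ∞ :=
  ⨆ c ∈ {c | c ∈ 𝒟.coll ∧ Separates c x y ∧ ∀ h ∈ c, x.side h ⊆ x.side w}, c.encard

/-! ### Interpolating between two ultrafilters by depth. -/

section Depth

variable {x y : WallUltrafilter 𝒟.walls} {w w' : Wall S}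

theorem depth_mono (h : x.side w ⊆ x.side w') : depth x y w ≤ depth x y w' :=
  iSup₂_le fun c hc => le_iSup₂_of_le (f := fun c _ => c.encard) c
    ⟨hc.1, hc.2.1, fun k hk => (hc.2.2 k hk).trans h⟩ le_rfl

theorem le_depth {c : Set (Wall S)} (hc : c ∈ 𝒟.coll) (hs : Separates c x y)
    (h : ∀ k ∈ c, x.side k ⊆ x.side w) : c.encard ≤ depth x y w :=
  le_iSup₂_of_le (f := fun c _ => c.encard) c ⟨hc, hs, h⟩ le_rfl

theorem depth_le_edist : depth x y w ≤ 𝒟.edist x y :=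
  iSup₂_le fun _ hc => encard_le_edist hc.1 hc.2.1

theorem one_le_depth (hw : w ∈ 𝒟.walls) (h : x.side w ≠ y.side w) : 1 ≤ depth x y w := by
  rw [← Set.encard_singleton w]
  have hs : ({w} : Set (Wall S)) ⊆ 𝒟.walls := Set.singleton_subset_iff.2 hw
  refine le_depth (𝒟.singleton_mem w hw) ((separates_iff hs).2 ?_) ?_
  · rintro k rfl
    exact h
  · rintro k rfl
    exact subset_rfl

open Classical in
/-- The ultrafilter at depth `r` between `x` and `y`. -/
noncomputable def interpolate (x y : WallUltrafilter 𝒟.walls) (r : ℕ) :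
    WallUltrafilter 𝒟.walls where
  half w := if depth x y w.1 ≤ r then y.half w else x.half w
  isHalf w := by split_ifs; exacts [y.isHalf w, x.isHalf w]
  upward h k B hB hsub := by
    -- Depth is monotone in the side of `x`, so the walls switched to `y` form an initial segment in
    -- the order from `x` to `y`. This rules out the mixed cases in which `h` and `k` both separate
    -- `x` from `y`.
    have hx : ∀ {A}, x.half h ⊆ A → k.1.IsHalf A → x.half k = A := fun ha hA =>
      x.upward h k _ hA ha
    have hy : ∀ {A}, y.half h ⊆ A → k.1.IsHalf A → y.half k = A := fun ha hA =>
      y.upward h k _ hA ha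
    have hmono : x.half h ⊆ x.half k → depth x y h.1 ≤ depth x y k.1 := fun hs =>
      depth_mono (by rwa [x.side_of_mem h.2, x.side_of_mem k.2])
    have hmono' : x.half k ⊆ x.half h → depth x y k.1 ≤ depth x y h.1 := fun hs =>
      depth_mono (by rwa [x.side_of_mem h.2, x.side_of_mem k.2])
    split_ifs at hsub with h1
    · have hyB := hy hsub hB
      split_ifs with h2
      · exact hyB
      rcases (x.isHalf h).eq_or_eq_compl (y.isHalf h) with e | e
      · exact hx (e ▸ hsub) hB
      rcases (x.isHalf k).eq_or_eq_compl (y.isHalf k) with e' | e'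
      · rw [← e', hyB]
      · refine absurd ((hmono' ?_).trans h1) h2
        rw [e, ← hyB, e'] at hsub
        exact Set.compl_subset_compl.1 hsub
    · have hxB := hx hsub hB
      split_ifs with h2
      · rcases (x.isHalf h).eq_or_eq_compl (y.isHalf h) with e | e
        · exact hy (e ▸ hsub) hB
        exact absurd ((hmono (hxB.symm ▸ hsub)).trans h2) h1
      · exact hxB

theorem interpolate_side_of_le {r : ℕ} (hw : w ∈ 𝒟.walls) (h : depth x y w ≤ r) :
    (interpolate x y r).side w = y.side w := by
  rw [side_of_mem _ hw, side_of_mem _ hw]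
  exact if_pos h

theorem interpolate_side_of_lt {r : ℕ} (hw : w ∈ 𝒟.walls) (h : r < depth x y w) :
    (interpolate x y r).side w = x.side w := by
  rw [side_of_mem _ hw, side_of_mem _ hw]
  exact if_neg (not_le.2 h)

theorem interpolate_side_ne {r s : ℕ} (hrs : r ≤ s) (hw : w ∈ 𝒟.walls)
    (h : (interpolate x y r).side w ≠ (interpolate x y s).side w) :
    x.side w ≠ y.side w ∧ r < depth x y w ∧ depth x y w ≤ s := by
  have hrs' : (r : ℕ∞) ≤ s := by exact_mod_cast hrs
  rcases le_or_gt (depth x y w) r with h1 | h1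
  · rw [interpolate_side_of_le hw h1, interpolate_side_of_le hw (h1.trans hrs')] at h
    exact absurd rfl h
  · rcases le_or_gt (depth x y w) s with h2 | h2
    · rw [interpolate_side_of_lt hw h1, interpolate_side_of_le hw h2] at h
      exact ⟨h, h1, h2⟩
    · rw [interpolate_side_of_lt hw h1, interpolate_side_of_lt hw h2] at h
      exact absurd rfl h

theorem ext_side {u v : WallUltrafilter 𝒟.walls} (h : ∀ w ∈ 𝒟.walls, u.side w = v.side w) :
    u = v := by
  apply WallUltrafilter.ext
  funext w
  have := h w.1 w.2
  rwa [side_of_mem _ w.2, side_of_mem _ w.2] at this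

theorem interpolate_zero : interpolate x y 0 = x := by
  refine ext_side fun w hw => ?_
  by_cases h : x.side w = y.side w
  · rcases le_or_gt (depth x y w) (0 : ℕ) with h1 | h1
    · rw [interpolate_side_of_le hw h1, h]
    · rw [interpolate_side_of_lt hw h1]
  · refine interpolate_side_of_lt hw ?_
    exact lt_of_lt_of_le (by simp) (one_le_depth hw h)

theorem interpolate_eq_right {n : ℕ} (h : 𝒟.edist x y ≤ n) : interpolate x y n = y :=
  ext_side fun _ hw => interpolate_side_of_le hw (depth_le_edist.trans h)

theorem separates_of_interpolate {r s : ℕ} (hrs : r ≤ s) {c : Set (Wall S)} (hc : c ∈ 𝒟.coll)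
    (h : Separates c (interpolate x y r) (interpolate x y s)) : Separates c x y := by
  have hcW := 𝒟.subset_walls c hc
  rw [separates_iff hcW] at h ⊢
  exact fun w hw => (interpolate_side_ne hrs (hcW hw) (h w hw)).1

theorem edist_interpolate_le {r : ℕ} : 𝒟.edist x (interpolate x y r) ≤ 𝒟.edist x y := by
  refine edist_le_edist fun c hc hs => ?_
  refine separates_of_interpolate (Nat.zero_le r) hc ?_
  rwa [interpolate_zero]

end Depth

variable [Nonempty S]

theorem dist_eq_toNat (x y : 𝒟.Dual) : dist x y = ((𝒟.edist x.1 y.1).toNat : ℝ) := rfl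

theorem finite_of_separates_dual {x y : 𝒟.Dual} {c : Set (Wall S)} (hc : c ∈ 𝒟.coll)
    (hs : Separates c x.1 y.1) : c.Finite :=
  finite_of_separates (edist_lt_top x y) hc hs

theorem ncard_le_dist {x y : 𝒟.Dual} {c : Set (Wall S)} (hc : c ∈ 𝒟.coll)
    (hs : Separates c x.1 y.1) : (c.ncard : ℝ) ≤ dist x y := by
  rw [dist_eq_toNat, Set.ncard]
  exact_mod_cast ENat.toNat_le_toNat (encard_le_edist hc hs) (edist_lt_top x y).ne

theorem exists_ncard_eq_dist (h0 : ∅ ∈ 𝒟.coll) (x y : 𝒟.Dual) :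
    ∃ c ∈ 𝒟.coll, Separates c x.1 y.1 ∧ (c.ncard : ℝ) = dist x y := by
  have hlt := edist_lt_top x y
  have heq : 𝒟.edist x.1 y.1 =
      ⨆ c : {c | c ∈ 𝒟.coll ∧ Separates c x.1 y.1}, c.1.encard := by
    unfold edist
    rw [iSup_subtype']
  have : Nonempty {c | c ∈ 𝒟.coll ∧ Separates c x.1 y.1} := ⟨⟨∅, h0, fun h hh => hh.elim⟩⟩
  obtain ⟨c, hc⟩ := ENat.exists_eq_iSup_of_lt_top (heq ▸ hlt)
  refine ⟨c.1, c.2.1, c.2.2, ?_⟩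
  rw [dist_eq_toNat, heq, ← hc, Set.ncard]

theorem dist_le_of_forall (h0 : ∅ ∈ 𝒟.coll) {x y : 𝒟.Dual} {r : ℝ}
    (h : ∀ c ∈ 𝒟.coll, Separates c x.1 y.1 → (c.ncard : ℝ) ≤ r) : dist x y ≤ r := by
  obtain ⟨c, hc, hs, heq⟩ := exists_ncard_eq_dist h0 x y
  rw [← heq]
  exact h c hc hs

/-- Chains of the system are `L`-chains that can be glued up to deleting `M` elements. -/
structure IsGluable (𝒟 : WallSystem S) (L M : ℕ) : Prop where
  empty_mem : ∅ ∈ 𝒟.coll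
  chain : ∀ c ∈ 𝒟.coll, IsWallChain c
  sep : ∀ c ∈ 𝒟.coll, ∀ h ∈ c, ∀ k ∈ c, h ≠ k → ∀ d ∈ 𝒟.coll,
    (∀ l ∈ d, l.Crosses h ∧ l.Crosses k) → d.encard ≤ L
  glue : ∀ x y : WallUltrafilter 𝒟.walls, ∀ c ∈ 𝒟.coll, ∀ c' ∈ 𝒟.coll, c.Finite → c'.Finite →
    Separates c x y → Separates c' x y → (∀ h ∈ c, ∀ k ∈ c', x.side h ⊆ x.side k) →
    ∃ e ∈ 𝒟.coll, e ⊆ c ∪ c' ∧ c.ncard + c'.ncard ≤ e.ncard + M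

section Depth

variable {x y : WallUltrafilter 𝒟.walls} {w w' : Wall S}

/-- The first wall of `c` has depth more than `r`, so it is preceded by a chain of at least `r + 1`
walls. Gluing this chain to `c` loses at most `M` walls, and the result still lies below the last
wall of `c`, whose depth is at most `s`. -/
theorem IsGluable.ncard_add_le_of_interpolate {L M : ℕ} (h𝒟 : 𝒟.IsGluable L M)
    (hxy : 𝒟.edist x y < ⊤) {r s : ℕ} (hrs : r ≤ s) {c : Set (Wall S)} (hc : c ∈ 𝒟.coll)
    (hs : Separates c (interpolate x y r) (interpolate x y s)) (hne : c.Nonempty) :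
    c.ncard + (r + 1) ≤ s + M := by
  have hcW := 𝒟.subset_walls c hc
  have hsc := separates_of_interpolate hrs hc hs
  have hf := finite_of_separates hxy hc hsc
  obtain ⟨a, ha, hal⟩ := x.exists_least y hcW (h𝒟.chain c hc) hsc hf hne
  obtain ⟨b, hb, hbl⟩ := x.exists_greatest y hcW (h𝒟.chain c hc) hsc hf hne
  have h1 := (interpolate_side_ne hrs (hcW ha) ((separates_iff hcW).1 hs a ha)).2.1
  have h2 := (interpolate_side_ne hrs (hcW hb) ((separates_iff hcW).1 hs b hb)).2.2
  unfold depth at h1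
  simp only [lt_iSup_iff] at h1
  obtain ⟨c', ⟨hc', hsc', hca⟩, hlt⟩ := h1
  have hf' := finite_of_separates hxy hc' hsc'
  obtain ⟨e, he, hsub, hcard⟩ := h𝒟.glue x y c' hc' c hc hf' hf hsc' hsc
    fun h hh k hk => (hca h hh).trans (hal k hk)
  have hse : Separates e x y := by
    intro h hh
    rcases hsub hh with h3 | h3
    · exact hsc' h h3
    · exact hsc h h3
  have h4 : e.encard ≤ s := by
    refine (le_depth he hse fun k hk => ?_).trans h2
    rcases hsub hk with h3 | h3
    · exact (hca k h3).trans (hal b hb)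
    · exact hbl k h3
  have h5 : e.ncard ≤ s := by
    rw [← (hf'.union hf |>.subset hsub).cast_ncard_eq] at h4
    exact_mod_cast h4
  rw [← hf'.cast_ncard_eq] at hlt
  have h6 : r < c'.ncard := by exact_mod_cast hlt
  omega

end Depth

/-- The dual of a gluable system is roughly geodesic. -/
theorem IsGluable.roughlyGeodesic {L M : ℕ} (h𝒟 : 𝒟.IsGluable L M) (hM : 1 ≤ M) :
    RoughlyGeodesic 𝒟.Dual M := by
  intro x y
  set n := (𝒟.edist x.1 y.1).toNat with hn
  have hnd : dist x y = n := rfl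
  have hM' : (1 : ℝ) ≤ M := by exact_mod_cast hM
  let z : ℕ → 𝒟.Dual := fun r => ⟨interpolate x.1 y.1 r, fun s => by
    refine (edist_triangle _ x.1 _).trans_lt (WithTop.add_lt_top.2 ⟨?_, x.2 s⟩)
    rw [edist_comm]
    exact edist_interpolate_le.trans_lt (edist_lt_top x y)⟩
  have hz0 : z 0 = x := Subtype.ext interpolate_zero
  have hzn : z n = y := Subtype.ext (interpolate_eq_right (ENat.natCast_toNat (edist_lt_top x y).ne).ge)
  -- The hypothesis `1 ≤ M` is what covers the empty chain here, and equal floors below.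
  have hup : ∀ r s : ℕ, r < s → dist (z r) (z s) ≤ s - r + (M - 1) := by
    intro r s hrs
    have hrs' : (r : ℝ) < s := by exact_mod_cast hrs
    refine dist_le_of_forall h𝒟.empty_mem fun c hc hs => ?_
    rcases c.eq_empty_or_nonempty with rfl | hne
    · rw [Set.ncard_empty]
      push_cast
      linarith
    · have := h𝒟.ncard_add_le_of_interpolate (edist_lt_top x y) hrs.le hc hs hne
      have h' : ((c.ncard + (r + 1) : ℕ) : ℝ) ≤ (s + M : ℕ) := by exact_mod_cast this
      push_cast at h'
      linarith
  have hup0 : ∀ r : ℕ, dist x (z r) ≤ r := by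
    intro r
    refine dist_le_of_forall h𝒟.empty_mem fun c hc hs => ?_
    rcases c.eq_empty_or_nonempty with rfl | hne
    · simp
    have hcW := 𝒟.subset_walls c hc
    have hs' : Separates c (interpolate x.1 y.1 0) (interpolate x.1 y.1 r) := by
      rwa [interpolate_zero]
    have hsc := separates_of_interpolate (Nat.zero_le r) hc hs'
    have hf := finite_of_separates (edist_lt_top x y) hc hsc
    obtain ⟨b, hb, hbl⟩ := x.1.exists_greatest y.1 hcW (h𝒟.chain c hc) hsc hf hne
    have h2 := (interpolate_side_ne (Nat.zero_le r) (hcW hb)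
      ((separates_iff hcW).1 hs' b hb)).2.2
    have h4 : c.encard ≤ r := (le_depth hc hsc hbl).trans h2
    rw [← hf.cast_ncard_eq] at h4
    exact_mod_cast h4
  -- As the bound from `x` to `z r` has no error, the triangle inequality loses `M - 1` only once.
  -- The remaining 1 of the constant `M` pays for taking floors.
  have hlow : ∀ r s : ℕ, r < s → s ≤ n → s - r - (M - 1 : ℝ) ≤ dist (z r) (z s) := by
    intro r s hrs hsn
    have h1 := dist_triangle4 x (z r) (z s) y
    have h2 : dist (z s) y ≤ n - s + (M - 1) := by
      rcases hsn.eq_or_lt with rfl | hlt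
      · rw [hzn, dist_self]
        linarith
      · rw [← hzn]
        exact hup s n hlt
    have h3 := hup0 r
    rw [hnd] at h1
    linarith
  have key : ∀ s ∈ Set.Icc (0 : ℝ) n, ∀ t ∈ Set.Icc (0 : ℝ) n, s ≤ t →
      abs (dist (z ⌊s⌋₊) (z ⌊t⌋₊) - abs (s - t)) ≤ M := by
    intro s hs t ht hst
    have a1 := Nat.floor_le hs.1
    have a2 := Nat.lt_floor_add_one s
    have a3 := Nat.floor_le ht.1
    have a4 := Nat.lt_floor_add_one t
    rw [abs_of_nonpos (sub_nonpos.2 hst)]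
    rcases (Nat.floor_le_floor hst).eq_or_lt with h | h
    · rw [h] at a1 a2 ⊢
      rw [dist_self, abs_le]
      constructor <;> linarith
    · have h1 := hup _ _ h
      have h2 := hlow _ _ h (Nat.floor_le_of_le ht.2)
      rw [abs_le]
      constructor <;> linarith
  refine ⟨n, fun t => z ⌊t⌋₊, Nat.cast_nonneg n, by simp [hz0], by simp [hzn], ?_⟩
  intro s hs t ht
  rcases le_total s t with h | h
  · exact key s hs t ht h
  · rw [dist_comm, abs_sub_comm s t]
    exact key t ht s hs h

/-! ### Medians, Gromov products and hyperbolicity of the dual. -/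

section Median

/-- The median of three points of the dual. -/
noncomputable def dualMedian (x y z : 𝒟.Dual) : 𝒟.Dual :=
  ⟨median x.1 y.1 z.1, fun s => by
    refine (edist_triangle _ x.1 _).trans_lt (WithTop.add_lt_top.2 ⟨?_, x.2 s⟩)
    rw [edist_comm]
    refine (edist_le_edist fun c hc hs => ?_).trans_lt (edist_lt_top x y)
    have hcW := 𝒟.subset_walls c hc
    rw [separates_iff hcW] at hs ⊢
    intro h hh heq
    exact hs h hh (side_median_of_eq _ _ _ (hcW hh) heq).symm⟩

theorem dualMedian_comm (x y z : 𝒟.Dual) : dualMedian x y z = dualMedian y x z :=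
  Subtype.ext (median_comm _ _ _)

theorem dualMedian_rotate (x y z : 𝒟.Dual) : dualMedian x y z = dualMedian y z x :=
  Subtype.ext (median_rotate _ _ _)

/-- A wall separates `x` from the median if and only if it separates it from `y` and `z`. -/
theorem side_ne_median_iff {x y z : 𝒟.Dual} {w : Wall S} (hw : w ∈ 𝒟.walls) :
    x.1.side w ≠ (dualMedian x y z).1.side w ↔
      x.1.side w ≠ y.1.side w ∧ x.1.side w ≠ z.1.side w := by
  change x.1.side w ≠ (median x.1 y.1 z.1).side w ↔ _
  by_cases h : x.1.side w = y.1.side w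
  · rw [side_median_of_eq _ _ _ hw h]
    tauto
  · rw [side_median_of_ne _ _ _ hw h]
    tauto

theorem separates_median_iff {x y z : 𝒟.Dual} {c : Set (Wall S)} (hc : c ∈ 𝒟.coll) :
    Separates c x.1 (dualMedian x y z).1 ↔ Separates c x.1 y.1 ∧ Separates c x.1 z.1 := by
  have hcW := 𝒟.subset_walls c hc
  simp only [separates_iff hcW]
  constructor
  · exact fun h => ⟨fun w hw => ((side_ne_median_iff (hcW hw)).1 (h w hw)).1,
      fun w hw => ((side_ne_median_iff (hcW hw)).1 (h w hw)).2⟩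
  · exact fun h w hw => (side_ne_median_iff (hcW hw)).2 ⟨h.1 w hw, h.2 w hw⟩

/-- Chains realising the distances from `x` and from `y` to the median are glued into one chain from
`x` to `y`. The loss is the last wall `a` of the first chain, the at most `L` walls of the second
that cross both `a` and its predecessor `b`, and `M` for gluing. A remaining wall misses `a` or `b`,
so it is nested beyond `b`. -/
theorem IsGluable.dist_median_add_le {L M : ℕ} (h𝒟 : 𝒟.IsGluable L M) (x y z : 𝒟.Dual) :
    dist x (dualMedian x y z) + dist (dualMedian x y z) y ≤ dist x y + (L + 1 + M) := by
  obtain ⟨c, hc, hs, hcd⟩ := exists_ncard_eq_dist h𝒟.empty_mem x (dualMedian x y z)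
  obtain ⟨d, hd, hsd, hdd⟩ := exists_ncard_eq_dist h𝒟.empty_mem y (dualMedian x y z)
  rw [dist_comm _ y, ← hcd, ← hdd]
  rw [dualMedian_comm] at hsd
  obtain ⟨hs1, hs2⟩ := (separates_median_iff hc).1 hs
  obtain ⟨hsd1, hsd2⟩ := (separates_median_iff hd).1 hsd
  have hsd1' : Separates d x.1 y.1 := fun w hw => (hsd1 w hw).symm
  have hcW := 𝒟.subset_walls c hc
  have hdW := 𝒟.subset_walls d hd
  have hfc := finite_of_separates_dual hc hs1
  have hfd := finite_of_separates_dual hd hsd1'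
  have hd1 := ncard_le_dist hd hsd1'
  have hL0 : (0 : ℝ) ≤ L := Nat.cast_nonneg _
  have hM0 : (0 : ℝ) ≤ M := Nat.cast_nonneg _
  by_cases hc1 : c.ncard ≤ 1
  · have : (c.ncard : ℝ) ≤ 1 := by exact_mod_cast hc1
    linarith
  have hne : c.Nonempty := by
    rw [Set.nonempty_iff_ne_empty]
    rintro rfl
    simp at hc1
  obtain ⟨a, ha, hamax⟩ := x.1.exists_greatest y.1 hcW (h𝒟.chain c hc) hs1 hfc hne
  have hc' : c \ {a} ∈ 𝒟.coll := 𝒟.mem_of_subset c hc _ Set.sdiff_subset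
  have hs1' : Separates (c \ {a}) x.1 y.1 := fun w hw => hs1 w hw.1
  have hfc' : (c \ {a}).Finite := hfc.subset Set.sdiff_subset
  have hcard : (c \ {a}).ncard + 1 = c.ncard := Set.ncard_sdiff_singleton_add_one ha hfc
  have hne' : (c \ {a}).Nonempty := by
    rw [← Set.ncard_pos hfc']
    omega
  obtain ⟨b, hb, hbmax⟩ := x.1.exists_greatest y.1 (Set.sdiff_subset.trans hcW)
    (h𝒟.chain _ hc') hs1' hfc' hne'
  set d₁ := {l | l ∈ d ∧ l.Crosses a ∧ l.Crosses b} with hd₁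
  have hd₁c : d₁ ∈ 𝒟.coll := 𝒟.mem_of_subset d hd _ fun l hl => hl.1
  have hd₁L : d₁.encard ≤ L := h𝒟.sep c hc a ha b hb.1 (fun h => hb.2 h.symm) d₁ hd₁c
    fun l hl => hl.2
  have hd₁L' : d₁.ncard ≤ L := by
    rw [← (hfd.subset fun l hl => hl.1 : d₁.Finite).cast_ncard_eq] at hd₁L
    exact_mod_cast hd₁L
  have hd' : d \ d₁ ∈ 𝒟.coll := 𝒟.mem_of_subset d hd _ Set.sdiff_subset
  have hcard' : d.ncard ≤ (d \ d₁).ncard + d₁.ncard := by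
    rw [Set.ncard_sdiff_add_ncard_of_subset (fun l hl => hl.1) hfd]
  -- Noncrossing walls are nested, and `z` fixes the order: it is on the far side of `k` from `x`
  -- but on the side of `x` for `l`.
  have nest : ∀ k ∈ c, ∀ l ∈ d, ¬ l.Crosses k → x.1.side k ⊆ x.1.side l := by
    intro k hk l hl hcr
    rcases x.1.side_subset_or_subset y.1 (hcW hk) (hdW hl) ((separates_iff hcW).1 hs1 k hk)
      ((separates_iff hdW).1 hsd1' l hl) (fun h => hcr h.symm) with h1 | h1
    · exact h1
    · exfalso
      have e1 := x.1.side_eq_compl z.1 (hcW hk) ((separates_iff hcW).1 hs2 k hk)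
      have e2 : z.1.side l = x.1.side l := by
        have e3 := y.1.side_eq_compl z.1 (hdW hl) ((separates_iff hdW).1 hsd2 l hl)
        have e4 := y.1.side_eq_compl x.1 (hdW hl) ((separates_iff hdW).1 hsd1 l hl)
        rw [e3, e4]
      obtain ⟨s, hs, hs'⟩ := z.1.side_inter_nonempty (hcW hk) (hdW hl)
      rw [e1] at hs
      rw [e2] at hs'
      exact hs (h1 hs')
  obtain ⟨e, he, hsub, hcard''⟩ := h𝒟.glue x.1 y.1 _ hc' _ hd' hfc' (hfd.subset Set.sdiff_subset)
    hs1' (fun w hw => hsd1' w hw.1) (by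
      intro h hh k hk
      refine (hbmax h hh).trans ?_
      by_cases hcr : k.Crosses b
      · refine (hamax b hb.1).trans (nest a ha k hk.1 fun h => hk.2 ⟨hk.1, h, hcr⟩)
      · exact nest b hb.1 k hk.1 hcr)
  have hse : Separates e x.1 y.1 := by
    intro w hw
    rcases hsub hw with h | h
    · exact hs1' w h
    · exact hsd1' w h.1
  have h1 := ncard_le_dist he hse
  have h2 : ((c.ncard + d.ncard : ℕ) : ℝ) ≤ (e.ncard + (L + 1 + M) : ℕ) := by
    exact_mod_cast (by omega)
  push_cast at h2
  linarith

theorem IsGluable.abs_gromovProduct_sub_le {L M : ℕ} (h𝒟 : 𝒟.IsGluable L M) (x y p : 𝒟.Dual) :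
    |gromovProduct x y p - dist p (dualMedian p x y)| ≤ L + 1 + M := by
  have h1 := h𝒟.dist_median_add_le p x y
  have h2 := h𝒟.dist_median_add_le x y p
  have h3 := h𝒟.dist_median_add_le y p x
  rw [← dualMedian_rotate] at h2
  rw [dualMedian_rotate, ← dualMedian_rotate] at h3
  rw [dualMedian_rotate y p x] at h3
  set m := dualMedian p x y
  have t1 := dist_triangle p m x
  have t2 := dist_triangle x m y
  have t3 := dist_triangle y m p
  unfold gromovProduct
  rw [dist_comm m x] at *
  rw [dist_comm m y] at *
  rw [dist_comm m p] at *
  rw [dist_comm p x] at *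
  rw [abs_le]
  constructor <;> linarith

/-- The dual of a gluable system is hyperbolic. -/
theorem IsGluable.hyperbolic {L M : ℕ} (h𝒟 : 𝒟.IsGluable L M) :
    Hyperbolic 𝒟.Dual (2 * (L + 1 + M) + (L + 1)) := by
  intro x y z p
  have h1 := abs_le.1 (h𝒟.abs_gromovProduct_sub_le x y p)
  have h2 := abs_le.1 (h𝒟.abs_gromovProduct_sub_le y z p)
  have h3 := abs_le.1 (h𝒟.abs_gromovProduct_sub_le x z p)
  -- Replacing Gromov products by distances to medians, once on each side, costs `2 * (L + 1 + M)`.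
  suffices h : min (dist p (dualMedian p x y)) (dist p (dualMedian p y z)) ≤
      dist p (dualMedian p x z) + (L + 1) by
    rcases min_le_iff.1 h with h | h
    · have := min_le_left (gromovProduct x y p) (gromovProduct y z p)
      linarith
    · have := min_le_right (gromovProduct x y p) (gromovProduct y z p)
      linarith
  obtain ⟨c, hc, hs, hcd⟩ := exists_ncard_eq_dist h𝒟.empty_mem p (dualMedian p x y)
  obtain ⟨d, hd, hsd, hdd⟩ := exists_ncard_eq_dist h𝒟.empty_mem p (dualMedian p y z)
  rw [← hcd, ← hdd]
  have hcW := 𝒟.subset_walls c hc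
  have hdW := 𝒟.subset_walls d hd
  obtain ⟨hcx, hcy⟩ := (separates_median_iff hc).1 hs
  obtain ⟨hdy, hdz⟩ := (separates_median_iff hd).1 hsd
  have hfc := finite_of_separates_dual hc hcx
  have hfd := finite_of_separates_dual hd hdy
  rw [separates_iff hcW] at hcx hcy
  rw [separates_iff hdW] at hdy hdz
  -- the parts that separate `p` from all of `x`, `y`, `z`, and the rest
  set c₁ := {h | h ∈ c ∧ p.1.side h ≠ z.1.side h} with hc₁
  set c₂ := {h | h ∈ c ∧ p.1.side h = z.1.side h} with hc₂
  set d₁ := {h | h ∈ d ∧ p.1.side h ≠ x.1.side h} with hd₁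
  set d₂ := {h | h ∈ d ∧ p.1.side h = x.1.side h} with hd₂
  have hc₁c : c₁ ∈ 𝒟.coll := 𝒟.mem_of_subset c hc _ fun h hh => hh.1
  have hd₁c : d₁ ∈ 𝒟.coll := 𝒟.mem_of_subset d hd _ fun h hh => hh.1
  have hd₂c : d₂ ∈ 𝒟.coll := 𝒟.mem_of_subset d hd _ fun h hh => hh.1
  have k1 : (c₁.ncard : ℝ) ≤ dist p (dualMedian p x z) := by
    refine ncard_le_dist hc₁c ((separates_median_iff hc₁c).2 ?_)
    rw [separates_iff (𝒟.subset_walls _ hc₁c), separates_iff (𝒟.subset_walls _ hc₁c)]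
    exact ⟨fun h hh => hcx h hh.1, fun h hh => hh.2⟩
  have k2 : (d₁.ncard : ℝ) ≤ dist p (dualMedian p x z) := by
    refine ncard_le_dist hd₁c ((separates_median_iff hd₁c).2 ?_)
    rw [separates_iff (𝒟.subset_walls _ hd₁c), separates_iff (𝒟.subset_walls _ hd₁c)]
    exact ⟨fun h hh => hh.2, fun h hh => hdz h hh.1⟩
  -- The points `p`, `x`, `z`, `y` occupy the four quarters cut out by `k` and `h`. So if `c₂` has
  -- two elements, the `L`-chain condition bounds `d₂`.
  have hcross : ∀ k ∈ d₂, ∀ h ∈ c₂, k.Crosses h := by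
    intro k hk h hh
    exact p.1.crosses_of_four x.1 z.1 y.1 (hdW hk.1) (hcW hh.1) hk.2.symm (hcx h hh.1).symm
      (hdz k hk.1).symm hh.2.symm (hdy k hk.1).symm (hcy h hh.1).symm
  have hc_card : c.ncard ≤ c₁.ncard + c₂.ncard := by
    refine (Set.ncard_le_ncard (fun h hh => ?_) ((hfc.subset fun h hh => hh.1).union
      (hfc.subset fun h hh => hh.1))).trans (Set.ncard_union_le c₁ c₂)
    by_cases h' : p.1.side h = z.1.side h
    · exact Or.inr ⟨hh, h'⟩
    · exact Or.inl ⟨hh, h'⟩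
  have hd_card : d.ncard ≤ d₁.ncard + d₂.ncard := by
    refine (Set.ncard_le_ncard (fun h hh => ?_) ((hfd.subset fun h hh => hh.1).union
      (hfd.subset fun h hh => hh.1))).trans (Set.ncard_union_le d₁ d₂)
    by_cases h' : p.1.side h = x.1.side h
    · exact Or.inr ⟨hh, h'⟩
    · exact Or.inl ⟨hh, h'⟩
  have hL0 : (0 : ℝ) ≤ L := Nat.cast_nonneg _
  by_cases h2 : c₂.ncard ≤ 1
  · refine (min_le_left _ _).trans ?_
    have : (c.ncard : ℝ) ≤ c₁.ncard + 1 := by exact_mod_cast (by omega)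
    linarith
  · refine (min_le_right _ _).trans ?_
    have hf₂ : c₂.Finite := hfc.subset fun h hh => hh.1
    obtain ⟨a, b, ha, hb, hab⟩ := (Set.one_lt_ncard_iff hf₂).1 (not_le.1 h2)
    have hL := h𝒟.sep c hc a ha.1 b hb.1 hab d₂ hd₂c
      fun l hl => ⟨hcross l hl a ha, hcross l hl b hb⟩
    rw [← (hfd.subset fun l hl => hl.1 : d₂.Finite).cast_ncard_eq] at hL
    have hL' : d₂.ncard ≤ L := by exact_mod_cast hL
    have : (d.ncard : ℝ) ≤ d₁.ncard + L := by exact_mod_cast (by omega)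
    linarith

end Median

end WallSystem

/-! ### Four-point inequalities and counting -/

section Coarse

variable {X : Type*} [MetricSpace X] {δ : ℝ}

theorem Hyperbolic.four_point (hX : Hyperbolic X δ) (x y z p : X) :
    dist x z + dist y p ≤ max (dist x y + dist z p) (dist y z + dist x p) + 2 * δ := by
  have h := hX x y z p
  unfold gromovProduct at h
  have h' : min ((dist x p + dist y p - dist x y) / 2) ((dist y p + dist z p - dist y z) / 2) ≤
    (dist x p + dist z p - dist x z) / 2 + δ := by linarith
  have h1 := le_max_left (dist x y + dist z p) (dist y z + dist x p)
  have h2 := le_max_right (dist x y + dist z p) (dist y z + dist x p)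
  rcases min_le_iff.1 h' with h' | h' <;> linarith

/-- In the four-point inequality for `a`, `u`, `b`, `v`, betweenness makes both sums on the right
nearly `dist a b` when `u` and `v` are at similar distances from `b`. -/
theorem Hyperbolic.dist_le_of_between (hX : Hyperbolic X δ) {a b u v : X} {C E : ℝ}
    (hu : dist a u + dist u b ≤ dist a b + C) (hv : dist a v + dist v b ≤ dist a b + C)
    (hE : |dist u b - dist v b| ≤ E) : dist u v ≤ C + E + 2 * δ := by
  have h := hX.four_point a u b v
  have hE' := abs_le.1 hE
  rw [dist_comm b v] at h
  rcases le_total (dist a u + dist v b) (dist u b + dist a v) with h1 | h1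
  · rw [max_eq_right h1] at h
    linarith
  · rw [max_eq_left h1] at h
    linarith

theorem ncard_le_of_separated {ι : Type*} {e : Set ι} (t : ι → ℝ) {R s : ℝ}
    (hs : 0 < s) (hR : 0 ≤ R) (h0 : ∀ i ∈ e, 0 ≤ t i) (h1 : ∀ i ∈ e, t i ≤ R)
    (h2 : ∀ i ∈ e, ∀ j ∈ e, i ≠ j → s ≤ |t i - t j|) : (e.ncard : ℝ) ≤ R / s + 1 := by
  have hmaps : ∀ i ∈ e, ⌊t i / s⌋₊ ∈ Set.Iio (⌊R / s⌋₊ + 1) := fun i hi =>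
    Nat.lt_succ_of_le (Nat.floor_le_floor (div_le_div_of_nonneg_right (h1 i hi) hs.le))
  have hinj : Set.InjOn (fun i => ⌊t i / s⌋₊) e := by
    intro i hi j hj hij
    by_contra hne
    have h3 := h2 i hi j hj hne
    have hij' : (⌊t i / s⌋₊ : ℝ) = ⌊t j / s⌋₊ := by exact_mod_cast hij
    have a1 := Nat.floor_le (div_nonneg (h0 i hi) hs.le)
    have a2 := Nat.lt_floor_add_one (t i / s)
    have b1 := Nat.floor_le (div_nonneg (h0 j hj) hs.le)
    have b2 := Nat.lt_floor_add_one (t j / s)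
    have h4 : |t i / s - t j / s| < 1 := by
      rw [abs_lt]
      constructor <;> linarith
    rw [← sub_div, abs_div, abs_of_pos hs, div_lt_one hs] at h4
    linarith
  have h3 := Set.ncard_le_ncard_of_injOn _ hmaps hinj (Set.finite_Iio _)
  rw [← Finset.coe_Iio, Set.ncard_coe_finset, Nat.card_Iio] at h3
  have h4 : (e.ncard : ℝ) ≤ ⌊R / s⌋₊ + 1 := by exact_mod_cast h3
  exact h4.trans (by linarith [Nat.floor_le (div_nonneg hR hs.le)])

end Coarse

/-! ### Walls of geodesic spaces defined by balls -/

section BallWalls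

variable {T : Type w} [MetricSpace T] {K : ℝ} {p q : T} {h k : Wall T}

theorem halfAt_eq_of_isPreconnected (hh : h ∈ ballWalls K p) {Z : Set T} (hZ : IsPreconnected Z)
    (hZp : Z ⊆ (Metric.closedBall p K)ᶜ) {u v : T} (hu : u ∈ Z) (hv : v ∈ Z) :
    h.halfAt u = h.halfAt v := by
  obtain ⟨q, hq, hhq⟩ := hh
  have key : ∀ u ∈ Z, ∀ v ∈ Z, u ∈ connectedComponentIn (Metric.closedBall p K)ᶜ q →
      v ∈ connectedComponentIn (Metric.closedBall p K)ᶜ q := by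
    intro u hu v hv h1
    rw [connectedComponentIn_eq h1]
    exact hZ.subset_connectedComponentIn hu hZp hv
  have hiff : u ∈ connectedComponentIn (Metric.closedBall p K)ᶜ q ↔
      v ∈ connectedComponentIn (Metric.closedBall p K)ᶜ q := ⟨key u hu v hv, key v hv u hu⟩
  rcases hhq with rfl | rfl
  · exact (Wall.halfAt_eq_iff (Wall.isHalf_ofSet.2 (Or.inl rfl)) u v).2 hiff
  · refine (Wall.halfAt_eq_iff (Wall.isHalf_ofSet.2 (Or.inl rfl)) u v).2 ?_
    have h1 := hZp hu
    have h2 := hZp hv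
    rw [Set.mem_compl_iff] at h1 h2
    simp only [Set.mem_union, hiff, h1, h2, or_false]

theorem Geodesic.dist_add_le_of_halfAt_ne (hT : Geodesic T) (hh : h ∈ ballWalls K p) {u v : T}
    (hne : h.halfAt u ≠ h.halfAt v) : dist u p + dist p v ≤ dist u v + 2 * K := by
  obtain ⟨Z, hZ, hu, hv, hZb, -⟩ := hT.exists_segment u v
  have h1 : ¬ Z ⊆ (Metric.closedBall p K)ᶜ := fun hZp =>
    hne (halfAt_eq_of_isPreconnected hh hZ hZp hu hv)
  rw [Set.not_subset] at h1
  obtain ⟨z, hz, hzp⟩ := h1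
  rw [Set.notMem_compl_iff, Metric.mem_closedBall] at hzp
  have h2 := hZb z hz
  have h3 := dist_triangle u z p
  have h4 := dist_triangle p z v
  rw [dist_comm p z] at h4
  linarith

theorem Wall.halfAt_ne_of_mem_notMem {S : Type*} {h : Wall S} {A : Set S} (hA : h.IsHalf A)
    {u v : S} (hu : u ∈ A) (hv : v ∉ A) : h.halfAt u ≠ h.halfAt v := fun heq =>
  hv (((Wall.halfAt_eq_iff hA u v).1 heq).1 hu)

/-- Walls defined by distant balls are nested: the halfspaces facing away from each other are
disjoint. -/
theorem Geodesic.disjoint_of_notMem (hT : Geodesic T) (hh : h ∈ ballWalls K p)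
    (hk : k ∈ ballWalls K q) (hpq : 2 * K < dist p q) {A B : Set T} (hA : h.IsHalf A)
    (hB : k.IsHalf B) (hqA : q ∉ A) (hpB : p ∉ B) : Disjoint A B := by
  rw [Set.disjoint_left]
  intro z hzA hzB
  -- A common point `z` would have `p` coarsely between `z` and `q`, and `q` coarsely between `z`
  -- and `p`. Adding the two inequalities gives `dist p q ≤ 2 * K`.
  have h1 := hT.dist_add_le_of_halfAt_ne hh (Wall.halfAt_ne_of_mem_notMem hA hzA hqA)
  have h2 := hT.dist_add_le_of_halfAt_ne hk (Wall.halfAt_ne_of_mem_notMem hB hzB hpB)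
  rw [dist_comm q p] at h2
  linarith

theorem Geodesic.exists_disjoint (hT : Geodesic T) (hh : h ∈ ballWalls K p)
    (hk : k ∈ ballWalls K q) (hpq : 2 * K < dist p q) {A B : Set T} (hA : h.IsHalf A)
    (hB : k.IsHalf B) : Disjoint A B ∨ A ⊆ B ∨ B ⊆ A ∨ Disjoint Aᶜ Bᶜ := by
  by_cases h1 : q ∈ A <;> by_cases h2 : p ∈ B
  · exact Or.inr (Or.inr (Or.inr (hT.disjoint_of_notMem hh hk hpq hA.compl hB.compl
      (fun h => h h1) (fun h => h h2))))
  · refine Or.inr (Or.inr (Or.inl ?_))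
    exact Set.disjoint_compl_left_iff_subset.1 (hT.disjoint_of_notMem hh hk hpq hA.compl hB
      (fun h => h h1) h2)
  · exact Or.inr (Or.inl (Set.disjoint_compl_right_iff_subset.1
      (hT.disjoint_of_notMem hh hk hpq hA hB.compl h1 (fun h => h h2))))
  · exact Or.inl (hT.disjoint_of_notMem hh hk hpq hA hB h1 h2)

/-- Few walls with distant centres separate a point from two others with small Gromov product. -/
theorem ncard_le_gromovProduct (hT : Geodesic T) {δ : ℝ} (hδ : Hyperbolic T δ)
    (hK : 100 * δ < K) (hK0 : 0 < K) {ι : Type*} {e : Set ι} (r : ι → Wall T) (c : ι → T) (hr : ∀ i ∈ e, r i ∈ ballWalls K (c i))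
    (hfar : ∀ i ∈ e, ∀ j ∈ e, i ≠ j → 10 * K ≤ dist (c i) (c j)) {a b x : T}
    (ha : ∀ i ∈ e, (r i).halfAt a ≠ (r i).halfAt x)
    (hb : ∀ i ∈ e, (r i).halfAt b ≠ (r i).halfAt x) :
    (e.ncard : ℝ) ≤ (gromovProduct a b x + 2 * K) / (7 * K) + 1 := by
  have hgp : 0 ≤ gromovProduct a b x := by
    have := dist_triangle a x b
    unfold gromovProduct
    rw [dist_comm x b] at this
    linarith
  have ha' := fun i hi => hT.dist_add_le_of_halfAt_ne (hr i hi) (ha i hi)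
  have hb' := fun i hi => hT.dist_add_le_of_halfAt_ne (hr i hi) (hb i hi)
  -- All centres are within error `2 * K` of lying between `a` and `x`. Being `10 * K` apart, their
  -- distances to `x` differ by at least `10 * K - 2 * K - 2 * δ`, which exceeds `7 * K`.
  refine ncard_le_of_separated (fun i => dist (c i) x) (by linarith) (by linarith)
    (fun _ _ => dist_nonneg) (fun i hi => ?_) (fun i hi j hj hij => ?_)
  · have h1 := ha' i hi
    have h2 := hb' i hi
    have h3 := dist_triangle a (c i) b
    rw [dist_comm (c i) b] at h3
    unfold gromovProduct
    linarith
  · have h1 := hδ.dist_le_of_between (ha' i hi) (ha' j hj) le_rfl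
    have h2 := hfar i hi j hj hij
    linarith

end BallWalls

/-! ### Induced walls with distant centres -/

section Spread

variable {T : Type w} [MetricSpace T] {S : Type*} {π : S → T} {K : ℝ}

/-- The walls in `a` are induced by the walls `r h` of `T`, which have distant centres `c h`. -/
structure Spread (π : S → T) (K : ℝ) (a : Set (Wall S)) (r : Wall S → Wall T) (c : Wall S → T) :
    Prop where
  finite : a.Finite
  mem : ∀ h ∈ a, r h ∈ ballWalls K (c h)
  comap : ∀ h ∈ a, (r h).comap π = h
  far : ∀ h ∈ a, ∀ k ∈ a, h ≠ k → 10 * K ≤ dist (c h) (c k)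

theorem Spread.mono {a b : Set (Wall S)} {r : Wall S → Wall T} {c : Wall S → T}
    (ha : Spread π K a r c) (hb : b ⊆ a) : Spread π K b r c where
  finite := ha.finite.subset hb
  mem h hh := ha.mem h (hb hh)
  comap h hh := ha.comap h (hb hh)
  far h hh k hk := ha.far h (hb hh) k (hb hk)

/-- Distinct walls of `T` may induce the same wall of `S`, so one preimage is chosen for each
induced wall. Nesting in `T` is not recorded; `Spread.exists_disparate` recovers it from separation.
-/
theorem exists_spread {d : Set (Wall T)} (hd : d ∈ disparateChains K) :
    ∃ r c, Spread π K (Wall.comap π '' d) r c ∧ ∀ h ∈ Wall.comap π '' d, r h ∈ d := by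
  obtain ⟨hf, -, p, hp, hfar⟩ := hd
  have hr : ∀ h : Wall S, ∃ k : Wall T, h ∈ Wall.comap π '' d → k ∈ d ∧ k.comap π = h := by
    intro h
    by_cases hh : h ∈ Wall.comap π '' d
    · obtain ⟨k, hk⟩ := hh
      exact ⟨k, fun _ => hk⟩
    · exact ⟨Wall.ofSet ∅, fun h => absurd h hh⟩
  choose r hr using hr
  refine ⟨r, fun h => p (r h), ⟨hf.image _, fun h hh => hp _ (hr h hh).1, fun h hh => (hr h hh).2,
    fun h hh k hk hne => hfar _ (hr h hh).1 _ (hr k hk).1 fun heq => hne ?_⟩,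
    fun h hh => (hr h hh).1⟩
  rw [← (hr h hh).2, ← (hr k hk).2, heq]

theorem Spread.exists_half {a : Set (Wall S)} {r : Wall S → Wall T} {c : Wall S → T}
    (ha : Spread π K a r c) {h : Wall S} (hh : h ∈ a) {A : Set S} (hA : h.IsHalf A) :
    ∃ B, (r h).IsHalf B ∧ π ⁻¹' B = A := by
  rw [← ha.comap h hh, Wall.isHalf_comap] at hA
  exact hA

open WallUltrafilter in
/-- A spread set of walls separating two ultrafilters comes from a disparate chain. -/
theorem Spread.exists_disparate [Nonempty S] (hT : Geodesic T) (hK : 0 < K) {a : Set (Wall S)}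
    {r : Wall S → Wall T} {c : Wall S → T} (ha : Spread π K a r c) {W : Set (Wall S)}
    (haW : a ⊆ W) (x y : WallUltrafilter W) (hxy : Separates a x y) :
    ∃ d ∈ disparateChains K, Wall.comap π '' d = a := by
  rw [separates_iff haW] at hxy
  have hinv : ∀ h ∈ a, (Wall.comap π) (r h) = h := ha.comap
  have hA : ∀ h : Wall S, ∃ A : Set T, h ∈ a → (r h).IsHalf A ∧ π ⁻¹' A = x.side h := by
    intro h
    by_cases hh : h ∈ a
    · obtain ⟨A, hA⟩ := ha.exists_half hh (x.isHalf_side (haW hh))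
      exact ⟨A, fun _ => hA⟩
    · exact ⟨∅, fun h => absurd h hh⟩
  choose A hA using hA
  refine ⟨r '' a, ⟨ha.finite.image r, ⟨fun k => A (k.comap π), ?_, ?_⟩,
    fun k => c (k.comap π), ?_, ?_⟩, ?_⟩
  · rintro _ ⟨h, hh, rfl⟩
    beta_reduce
    rw [hinv h hh]
    exact (hA h hh).1
  · rintro _ ⟨h, hh, rfl⟩ _ ⟨k, hk, rfl⟩
    beta_reduce
    rw [hinv h hh, hinv k hk]
    by_cases hhk : h = k
    · rw [hhk]
      exact Or.inl subset_rfl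
    have hd := ha.far h hh k hk hhk
    -- Distant walls are nested in one of four ways. Disjoint sides contradict that `x` chooses
    -- both, and disjoint complements that `y` chooses both; the other two are the chain condition.
    rcases hT.exists_disjoint (ha.mem h hh) (ha.mem k hk) (by linarith) (hA h hh).1 (hA k hk).1
      with h1 | h1 | h1 | h1
    · obtain ⟨s, hs, hs'⟩ := x.side_inter_nonempty (haW hh) (haW hk)
      rw [← (hA h hh).2] at hs
      rw [← (hA k hk).2] at hs'
      exact absurd hs' (Set.disjoint_left.1 h1 hs)
    · exact Or.inl h1
    · exact Or.inr h1
    · obtain ⟨s, hs, hs'⟩ := y.side_inter_nonempty (haW hh) (haW hk)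
      rw [x.side_eq_compl y (haW hh) (hxy h hh), ← (hA h hh).2] at hs
      rw [x.side_eq_compl y (haW hk) (hxy k hk), ← (hA k hk).2] at hs'
      exact absurd hs' (Set.disjoint_left.1 h1 hs)
  · rintro _ ⟨h, hh, rfl⟩
    beta_reduce
    rw [hinv h hh]
    exact ha.mem h hh
  · rintro _ ⟨h, hh, rfl⟩ _ ⟨k, hk, rfl⟩ hne
    beta_reduce
    rw [hinv h hh, hinv k hk]
    exact ha.far h hh k hk fun heq => hne (heq ▸ rfl)
  · rw [Set.image_image]
    ext h
    constructor
    · rintro ⟨k, hk, rfl⟩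
      beta_reduce
      rwa [hinv k hk]
    · exact fun hh => ⟨h, hh, hinv h hh⟩

/-- Each of the three other positions of the centres makes two sides disjoint by
`Geodesic.disjoint_of_notMem`. This is excluded by a point of the smaller halfspace, a point outside
the larger, or a point in their difference. -/
theorem Geodesic.mem_and_notMem_of_ssubset (hT : Geodesic T) {p q : T} {h k : Wall T}
    (hh : h ∈ ballWalls K p) (hk : k ∈ ballWalls K q) (hpq : 2 * K < dist p q) {A B : Set T}
    (hA : h.IsHalf A) (hB : k.IsHalf B) (hAB : π ⁻¹' A ⊂ π ⁻¹' B) (hA0 : (π ⁻¹' A).Nonempty)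
    (hB0 : (π ⁻¹' B)ᶜ.Nonempty) : p ∈ B ∧ q ∉ A := by
  obtain ⟨s, hs⟩ := hA0
  obtain ⟨t, ht⟩ := hB0
  obtain ⟨hsub, hne⟩ := hAB
  obtain ⟨v, hvB, hvA⟩ := Set.not_subset.1 hne
  by_cases h1 : q ∈ A <;> by_cases h2 : p ∈ B
  · exact absurd (fun h => ht (hsub h) : t ∉ π ⁻¹' A) fun h3 => (Set.disjoint_left.1
      (hT.disjoint_of_notMem hh hk hpq hA.compl hB.compl (fun h => h h1) (fun h => h h2))
      (show π t ∈ Aᶜ from h3)) ht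
  · exact absurd hvB (Set.disjoint_left.1
      (hT.disjoint_of_notMem hh hk hpq hA.compl hB (fun h => h h1) h2)
      (show π v ∈ Aᶜ from hvA))
  · exact ⟨h2, h1⟩
  · exact absurd (hsub hs) (Set.disjoint_left.1
      (hT.disjoint_of_notMem hh hk hpq hA hB h1 h2) hs)

/-- The centre of a wall lies coarsely between those of walls that are nested on both sides. -/
theorem Geodesic.dist_add_le_of_ssubset (hT : Geodesic T) {p q t : T} {h k l : Wall T}
    (hh : h ∈ ballWalls K p) (hk : k ∈ ballWalls K q) (hl : l ∈ ballWalls K t)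
    (hpq : 2 * K < dist p q) (hqt : 2 * K < dist q t) {A B C : Set S}
    (hA : (h.comap π).IsHalf A) (hB : (k.comap π).IsHalf B) (hC : (l.comap π).IsHalf C)
    (hAB : A ⊂ B) (hBC : B ⊂ C) (hA0 : A.Nonempty) (hC0 : Cᶜ.Nonempty) :
    dist p q + dist q t ≤ dist p t + 2 * K := by
  obtain ⟨A, hA, rfl⟩ := hA
  obtain ⟨B, hB, rfl⟩ := hB
  obtain ⟨C, hC, rfl⟩ := hC
  have h1 := (hT.mem_and_notMem_of_ssubset hh hk hpq hA hB hAB hA0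
    (hC0.mono (Set.compl_subset_compl.2 hBC.1))).1
  have h2 := (hT.mem_and_notMem_of_ssubset hk hl hqt hB hC hBC (hA0.mono hAB.1) hC0).2
  exact hT.dist_add_le_of_halfAt_ne hk (Wall.halfAt_ne_of_mem_notMem hB h1 h2)

end Spread

/-! ### Gluing of `L`-chains -/

section Glue

open WallUltrafilter

variable {S : Type*} [Nonempty S] {W : Set (Wall S)}

theorem WallUltrafilter.exists_drop_greatest (x y : WallUltrafilter W) {a : Set (Wall S)}
    (haW : a ⊆ W) (hc : IsWallChain a) (hs : Separates a x y) (hf : a.Finite) :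
    ∃ b ⊆ a, a.ncard ≤ b.ncard + 1 ∧ ∀ h ∈ b, ∃ u ∈ a, u ≠ h ∧ ∀ k ∈ a, x.side k ⊆ x.side u := by
  rcases a.eq_empty_or_nonempty with rfl | hne
  · exact ⟨∅, subset_rfl, by simp, by simp⟩
  obtain ⟨u, hu, hmax⟩ := x.exists_greatest y haW hc hs hf hne
  exact ⟨a \ {u}, Set.sdiff_subset, (Set.ncard_sdiff_singleton_add_one hu hf).ge,
    fun h hh => ⟨u, hu, fun heq => hh.2 heq.symm, hmax⟩⟩

theorem WallUltrafilter.exists_drop_least (x y : WallUltrafilter W) {a : Set (Wall S)}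
    (haW : a ⊆ W) (hc : IsWallChain a) (hs : Separates a x y) (hf : a.Finite) :
    ∃ b ⊆ a, a.ncard ≤ b.ncard + 1 ∧ ∀ h ∈ b, ∃ u ∈ a, u ≠ h ∧ ∀ k ∈ a, x.side u ⊆ x.side k := by
  rcases a.eq_empty_or_nonempty with rfl | hne
  · exact ⟨∅, subset_rfl, by simp, by simp⟩
  obtain ⟨u, hu, hmax⟩ := x.exists_least y haW hc hs hf hne
  exact ⟨a \ {u}, Set.sdiff_subset, (Set.ncard_sdiff_singleton_add_one hu hf).ge,
    fun h hh => ⟨u, hu, fun heq => hh.2 heq.symm, hmax⟩⟩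

theorem WallUltrafilter.exists_drop_two_greatest (x y : WallUltrafilter W) {a : Set (Wall S)}
    (haW : a ⊆ W) (hc : IsWallChain a) (hs : Separates a x y) (hf : a.Finite) :
    ∃ b ⊆ a, a.ncard ≤ b.ncard + 2 ∧ ∀ h ∈ b, ∃ u ∈ a, ∃ v ∈ a, h ≠ u ∧ u ≠ v ∧
      x.side h ⊆ x.side u ∧ x.side u ⊆ x.side v := by
  obtain ⟨b, hb, hcard, hbu⟩ := x.exists_drop_greatest y haW hc hs hf
  obtain ⟨b', hb', hcard', hbu'⟩ := x.exists_drop_greatest y (hb.trans haW) (hc.mono hb)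
    (fun h hh => hs h (hb hh)) (hf.subset hb)
  refine ⟨b', hb'.trans hb, by omega, fun h hh => ?_⟩
  obtain ⟨u, hu, huh, humax⟩ := hbu' h hh
  obtain ⟨v, hv, hvu, hvmax⟩ := hbu u hu
  exact ⟨u, hb hu, v, hv, huh.symm, hvu.symm, humax h (hb' hh), hvmax u (hb hu)⟩

variable {T : Type w} [MetricSpace T] {π : S → T} {K : ℝ}

/-- Two separating spread chains, one after the other, are disparate after deletion of the two last
elements of the first and the first element of the second. -/
theorem Spread.le_dist_of_nested (hT : Geodesic T) (hK : 0 < K) (x y : WallUltrafilter W)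
    {a a' : Set (Wall S)} {r r' : Wall S → Wall T} {c c' : Wall S → T} (ha : Spread π K a r c)
    (ha' : Spread π K a' r' c') (haW : a ⊆ W) (haW' : a' ⊆ W) (hs' : Separates a' x y) {h u v t k : Wall S} (hh : h ∈ a) (hu : u ∈ a) (hv : v ∈ a)
    (ht : t ∈ a') (hk : k ∈ a') (hhu : h ≠ u) (huv : u ≠ v) (htk : t ≠ k)
    (h1 : x.side h ⊆ x.side u) (h2 : x.side u ⊆ x.side v) (h3 : x.side v ⊆ x.side t)
    (h4 : x.side t ⊆ x.side k) : 10 * K ≤ dist (c h) (c' k) := by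
  have strict : ∀ {h k}, h ∈ W → k ∈ W → h ≠ k → x.side h ⊆ x.side k → x.side h ⊂ x.side k :=
    fun hh hk hne hsub => hsub.ssubset_of_ne fun heq => hne (x.eq_of_side_eq hh hk heq)
  rw [separates_iff haW'] at hs'
  have s1 := strict (haW hh) (haW hu) hhu h1
  have s2 : x.side u ⊂ x.side t := (strict (haW hu) (haW hv) huv h2).trans_subset h3
  have s3 := strict (haW' ht) (haW' hk) htk h4
  have hne := x.side_nonempty (haW hh)
  have hne' : (x.side k)ᶜ.Nonempty := by
    rw [← x.side_eq_compl y (haW' hk) (hs' k hk)]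
    exact y.side_nonempty (haW' hk)
  have half : ∀ h ∈ a, ((r h).comap π).IsHalf (x.side h) := fun h hh => by
    rw [ha.comap h hh]
    exact x.isHalf_side (haW hh)
  have half' : ∀ h ∈ a', ((r' h).comap π).IsHalf (x.side h) := fun h hh => by
    rw [ha'.comap h hh]
    exact x.isHalf_side (haW' hh)
  have d1 := ha.far h hh u hu hhu
  have d2 := ha'.far t ht k hk htk
  -- If the centres of `u` and `k` are far apart, that of `u` is coarsely between those of `h` and
  -- `k`, so the `10 * K` gap from `h` to `u` persists. If they were close, the centre of `t`, which
  -- is coarsely between them, could not be `10 * K` away from that of `k`. The wall `v` serves to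
  -- make `u` and `t` strictly nested.
  by_cases hd : 2 * K < dist (c u) (c' k)
  · have := hT.dist_add_le_of_ssubset (ha.mem h hh) (ha.mem u hu) (ha'.mem k hk) (by linarith) hd
      (half h hh) (half u hu) (half' k hk) s1 (s2.trans s3) hne hne'
    linarith
  · exfalso
    have d3 := dist_triangle (c' t) (c u) (c' k)
    rw [dist_comm (c' t) (c u)] at d3
    have := hT.dist_add_le_of_ssubset (ha.mem u hu) (ha'.mem t ht) (ha'.mem k hk) (by linarith)
      (by linarith) (half u hu) (half' t ht) (half' k hk) s2 s3 (hne.mono s1.1) hne'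
    linarith

end Glue

section LChains

open WallUltrafilter

variable {m : ℕ} {T : Fin m → Type w} [∀ i, MetricSpace (T i)] {S : Type*}
  {π : ∀ i, S → T i} {K : Fin m → ℝ}

theorem exists_spread_of_mem_unionsOfChains {c : Set (Wall S)} (hc : c ∈ unionsOfChains π K) :
    ∃ (a : Fin m → Set (Wall S)) (r : ∀ i, Wall S → Wall (T i)) (q : ∀ i, Wall S → T i),
      (∀ i, Spread (π i) (K i) (a i) (r i) (q i)) ∧ c = ⋃ i, a i := by
  obtain ⟨d, hd, rfl⟩ := hc
  choose r q hs _ using fun i => exists_spread (π := π i) (hd i)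
  exact ⟨fun i => Wall.comap (π i) '' d i, r, q, hs, rfl⟩

theorem finite_of_mem_unionsOfChains {c : Set (Wall S)} (hc : c ∈ unionsOfChains π K) :
    c.Finite := by
  obtain ⟨a, r, q, hs, rfl⟩ := exists_spread_of_mem_unionsOfChains hc
  exact Set.finite_iUnion fun i => (hs i).finite

theorem ncard_le_sum_of_subset_iUnion {α : Type*} {c : Set α} {b : Fin m → Set α}
    (hb : ∀ i, (b i).Finite) (h : c ⊆ ⋃ i, b i) : c.ncard ≤ ∑ i, (b i).ncard :=
  (Set.ncard_le_ncard h (Set.finite_iUnion hb)).trans (Set.ncard_iUnion_le_of_fintype b)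

-- In each factor the two last walls of `c` and the first of `c'` are deleted, so that the remaining
-- ones have distant centres by `Spread.le_dist_of_nested`; whence `3 * m`. Since both chains
-- separate `x` from `y`, the concatenation is nested in `S` and comes from disparate chains in the
-- factors.
open Classical in
theorem lChains_glue [Nonempty S] (hT : ∀ i, Geodesic (T i)) (hK : ∀ i, 0 < K i) {L : ℕ}
    {W : Set (Wall S)} (x y : WallUltrafilter W) {c c' : Set (Wall S)} (hcW : c ⊆ W) (hcW' : c' ⊆ W)
    (hc : c ∈ lChains π K L) (hc' : c' ∈ lChains π K L) (hs : Separates c x y)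
    (hs' : Separates c' x y) (hle : ∀ h ∈ c, ∀ k ∈ c', x.side h ⊆ x.side k) :
    ∃ e ∈ lChains π K L, e ⊆ c ∪ c' ∧ c.ncard + c'.ncard ≤ e.ncard + 3 * m := by
  have hfc := finite_of_mem_unionsOfChains hc.1.1
  have hfc' := finite_of_mem_unionsOfChains hc'.1.1
  obtain ⟨a, r, q, ha, hca⟩ := exists_spread_of_mem_unionsOfChains hc.1.1
  obtain ⟨a', r', q', ha', hca'⟩ := exists_spread_of_mem_unionsOfChains hc'.1.1
  have hac : ∀ i, a i ⊆ c := fun i => hca ▸ Set.subset_iUnion a i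
  have hac' : ∀ i, a' i ⊆ c' := fun i => hca' ▸ Set.subset_iUnion a' i
  choose b hba hbcard hb using fun i => x.exists_drop_two_greatest y ((hac i).trans hcW)
    (hc.1.2.mono (hac i)) (fun h hh => hs h (hac i hh)) (ha i).finite
  choose b' hba' hbcard' hb' using fun i => x.exists_drop_least y ((hac' i).trans hcW')
    (hc'.1.2.mono (hac' i)) (fun h hh => hs' h (hac' i hh)) (ha' i).finite
  have hne : ∀ i j, ∀ h ∈ b i, ∀ k ∈ b' j, h ≠ k := by
    rintro i j h hh k hk rfl
    obtain ⟨u, hu, v, hv, hhu, huv, h1, h2⟩ := hb i h hh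
    have h3 := hle u (hac i hu) h (hac' j (hba' j hk))
    exact hhu (x.eq_of_side_eq (hcW (hac i (hba i hh))) (hcW (hac i hu)) (h1.antisymm h3))
  have hspread : ∀ i, Spread (π i) (K i) (b i ∪ b' i) (fun h => if h ∈ b i then r i h else r' i h)
      (fun h => if h ∈ b i then q i h else q' i h) := by
    intro i
    have hnot : ∀ h ∈ b' i, h ∉ b i := fun h hh hh' => hne i i h hh' h hh rfl
    have hsb := (ha i).mono (hba i)
    have hsb' := (ha' i).mono (hba' i)
    have hcross : ∀ h ∈ b i, ∀ k ∈ b' i, 10 * K i ≤ dist (q i h) (q' i k) := by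
      intro h hh k hk
      obtain ⟨u, hu, v, hv, hhu, huv, h1, h2⟩ := hb i h hh
      obtain ⟨t, ht, htk, hmin⟩ := hb' i k hk
      exact Spread.le_dist_of_nested (hT i) (hK i) x y (ha i) (ha' i) ((hac i).trans hcW)
        ((hac' i).trans hcW') (fun h hh => hs' h (hac' i hh))
        (hba i hh) hu hv ht (hba' i hk) hhu huv htk h1 h2 (hle v (hac i hv) t (hac' i ht))
        (hmin k (hba' i hk))
    refine ⟨hsb.finite.union hsb'.finite, ?_, ?_, ?_⟩
    · rintro h (hh | hh)
      · simpa only [if_pos hh] using hsb.mem h hh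
      · simpa only [if_neg (hnot h hh)] using hsb'.mem h hh
    · rintro h (hh | hh)
      · simpa only [if_pos hh] using hsb.comap h hh
      · simpa only [if_neg (hnot h hh)] using hsb'.comap h hh
    · rintro h (hh | hh) k (hk | hk) hhk
      · simpa only [if_pos hh, if_pos hk] using hsb.far h hh k hk hhk
      · simpa only [if_pos hh, if_neg (hnot k hk)] using hcross h hh k hk
      · simpa only [if_pos hk, if_neg (hnot h hh), dist_comm] using hcross k hk h hh
      · simpa only [if_neg (hnot h hh), if_neg (hnot k hk)] using hsb'.far h hh k hk hhk
  set e := ⋃ i, (b i ∪ b' i) with he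
  have hbc : ∀ i, b i ⊆ c := fun i => (hba i).trans (hac i)
  have hbc' : ∀ i, b' i ⊆ c' := fun i => (hba' i).trans (hac' i)
  have hee : ∀ h ∈ e, (∃ i, h ∈ b i) ∨ ∃ i, h ∈ b' i := by
    intro h hh
    obtain ⟨i, hi | hi⟩ := Set.mem_iUnion.1 hh
    · exact Or.inl ⟨i, hi⟩
    · exact Or.inr ⟨i, hi⟩
  have hsub : e ⊆ c ∪ c' := by
    intro h hh
    rcases hee h hh with ⟨i, hi⟩ | ⟨i, hi⟩
    · exact Or.inl (hbc i hi)
    · exact Or.inr (hbc' i hi)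
  have heW : e ⊆ W := hsub.trans (Set.union_subset hcW hcW')
  have hse : Separates e x y := by
    intro h hh
    rcases hsub hh with h1 | h1
    · exact hs h h1
    · exact hs' h h1
  have hbetween : ∀ h ∈ e, ∀ k ∈ e, h ≠ k → ∀ d ∈ chainUnions π K,
      (∀ l ∈ d, l.Crosses h ∧ l.Crosses k) → d.encard ≤ L := by
    -- The deleted wall `u` of `c` lies between `h` and `k`, so what crosses these two also crosses
    -- `u`. The `L`-chain condition for the pair `h`, `u` of `c` then applies.
    have mixed : ∀ i j, ∀ h ∈ b i, ∀ k ∈ b' j, ∀ d ∈ chainUnions π K,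
        (∀ l ∈ d, l.Crosses h ∧ l.Crosses k) → d.encard ≤ L := by
      intro i j h hh k hk d hd hl
      obtain ⟨u, hu, v, hv, hhu, huv, h1, h2⟩ := hb i h hh
      refine hc.2 h (hbc i hh) u (hac i hu) hhu d hd fun l hld => ⟨(hl l hld).1, ?_⟩
      exact (hl l hld).1.between (hl l hld).2 (x.isHalf_side (hcW (hbc i hh)))
        (x.isHalf_side (hcW (hac i hu))) (x.isHalf_side (hcW' (hbc' j hk))) h1
        (hle u (hac i hu) k (hbc' j hk))
    intro h hh k hk hhk d hd hl
    rcases hee h hh with ⟨i, hi⟩ | ⟨i, hi⟩ <;> rcases hee k hk with ⟨j, hj⟩ | ⟨j, hj⟩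
    · exact hc.2 h (hbc i hi) k (hbc j hj) hhk d hd hl
    · exact mixed i j h hi k hj d hd hl
    · exact mixed j i k hj h hi d hd fun l hld => (hl l hld).symm
    · exact hc'.2 h (hbc' i hi) k (hbc' j hj) hhk d hd hl
  have hchain : IsWallChain e := by
    refine ⟨x.side, fun h hh => x.isHalf_side (heW hh), fun h hh k hk => ?_⟩
    rcases hsub hh with h1 | h1 <;> rcases hsub hk with h2 | h2
    · exact x.side_total y hcW hc.1.2 hs h1 h2
    · exact Or.inl (hle h h1 k h2)
    · exact Or.inr (hle k h2 h h1)
    · exact x.side_total y hcW' hc'.1.2 hs' h1 h2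
  have hunion : e ∈ unionsOfChains π K := by
    have hei : ∀ i, b i ∪ b' i ⊆ e := fun i => Set.subset_iUnion (fun i => b i ∪ b' i) i
    choose d hd hdb using fun i => (hspread i).exists_disparate (hT i) (hK i) ((hei i).trans heW)
      x y (fun h hh => hse h (hei i hh))
    exact ⟨d, hd, by rw [he]; simp only [hdb]⟩
  refine ⟨e, ⟨⟨hunion, hchain⟩, hbetween⟩, hsub, ?_⟩
  have hfe : e.Finite := (hfc.union hfc').subset hsub
  have hdisj : Disjoint (⋃ i, b i) (⋃ i, b' i) := by
    rw [Set.disjoint_left]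
    intro h hh hh'
    obtain ⟨i, hi⟩ := Set.mem_iUnion.1 hh
    obtain ⟨j, hj⟩ := Set.mem_iUnion.1 hh'
    exact hne i j h hi h hj rfl
  have hfb : (⋃ i, b i).Finite := hfc.subset (Set.iUnion_subset hbc)
  have hfb' : (⋃ i, b' i).Finite := hfc'.subset (Set.iUnion_subset hbc')
  have c1 : c.ncard ≤ (⋃ i, b i).ncard + 2 * m := by
    have h1 : c \ (⋃ i, b i) ⊆ ⋃ i, (a i \ b i) := by
      rintro h ⟨hh, hhb⟩
      rw [hca] at hh
      obtain ⟨i, hi⟩ := Set.mem_iUnion.1 hh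
      exact Set.mem_iUnion.2 ⟨i, hi, fun h' => hhb (Set.mem_iUnion.2 ⟨i, h'⟩)⟩
    have h2 := ncard_le_sum_of_subset_iUnion (fun i => (ha i).finite.subset Set.sdiff_subset) h1
    have h3 : ∑ i, (a i \ b i).ncard ≤ ∑ _i : Fin m, 2 := Finset.sum_le_sum fun i _ => by
      have := Set.ncard_sdiff_add_ncard_of_subset (hba i) (ha i).finite
      have := hbcard i
      omega
    rw [Finset.sum_const, Finset.card_univ, Fintype.card_fin, smul_eq_mul] at h3
    have h4 := Set.ncard_sdiff_add_ncard_of_subset (Set.iUnion_subset hbc) hfc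
    omega
  have c2 : c'.ncard ≤ (⋃ i, b' i).ncard + m := by
    have h1 : c' \ (⋃ i, b' i) ⊆ ⋃ i, (a' i \ b' i) := by
      rintro h ⟨hh, hhb⟩
      rw [hca'] at hh
      obtain ⟨i, hi⟩ := Set.mem_iUnion.1 hh
      exact Set.mem_iUnion.2 ⟨i, hi, fun h' => hhb (Set.mem_iUnion.2 ⟨i, h'⟩)⟩
    have h2 := ncard_le_sum_of_subset_iUnion (fun i => (ha' i).finite.subset Set.sdiff_subset) h1
    have h3 : ∑ i, (a' i \ b' i).ncard ≤ ∑ _i : Fin m, 1 := Finset.sum_le_sum fun i _ => by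
      have := Set.ncard_sdiff_add_ncard_of_subset (hba' i) (ha' i).finite
      have := hbcard' i
      omega
    rw [Finset.sum_const, Finset.card_univ, Fintype.card_fin, smul_eq_mul] at h3
    have h4 := Set.ncard_sdiff_add_ncard_of_subset (Set.iUnion_subset hbc') hfc'
    omega
  have c3 : (⋃ i, b i).ncard + (⋃ i, b' i).ncard ≤ e.ncard := by
    rw [← Set.ncard_union_eq hdisj hfb hfb']
    refine Set.ncard_le_ncard ?_ hfe
    rw [he, Set.iUnion_union_distrib]
  omega

theorem lChainSystem_isGluable [Nonempty S] (hT : ∀ i, Geodesic (T i)) (hK : ∀ i, 0 < K i)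
    (L : ℕ) : (lChainSystem π K L).IsGluable L (3 * m) where
  empty_mem := by
    obtain ⟨s⟩ := ‹Nonempty S›
    refine ⟨⟨⟨fun _ => ∅, fun i => empty_mem_disparateChains (p := π i s), by simp⟩,
      fun _ => ∅, by simp, by simp⟩, by simp⟩
  chain c hc := hc.1.2
  sep c hc h hh k hk hhk d hd hl := hc.2 h hh k hk hhk d hd.1 hl
  glue x y c hc c' hc' _ _ hs hs' hle :=
    lChains_glue hT hK x y ((lChainSystem π K L).subset_walls c hc)
      ((lChainSystem π K L).subset_walls c' hc') hc hc' hs hs' hle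

end LChains

/-! ### Distances in the dual of the `L`-chains -/

theorem Hyperbolic.nonneg {X : Type*} [MetricSpace X] {δ : ℝ} (hX : Hyperbolic X δ) (x : X) :
    0 ≤ δ := by
  have := hX x x x x
  simpa [gromovProduct] using this

theorem IsAdmissibleRadius.pos {T : Type*} [MetricSpace T] {K : ℝ} (hK : IsAdmissibleRadius T K)
    (x : T) : 0 < K := by
  obtain ⟨⟨δ, hδ, h⟩, -⟩ := hK
  linarith [hδ.nonneg x]

theorem gromovProduct_self {X : Type*} [MetricSpace X] (x p : X) :
    gromovProduct x x p = dist x p := by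
  simp [gromovProduct]

/-! ### Upper bounds by counting, and dualisability. -/

section Upper

variable {m : ℕ} {T : Fin m → Type w} [∀ i, MetricSpace (T i)] {S : Type*}
  {π : ∀ i, S → T i} {K : Fin m → ℝ}

theorem ncard_le_sum_gromovProduct (hT : ∀ i, Geodesic (T i))
    (hK : ∀ i, IsAdmissibleRadius (T i) (K i)) {c : Set (Wall S)} (hc : c ∈ unionsOfChains π K)
    {s t u : S} (hs : ∀ h ∈ c, h.halfAt s ≠ h.halfAt u) (ht : ∀ h ∈ c, h.halfAt t ≠ h.halfAt u) :
    (c.ncard : ℝ) ≤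
      ∑ i, ((gromovProduct (π i s) (π i t) (π i u) + 2 * K i) / (7 * K i) + 1) := by
  obtain ⟨a, r, q, ha, rfl⟩ := exists_spread_of_mem_unionsOfChains hc
  have h1 := ncard_le_sum_of_subset_iUnion (fun i => (ha i).finite) (subset_refl (⋃ i, a i))
  have h2 : ((⋃ i, a i).ncard : ℝ) ≤ ∑ i, ((a i).ncard : ℝ) := by exact_mod_cast h1
  refine h2.trans (Finset.sum_le_sum fun i _ => ?_)
  obtain ⟨δ, hδ, hKδ⟩ := (hK i).1
  have tr : ∀ h ∈ a i, ∀ s, h.halfAt s ≠ h.halfAt u →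
      (r i h).halfAt (π i s) ≠ (r i h).halfAt (π i u) := by
    intro h hh s hne heq
    refine hne ?_
    rw [← (ha i).comap h hh]
    exact (Wall.halfAt_comap_eq_iff _ _ _).2 heq
  exact ncard_le_gromovProduct (hT i) hδ hKδ ((hK i).pos (π i s)) (r i) (q i) (ha i).mem (ha i).far
    (fun h hh => tr h hh s (hs h (Set.mem_iUnion.2 ⟨i, hh⟩)))
    (fun h hh => tr h hh t (ht h (Set.mem_iUnion.2 ⟨i, hh⟩)))

theorem separates_principal_iff {W c : Set (Wall S)} (hc : c ⊆ W) {s t : S} :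
    Separates c (principal W s) (principal W t) ↔ ∀ h ∈ c, h.halfAt s ≠ h.halfAt t :=
  ⟨fun hs h hh => hs ⟨h, hc hh⟩ hh, fun hs h hh => hs h.1 hh⟩

theorem lChainSystem_isDualisable [Nonempty S] (hT : ∀ i, Geodesic (T i))
    (hK : ∀ i, IsAdmissibleRadius (T i) (K i)) (L : ℕ) : (lChainSystem π K L).IsDualisable := by
  intro s t
  set R := ∑ i, ((gromovProduct (π i s) (π i s) (π i t) + 2 * K i) / (7 * K i) + 1) with hR
  refine lt_of_le_of_lt (b := ((⌊R⌋₊ : ℕ) : ℕ∞)) (iSup₂_le ?_) (ENat.natCast_lt_top _)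
  rintro c ⟨hc, hs⟩
  have hc' : c ∈ lChains π K L := hc
  have hs' := (separates_principal_iff ((lChainSystem π K L).subset_walls c hc)).1 hs
  have h1 := ncard_le_sum_gromovProduct hT hK hc'.1.1 hs' hs'
  rw [← (finite_of_mem_unionsOfChains hc'.1.1).cast_ncard_eq]
  exact_mod_cast Nat.le_floor h1

end Upper

/-! ### Lower bounds from walls placed along geodesics. -/

section Lower

/-- Walls along a geodesic, at distance `R` from each other. -/
theorem IsAdmissibleRadius.exists_walls {T : Type*} [MetricSpace T] (hT : Geodesic T) {K : ℝ}
    (hK : IsAdmissibleRadius T K) {R : ℝ} (hR : 10 * K ≤ R) {x y : T} {n : ℕ}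
    (hn : (n + 1) * R ≤ dist x y) :
    ∃ (p : ℕ → T) (C : ℕ → Set T), ∀ k ∈ Set.Icc 1 n, Wall.ofSet (C k) ∈ ballWalls K (p k) ∧
      x ∈ C k ∧ y ∉ C k ∧ ∀ j ∈ Set.Icc 1 n, j < k → R ≤ dist (p j) (p k) ∧ C j ⊆ C k := by
  have hK0 := hK.pos x
  obtain ⟨Z, -, hxZ, hyZ, hZb, hZd, hZr⟩ := hT.exists_segment x y
  have hp : ∀ k : ℕ, ∃ z, k ∈ Set.Icc 1 n → z ∈ Z ∧ dist x z = k * R := by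
    intro k
    by_cases hk : k ∈ Set.Icc 1 n
    · obtain ⟨z, hz⟩ := hZr (k * R) ⟨mul_nonneg (Nat.cast_nonneg k) (by linarith), le_trans (by
        have : (k : ℝ) ≤ n := by exact_mod_cast hk.2
        gcongr <;> linarith) hn⟩
      exact ⟨z, fun _ => hz⟩
    · exact ⟨x, fun h => absurd h hk⟩
  choose p hp using hp
  have hxp : ∀ k ∈ Set.Icc 1 n, K < dist x (p k) := by
    intro k hk
    rw [(hp k hk).2]
    have h1 : (1 : ℝ) ≤ k := by exact_mod_cast hk.1
    have h2 : 1 * R ≤ k * R := by gcongr; linarith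
    linarith
  have hyp : ∀ k ∈ Set.Icc 1 n, K < dist y (p k) := by
    intro k hk
    have h1 := hZb _ (hp k hk).1
    rw [(hp k hk).2, dist_comm _ y] at h1
    have h3 : (k : ℝ) ≤ n := by exact_mod_cast hk.2
    have h2 : k * R ≤ n * R := by gcongr; linarith
    linarith
  have hout : ∀ k ∈ Set.Icc 1 n, x ∉ Metric.closedBall (p k) K := fun k hk => by
    rw [Metric.mem_closedBall, not_le]
    exact hxp k hk
  have hxC : ∀ k ∈ Set.Icc 1 n, x ∈ connectedComponentIn (Metric.closedBall (p k) K)ᶜ x :=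
    fun k hk => mem_connectedComponentIn (hout k hk)
  have hw : ∀ k ∈ Set.Icc 1 n,
      Wall.ofSet (connectedComponentIn (Metric.closedBall (p k) K)ᶜ x) ∈ ballWalls K (p k) :=
    fun k hk => ⟨x, hout k hk, Or.inl rfl⟩
  have hhalf : ∀ k, (Wall.ofSet (connectedComponentIn (Metric.closedBall (p k) K)ᶜ x)).IsHalf
      (connectedComponentIn (Metric.closedBall (p k) K)ᶜ x) := fun k =>
    Wall.isHalf_ofSet.2 (Or.inl rfl)
  refine ⟨p, fun k => connectedComponentIn (Metric.closedBall (p k) K)ᶜ x, fun k hk =>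
    ⟨hw k hk, hxC k hk, ?_, fun j hj hjk => ?_⟩⟩
  · refine hK.2 x y (p k) (hZb _ (hp k hk).1) (hout k hk) ?_
    rw [Metric.mem_closedBall, not_le]
    exact hyp k hk
  · have hjk' : (j : ℝ) + 1 ≤ k := by exact_mod_cast hjk
    have hmul : ((j : ℝ) + 1) * R ≤ k * R := by gcongr; linarith
    have hdist : dist (p j) (p k) = k * R - j * R := by
      rw [hZd _ (hp j hj).1 _ (hp k hk).1, (hp j hj).2, (hp k hk).2, abs_of_nonpos (by linarith)]
      ring
    refine ⟨by linarith, ?_⟩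
    -- `p j` lies in the component of `x`, since the geodesic from `x` to `p j` avoids the ball
    have hpj : p j ∈ connectedComponentIn (Metric.closedBall (p k) K)ᶜ x := by
      obtain ⟨Y, hY, hxY, hjY, hYb, -⟩ := hT.exists_segment x (p j)
      refine hY.subset_connectedComponentIn hxY (fun z hz => ?_) hjY
      rw [Set.mem_compl_iff, Metric.mem_closedBall, not_le]
      have h1 := hYb z hz
      have h2 := dist_triangle x z (p k)
      have h3 : 0 ≤ dist z (p j) := dist_nonneg
      rw [(hp j hj).2] at h1
      rw [(hp k hk).2] at h2
      linarith
    -- Here `p j` lies on a geodesic from `x` to `p k`, so admissibility puts the two on different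
    -- sides of its ball.
    have hpk : p k ∉ connectedComponentIn (Metric.closedBall (p j) K)ᶜ x := by
      refine hK.2 x (p k) (p j) ?_ (hout j hj) ?_
      · rw [(hp j hj).2, hdist, (hp k hk).2]
        ring
      · rw [Metric.mem_closedBall, not_le, dist_comm]
        linarith
    exact Set.disjoint_compl_right_iff_subset.1 (hT.disjoint_of_notMem (hw j hj) (hw k hk)
      (by linarith) (hhalf j) (hhalf k).compl hpk (fun h => h hpj))

variable {m : ℕ} {T : Fin m → Type w} [∀ i, MetricSpace (T i)] {S : Type*}
  {π : ∀ i, S → T i} {K : Fin m → ℝ}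

theorem image_comap_mem_unionsOfChains (s : S) {i : Fin m} {d : Set (Wall (T i))}
    (hd : d ∈ disparateChains (K i)) : Wall.comap (π i) '' d ∈ unionsOfChains π K := by
  refine ⟨Function.update (fun _ => ∅) i d, fun j => ?_, ?_⟩
  · by_cases hj : j = i
    · subst hj
      rwa [Function.update_self]
    · rw [Function.update_of_ne hj]
      exact empty_mem_disparateChains (p := π j s)
  · refine subset_antisymm ?_ (Set.iUnion_subset fun j => ?_)
    · refine (Set.subset_iUnion_of_subset i ?_)
      rw [Function.update_self]
    · by_cases hj : j = i
      · subst hj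
        rw [Function.update_self]
      · rw [Function.update_of_ne hj, Set.image_empty]
        exact Set.empty_subset _

/-- Of `N * (L₀ + 1)` walls along a geodesic of the factor `i`, every `(L₀ + 1)`-st is kept. A wall
crossing two of the kept walls crosses all those between, so the grid bound leaves at most `L₀` such
walls in each disparate chain and `m * L₀` in all. The bound `J` on gaps in `S` ensures that
distinct walls of the factor stay distinct on `S`. -/
theorem exists_lChain_separating (hT : ∀ i, Geodesic (T i))
    (hK : ∀ i, IsAdmissibleRadius (T i) (K i)) {J : ℝ} (hJ0 : 0 ≤ J)
    (hJ : ∀ (P : S → Prop) (s t : S), P s → ¬ P t →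
      ∃ u v, P u ∧ ¬ P v ∧ ∀ i, dist (π i u) (π i v) ≤ J)
    {L₀ L : ℕ} (hL₀ : GridBound π K L₀) (hL : m * L₀ ≤ L) (i : Fin m) (s t : S) {N : ℕ}
    (hN : (N + 1) * ((L₀ + 1) * (2 * J + 10 * K i + 1)) ≤ dist (π i s) (π i t)) :
    ∃ c ∈ lChains π K L, (∀ h ∈ c, h.halfAt s ≠ h.halfAt t) ∧ c.ncard = N := by
  have hK0 := (hK i).pos (π i s)
  set R := 2 * J + 10 * K i + 1 with hR
  have hN' : (((N * (L₀ + 1) : ℕ) : ℝ) + 1) * R ≤ dist (π i s) (π i t) := by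
    refine le_trans ?_ hN
    rw [← mul_assoc]
    have : (0 : ℝ) ≤ L₀ := Nat.cast_nonneg _
    push_cast
    gcongr
    nlinarith
  obtain ⟨p, C, hC⟩ := (hK i).exists_walls (hT i) (by linarith) hN'
  set n := N * (L₀ + 1) with hn
  have hhalf : ∀ k, (Wall.ofSet (C k)).IsHalf (C k) := fun k => Wall.isHalf_ofSet.2 (Or.inl rfl)
  let w : ℕ → Wall S := fun k => (Wall.ofSet (C k)).comap (π i)
  have hwhalf : ∀ k, (w k).IsHalf (π i ⁻¹' C k) := fun k => (hhalf k).comap _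
  have hwsep : ∀ k ∈ Set.Icc 1 n, (w k).halfAt s ≠ (w k).halfAt t := fun k hk =>
    Wall.halfAt_ne_of_mem_notMem (hwhalf k) (hC k hk).2.1 (hC k hk).2.2.1
  -- distinct walls of the geodesic induce distinct walls of `S`
  have hstrict : ∀ j ∈ Set.Icc 1 n, ∀ k ∈ Set.Icc 1 n, j < k → ∃ u, π i u ∈ C k ∧ π i u ∉ C j := by
    intro j hj k hk hjk
    obtain ⟨u, v, hu, hv, huv⟩ := hJ (fun u => π i u ∈ C j) s t (hC j hj).2.1 (hC j hj).2.2.1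
    by_contra! hcon
    obtain ⟨hd, hsub⟩ := (hC k hk).2.2.2 j hj hjk
    have hv' : π i v ∉ C k := fun h => hv (hcon v h)
    -- Both walls would separate `u` from `v`, which are at distance at most `J`. Both centres would
    -- then be coarsely between them, at distance at most `J + 2 * K i` from each other, which is
    -- less than `R`.
    have h1 := (hT i).dist_add_le_of_halfAt_ne (hC j hj).1
      (Wall.halfAt_ne_of_mem_notMem (hhalf j) hu hv)
    have h2 := (hT i).dist_add_le_of_halfAt_ne (hC k hk).1
      (Wall.halfAt_ne_of_mem_notMem (hhalf k) (hsub hu) hv')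
    have h3 := huv i
    have h4 := dist_triangle_left (p j) (p k) (π i u)
    have h5 := dist_triangle_right (p j) (p k) (π i v)
    linarith
  have hwne : ∀ j ∈ Set.Icc 1 n, ∀ k ∈ Set.Icc 1 n, j < k → w j ≠ w k := by
    intro j hj k hk hjk heq
    obtain ⟨u, hu, hu'⟩ := hstrict j hj k hk hjk
    have h1 := (heq ▸ hwhalf j).eq_or_eq_compl (hwhalf k)
    rcases h1 with h1 | h1
    · exact hu' (h1.le hu)
    · exact (h1.le ((hC k hk).2.1 : s ∈ π i ⁻¹' C k)) (hC j hj).2.1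
  have hwinj : Set.InjOn w (Set.Icc 1 n) := by
    intro j hj k hk heq
    rcases lt_trichotomy j k with h | h | h
    · exact absurd heq (hwne j hj k hk h)
    · exact h
    · exact absurd heq.symm (hwne k hk j hj h)
  let w' : ℕ → Wall (T i) := fun k => Wall.ofSet (C k)
  have hwinj' : Set.InjOn w' (Set.Icc 1 n) := fun j hj k hk heq =>
    hwinj hj hk (congrArg (Wall.comap (π i)) heq)
  have hmono : ∀ j ∈ Set.Icc 1 n, ∀ k ∈ Set.Icc 1 n, j ≤ k → C j ⊆ C k := by
    intro j hj k hk hjk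
    rcases hjk.eq_or_lt with rfl | h
    · exact subset_rfl
    · exact ((hC k hk).2.2.2 j hj h).2
  have hdisp : ∀ I ⊆ Set.Icc 1 n, w' '' I ∈ disparateChains (K i) := by
    intro I hI
    have hx : ∀ k ∈ I, (w' k).halfAt (π i s) = C k := fun k hk =>
      ((w' k).eq_halfAt _ _ (hhalf k) (hC k (hI hk)).2.1).symm
    have hinv : ∀ k ∈ I, Function.invFunOn w' (Set.Icc 1 n) (w' k) = k := fun k hk =>
      hwinj'.leftInvOn_invFunOn (hI hk)
    refine ⟨((Set.finite_Icc 1 n).subset hI).image _, ⟨fun h => h.halfAt (π i s),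
      fun h _ => h.halfAt_isHalf _, ?_⟩, fun h => p (Function.invFunOn w' (Set.Icc 1 n) h), ?_, ?_⟩
    · rintro _ ⟨j, hj, rfl⟩ _ ⟨k, hk, rfl⟩
      beta_reduce
      rw [hx j hj, hx k hk]
      exact (le_total j k).imp (hmono j (hI hj) k (hI hk)) (hmono k (hI hk) j (hI hj))
    · rintro _ ⟨k, hk, rfl⟩
      beta_reduce
      rw [hinv k hk]
      exact (hC k (hI hk)).1
    · rintro _ ⟨j, hj, rfl⟩ _ ⟨k, hk, rfl⟩ hne
      beta_reduce
      rw [hinv j hj, hinv k hk]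
      rcases lt_trichotomy j k with h | h | h
      · linarith [((hC k (hI hk)).2.2.2 j (hI hj) h).1]
      · exact absurd (h ▸ rfl) hne
      · rw [dist_comm]
        linarith [((hC j (hI hj)).2.2.2 k (hI hk) h).1]
  have hmem : ∀ a ∈ Set.Icc 1 N, a * (L₀ + 1) ∈ Set.Icc 1 n := fun a ha =>
    ⟨Nat.mul_pos ha.1 (Nat.succ_pos _), Nat.mul_le_mul_right _ ha.2⟩
  have hinj : Set.InjOn (fun a => w (a * (L₀ + 1))) (Set.Icc 1 N) := fun a ha b hb heq =>
    Nat.eq_of_mul_eq_mul_right (Nat.succ_pos _) (hwinj (hmem a ha) (hmem b hb) heq)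
  -- few walls cross two of the chosen walls
  have hfew : ∀ a ∈ Set.Icc 1 N, ∀ b ∈ Set.Icc 1 N, a < b → ∀ d ∈ chainUnions π K,
      (∀ l ∈ d, l.Crosses (w (a * (L₀ + 1))) ∧ l.Crosses (w (b * (L₀ + 1)))) → d.encard ≤ L := by
    intro a ha b hb hab d hd hl
    obtain ⟨⟨e, he, rfl⟩, -⟩ := hd
    have hIcc : Set.Icc (a * (L₀ + 1)) (b * (L₀ + 1)) ⊆ Set.Icc 1 n :=
      Set.Icc_subset_Icc (hmem a ha).1 (hmem b hb).2
    have hej : ∀ j, (e j).ncard ≤ L₀ := by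
      intro j
      have h1 := hL₀ j i (e j) (he j) _ (hdisp _ hIcc) (by
        rintro h hh _ ⟨k, hk, rfl⟩
        obtain ⟨c1, c2⟩ := hl _ (Set.mem_iUnion.2 ⟨j, h, hh, rfl⟩)
        exact c1.between c2 (hwhalf _) (hwhalf _) (hwhalf _)
          (Set.preimage_mono (hmono _ (hmem a ha) _ (hIcc hk) hk.1))
          (Set.preimage_mono (hmono _ (hIcc hk) _ (hmem b hb) hk.2)))
      -- With both ends included there are at least `L₀ + 2` walls, so the minimum in the grid bound
      -- must be the size of `e j`.
      have h2 : (L₀ : ℕ∞) < (w' '' Set.Icc (a * (L₀ + 1)) (b * (L₀ + 1))).encard := by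
        rw [(hwinj'.mono hIcc).encard_image, ← (Set.finite_Icc _ _).cast_ncard_eq,
          ← Finset.coe_Icc, Set.ncard_coe_finset, Nat.card_Icc]
        have h3 : (a + 1) * (L₀ + 1) ≤ b * (L₀ + 1) := Nat.mul_le_mul_right _ hab
        rw [add_mul] at h3
        exact_mod_cast (by omega)
      rcases min_le_iff.1 h1 with h1 | h1
      · rw [← (he j).1.cast_ncard_eq] at h1
        exact_mod_cast h1
      · exact absurd h1 (not_le.2 h2)
    have hfin : ∀ j, (Wall.comap (π j) '' e j).Finite := fun j => (he j).1.image _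
    have h4 := ncard_le_sum_of_subset_iUnion hfin subset_rfl
    have h5 : ∑ j, (Wall.comap (π j) '' e j).ncard ≤ ∑ _j : Fin m, L₀ :=
      Finset.sum_le_sum fun j _ => (Set.ncard_image_le (he j).1).trans (hej j)
    rw [Finset.sum_const, Finset.card_univ, Fintype.card_fin, smul_eq_mul] at h5
    rw [← (Set.finite_iUnion hfin).cast_ncard_eq]
    exact_mod_cast (h4.trans h5).trans hL
  refine ⟨(fun a => w (a * (L₀ + 1))) '' Set.Icc 1 N, ⟨⟨?_, ?_⟩, ?_⟩, ?_, ?_⟩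
  · have := image_comap_mem_unionsOfChains (π := π) s (hdisp
      ((fun a => a * (L₀ + 1)) '' Set.Icc 1 N) (by
        rintro _ ⟨a, ha, rfl⟩
        exact hmem a ha))
    rwa [Set.image_image, Set.image_image] at this
  · refine ⟨fun h => h.halfAt s, fun h _ => h.halfAt_isHalf _, ?_⟩
    have hx : ∀ k ∈ Set.Icc 1 n, (w k).halfAt s = π i ⁻¹' C k := fun k hk =>
      ((w k).eq_halfAt _ _ (hwhalf k) (hC k hk).2.1).symm
    rintro _ ⟨a, ha, rfl⟩ _ ⟨b, hb, rfl⟩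
    beta_reduce
    rw [hx _ (hmem a ha), hx _ (hmem b hb)]
    exact (le_total (a * (L₀ + 1)) (b * (L₀ + 1))).imp
      (fun h => Set.preimage_mono (hmono _ (hmem a ha) _ (hmem b hb) h))
      (fun h => Set.preimage_mono (hmono _ (hmem b hb) _ (hmem a ha) h))
  · rintro _ ⟨a, ha, rfl⟩ _ ⟨b, hb, rfl⟩ hne d hd hl
    rcases lt_trichotomy a b with h | h | h
    · exact hfew a ha b hb h d hd hl
    · exact absurd (h ▸ rfl) hne
    · exact hfew b hb a ha h d hd fun l hld => (hl l hld).symm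
  · rintro _ ⟨a, ha, rfl⟩
    exact hwsep _ (hmem a ha)
  · rw [hinj.ncard_image, ← Finset.coe_Icc, Set.ncard_coe_finset, Nat.card_Icc]
    omega

end Lower

/-! ### Coarse medians -/

section Medians

variable {X : Type*} [MetricSpace X]

/-- `m` is coarsely between any two of `x`, `y`, `z`. -/
def IsMedianUpTo (C : ℝ) (x y z m : X) : Prop :=
  dist x m + dist m y ≤ dist x y + C ∧ dist y m + dist m z ≤ dist y z + C ∧
    dist z m + dist m x ≤ dist z x + C

theorem IsRoughGeodesic.dist_add_le {k ℓ : ℝ} {x y : X} {γ : ℝ → X}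
    (hγ : IsRoughGeodesic k x y ℓ γ) {t : ℝ} (ht : t ∈ Set.Icc 0 ℓ) :
    dist x (γ t) + dist (γ t) y ≤ dist x y + 3 * k := by
  obtain ⟨hℓ, rfl, rfl, h⟩ := hγ
  have h0 : (0 : ℝ) ∈ Set.Icc 0 ℓ := ⟨le_rfl, hℓ⟩
  have h1 : ℓ ∈ Set.Icc 0 ℓ := ⟨hℓ, le_rfl⟩
  have a1 := abs_le.1 (h 0 h0 t ht)
  have a2 := abs_le.1 (h t ht ℓ h1)
  have a3 := abs_le.1 (h 0 h0 ℓ h1)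
  rw [zero_sub, abs_neg, abs_of_nonneg ht.1] at a1
  rw [abs_of_nonpos (by linarith [ht.2] : t - ℓ ≤ 0)] at a2
  rw [zero_sub, abs_neg, abs_of_nonneg hℓ] at a3
  linarith

/-- Sampling `γ` at integer times and at `ℓ` gives a finite sequence along which `P` must fail for
the first time. -/
theorem IsRoughGeodesic.exists_step {k ℓ : ℝ} {x y : X} {γ : ℝ → X}
    (hγ : IsRoughGeodesic k x y ℓ γ) {P : X → Prop} (hx : P x) (hy : ¬ P y) :
    ∃ s ∈ Set.Icc 0 ℓ, ∃ t ∈ Set.Icc 0 ℓ, P (γ s) ∧ ¬ P (γ t) ∧ dist (γ s) (γ t) ≤ 1 + k := by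
  obtain ⟨hℓ, rfl, rfl, h⟩ := hγ
  have hmem : ∀ n : ℕ, min (n : ℝ) ℓ ∈ Set.Icc 0 ℓ := fun n =>
    ⟨le_min (Nat.cast_nonneg n) hℓ, min_le_right _ _⟩
  by_contra! hcon
  have hall : ∀ n : ℕ, P (γ (min n ℓ)) := by
    intro n
    induction n with
    | zero => simpa [hℓ] using hx
    | succ n ih =>
      by_contra hn
      have h1 := hcon _ (hmem n) _ (hmem (n + 1)) ih hn
      have h2 := (abs_le.1 (h _ (hmem n) _ (hmem (n + 1)))).2
      have h3 : |min (n : ℝ) ℓ - min ((n + 1 : ℕ) : ℝ) ℓ| ≤ 1 := by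
        refine (abs_min_sub_min_le_max _ _ _ _).trans ?_
        push_cast
        simp
      linarith
  obtain ⟨n, hn⟩ := exists_nat_ge ℓ
  have := hall n
  rw [min_eq_right hn] at this
  exact hy this

theorem RoughlyGeodesic.nonneg {k : ℝ} (hX : RoughlyGeodesic X k) (x : X) : 0 ≤ k := by
  obtain ⟨ℓ, γ, hℓ, -, -, h⟩ := hX x x
  exact (abs_nonneg _).trans (h 0 ⟨le_rfl, hℓ⟩ 0 ⟨le_rfl, hℓ⟩)

theorem IsCoarseMedian.exists_isMedianUpTo {μ : X → X → X → X} (hμ : IsCoarseMedian μ) {k : ℝ}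
    (hX : RoughlyGeodesic X k) : ∃ C : ℝ, ∀ x y z, IsMedianUpTo C x y z (μ x y z) := by
  obtain ⟨C, hC⟩ := hμ k
  have key : ∀ x y z p q, ((p = x ∧ q = y) ∨ (p = y ∧ q = z) ∨ (p = z ∧ q = x)) →
      dist p (μ x y z) + dist (μ x y z) q ≤ dist p q + (3 * k + 2 * C) := by
    intro x y z p q hpq
    obtain ⟨ℓ, γ, hγ⟩ := hX p q
    obtain ⟨t, ht, hd⟩ := hC x y z p q hpq ℓ γ hγ
    have h1 := hγ.dist_add_le ht
    have h2 := dist_triangle p (γ t) (μ x y z)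
    have h3 := dist_triangle (μ x y z) (γ t) q
    rw [dist_comm (γ t) (μ x y z)] at h2
    linarith
  exact ⟨_, fun x y z => ⟨key x y z x y (Or.inl ⟨rfl, rfl⟩),
    key x y z y z (Or.inr (Or.inl ⟨rfl, rfl⟩)), key x y z z x (Or.inr (Or.inr ⟨rfl, rfl⟩))⟩⟩

/-- Both medians lie coarsely between `a` and `b`, at distances from `b` that are coarsely the
Gromov products at `b` of `a` with `c` and of `a` with `e`. The hypothesis `h` says that these
products differ by at most `δ`. -/
theorem Hyperbolic.dist_median_le {δ C : ℝ} (hX : Hyperbolic X δ) {a b c e u v : X}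
    (hu : IsMedianUpTo C a b c u) (hv : IsMedianUpTo C a b e v)
    (h : |(dist a c + dist b e) - (dist a e + dist b c)| ≤ 2 * δ) :
    dist u v ≤ 5 / 2 * C + 3 * δ := by
  obtain ⟨u1, u2, u3⟩ := hu
  obtain ⟨v1, v2, v3⟩ := hv
  have t1 := dist_triangle a u c
  have t2 := dist_triangle a v e
  have t3 := dist_triangle a u b
  have t4 := dist_triangle a v b
  have t5 := dist_triangle b u c
  have t6 := dist_triangle b v e
  have h' := abs_le.1 h
  have hE : |dist u b - dist v b| ≤ 3 / 2 * C + δ := by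
    rw [dist_comm b u] at *
    rw [dist_comm b v] at *
    rw [dist_comm c u, dist_comm u a, dist_comm c a] at u3
    rw [dist_comm e v, dist_comm v a, dist_comm e a] at v3
    rw [abs_le]
    constructor <;> linarith
  have := hX.dist_le_of_between u1 v1 hE
  linarith

/-- In a hyperbolic space, two of the medians of a quadrilateral coincide coarsely. -/
theorem Hyperbolic.exists_close_medians {δ C : ℝ} (hX : Hyperbolic X δ) {μ : X → X → X → X}
    (hμ : ∀ x y z, IsMedianUpTo C x y z (μ x y z)) (a b c e : X) :
    dist (μ a b c) (μ a b e) ≤ 5 / 2 * C + 3 * δ ∨ dist (μ a c b) (μ a c e) ≤ 5 / 2 * C + 3 * δ ∨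
      dist (μ a e b) (μ a e c) ≤ 5 / 2 * C + 3 * δ := by
  have h1 := hX.four_point a b c e
  have h2 := hX.four_point a c b e
  have h3 := hX.four_point a b e c
  have e1 : dist c b = dist b c := dist_comm _ _
  have e2 : dist e c = dist c e := dist_comm _ _
  have e3 : dist e b = dist b e := dist_comm _ _
  rw [e1] at h2
  rw [e2] at h3
  -- Of the three sums of distances between opposite pairs, the two largest differ by at most `2 *
  -- δ`. Which two they are decides which medians coincide.
  by_cases c1 : |(dist a c + dist b e) - (dist a e + dist b c)| ≤ 2 * δ
  · exact Or.inl (hX.dist_median_le (hμ _ _ _) (hμ _ _ _) c1)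
  by_cases c2 : |(dist a b + dist c e) - (dist a e + dist c b)| ≤ 2 * δ
  · exact Or.inr (Or.inl (hX.dist_median_le (hμ _ _ _) (hμ _ _ _) c2))
  refine Or.inr (Or.inr (hX.dist_median_le (hμ _ _ _) (hμ _ _ _) ?_))
  rw [e1] at c2
  rw [e2, e3]
  rw [abs_le] at c1 c2 ⊢
  have d1 : dist a c + dist b e ≤ dist a b + dist c e + 2 * δ ∨
      dist a c + dist b e ≤ dist b c + dist a e + 2 * δ := by
    rcases max_choice (dist a b + dist c e) (dist b c + dist a e) with h | h <;> rw [h] at h1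
    exacts [Or.inl h1, Or.inr h1]
  have d2 : dist a b + dist c e ≤ dist a c + dist b e + 2 * δ ∨
      dist a b + dist c e ≤ dist b c + dist a e + 2 * δ := by
    rcases max_choice (dist a c + dist b e) (dist b c + dist a e) with h | h <;> rw [h] at h2
    exacts [Or.inl h2, Or.inr h2]
  have d3 : dist a e + dist b c ≤ dist a b + dist c e + 2 * δ ∨
      dist a e + dist b c ≤ dist b e + dist a c + 2 * δ := by
    rcases max_choice (dist a b + dist c e) (dist b e + dist a c) with h | h <;> rw [h] at h3
    exacts [Or.inl h3, Or.inr h3]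
  constructor
  · by_contra hcon
    rcases d3 with d3 | d3 <;> rcases d2 with d2 | d2 <;> rcases d1 with d1 | d1 <;>
      first
      | linarith
      | exact c1 ⟨by linarith, by linarith⟩
  · by_contra hcon
    rcases d3 with d3 | d3 <;> rcases d2 with d2 | d2 <;> rcases d1 with d1 | d1 <;>
      first
      | linarith
      | exact c1 ⟨by linarith, by linarith⟩
      | exact c2 ⟨by linarith, by linarith⟩

end Medians

/-! ### Quasimedian embeddings -/

section Quasimedian

variable {X : Type*} [MetricSpace X] {m : ℕ} {T : Fin m → Type w} [∀ i, MetricSpace (T i)]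

theorem dist_le_l1Dist (a b : ∀ i, T i) (i : Fin m) : dist (a i) (b i) ≤ l1Dist a b :=
  Finset.single_le_sum (f := fun i => dist (a i) (b i)) (fun _ _ => dist_nonneg)
    (Finset.mem_univ i)

/-- The median of `X` is sent coarsely between the images of the three points in each factor. -/
theorem IsQuasimedian.exists_isMedianUpTo {Y : Type*} {μX : Y → Y → Y → Y} {μT : ∀ i, T i → T i → T i → T i}
    {f : Y → ∀ i, T i} (hf : IsQuasimedian μX μT f) (hT : ∀ i, Geodesic (T i))
    (hμT : ∀ i, IsCoarseMedian (μT i)) :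
    ∃ C : ℝ, ∀ x y z i, IsMedianUpTo C (f x i) (f y i) (f z i) (f (μX x y z) i) := by
  obtain ⟨δ, hδ⟩ := hf
  choose C hC using fun i => (hμT i).exists_isMedianUpTo (hT i)
  refine ⟨∑ i, |C i| + 2 * δ, fun x y z i => ?_⟩
  have h1 := (dist_le_l1Dist _ _ i).trans (hδ x y z)
  have h2 : C i ≤ ∑ i, |C i| := (le_abs_self _).trans
    (Finset.single_le_sum (f := fun i => |C i|) (fun _ _ => abs_nonneg _) (Finset.mem_univ i))
  have key : ∀ p q : T i, dist p (μT i (f x i) (f y i) (f z i)) +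
      dist (μT i (f x i) (f y i) (f z i)) q ≤ dist p q + C i →
      dist p (f (μX x y z) i) + dist (f (μX x y z) i) q ≤ dist p q + (∑ i, |C i| + 2 * δ) := by
    intro p q h
    have h3 := dist_triangle p (μT i (f x i) (f y i) (f z i)) (f (μX x y z) i)
    have h4 := dist_triangle (f (μX x y z) i) (μT i (f x i) (f y i) (f z i)) q
    rw [dist_comm (f (μX x y z) i) (μT i _ _ _)] at h4
    linarith
  obtain ⟨a1, a2, a3⟩ := hC i (f x i) (f y i) (f z i)
  exact ⟨key _ _ a1, key _ _ a2, key _ _ a3⟩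

/-- Rough geodesics are sent to unparametrised rough geodesics in each factor. -/
theorem IsQuasimedian.exists_between {μX : X → X → X → X} (hμX : IsCoarseMedian μX)
    {μT : ∀ i, T i → T i → T i → T i} {f : X → ∀ i, T i} (hf : IsQuasimedian μX μT f)
    (hfq : IsQuasiIsometricEmbedding dist l1Dist f) (hT : ∀ i, Geodesic (T i))
    (hμT : ∀ i, IsCoarseMedian (μT i)) {k : ℝ} (hX : RoughlyGeodesic X k) :
    ∃ C : ℝ, ∀ x y ℓ γ, IsRoughGeodesic k x y ℓ γ → ∀ t ∈ Set.Icc 0 ℓ, ∀ i,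
      dist (f x i) (f (γ t) i) + dist (f (γ t) i) (f y i) ≤ dist (f x i) (f y i) + C := by
  obtain ⟨C, hC⟩ := hμX.exists_isMedianUpTo hX
  obtain ⟨C', hC'⟩ := hf.exists_isMedianUpTo hT hμT
  obtain ⟨lam, c, hl, hc, hq⟩ := hfq
  refine ⟨C' + 2 * (lam * (C + 3 / 2 * k) + c), fun x y ℓ γ hγ t ht i => ?_⟩
  have h1 := hγ.dist_add_le ht
  obtain ⟨a1, a2, a3⟩ := hC x (γ t) y
  -- As `γ t` is coarsely between `x` and `y`, it is close to its median `v` with them, and `f`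
  -- sends `v` coarsely between the images of `x` and `y`.
  set v := μX x (γ t) y with hv
  have h2 : dist v (γ t) ≤ C + 3 / 2 * k := by
    have h3 := dist_triangle x v y
    rw [dist_comm (γ t) v] at a2
    linarith
  have h4 : dist (f v i) (f (γ t) i) ≤ lam * (C + 3 / 2 * k) + c :=
    ((dist_le_l1Dist _ _ i).trans (hq v (γ t)).2).trans (by gcongr)
  have h5 := (hC' x (γ t) y i).2.2
  rw [← hv, dist_comm (f y i) (f v i), dist_comm (f v i) (f x i), dist_comm (f y i) (f x i)] at h5
  have h6 := dist_triangle (f x i) (f v i) (f (γ t) i)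
  have h7 := dist_triangle (f (γ t) i) (f v i) (f y i)
  rw [dist_comm (f (γ t) i) (f v i)] at h7
  linarith

end Quasimedian

/-! ### Grids -/

section Grid

/-- A wall of `d` either cuts `u` off from both `a` and `a'`, or cuts `v` off from both `b` and
`b'`, or separates `u` from `v`. Each kind is counted by a Gromov product: at most `C / 2` for the
first two, at most `D` for the last. -/
theorem ncard_le_of_medians {T : Type*} [MetricSpace T] (hT : Geodesic T) {K : ℝ}
    (hK : IsAdmissibleRadius T K) {d : Set (Wall T)} (hd : d ∈ disparateChains K)
    {a a' b b' u v : T} {C D : ℝ} (ha : ∀ h ∈ d, h.halfAt a = h.halfAt a')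
    (hb : ∀ h ∈ d, h.halfAt b = h.halfAt b') (hab : ∀ h ∈ d, h.halfAt a ≠ h.halfAt b)
    (hu : dist a u + dist u a' ≤ dist a a' + C) (hv : dist b v + dist v b' ≤ dist b b' + C)
    (hD : dist u v ≤ D) :
    (d.ncard : ℝ) ≤
      2 * ((C / 2 + 2 * K) / (7 * K) + 1) + ((D + 2 * K) / (7 * K) + 1) := by
  obtain ⟨hf, -, p, hp, hfar⟩ := hd
  have hK0 := hK.pos a
  obtain ⟨δ, hδ, hKδ⟩ := hK.1
  have count : ∀ (x y z : T) (e : Set (Wall T)), e ⊆ d → (∀ h ∈ e, h.halfAt x ≠ h.halfAt z) →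
      (∀ h ∈ e, h.halfAt y ≠ h.halfAt z) →
      (e.ncard : ℝ) ≤ (gromovProduct x y z + 2 * K) / (7 * K) + 1 := fun x y z e he h1 h2 =>
    ncard_le_gromovProduct hT hδ hKδ hK0 id p (fun h hh => hp h (he hh))
      (fun h hh k hk => hfar h (he hh) k (he hk)) h1 h2
  set d₁ := {h | h ∈ d ∧ h.halfAt a ≠ h.halfAt u}
  set d₂ := {h | h ∈ d ∧ h.halfAt b ≠ h.halfAt v}
  set d₃ := {h | h ∈ d ∧ h.halfAt u ≠ h.halfAt v}
  have c1 := count a a' u d₁ (fun h hh => hh.1) (fun h hh => hh.2)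
    (fun h hh => ha h hh.1 ▸ hh.2)
  have c2 := count b b' v d₂ (fun h hh => hh.1) (fun h hh => hh.2)
    (fun h hh => hb h hh.1 ▸ hh.2)
  have c3 := count u u v d₃ (fun h hh => hh.1) (fun h hh => hh.2) (fun h hh => hh.2)
  have g1 : gromovProduct a a' u ≤ C / 2 := by
    unfold gromovProduct
    rw [dist_comm a' u]
    linarith
  have g2 : gromovProduct b b' v ≤ C / 2 := by
    unfold gromovProduct
    rw [dist_comm b' v]
    linarith
  rw [gromovProduct_self] at c3
  have hsub : d ⊆ d₁ ∪ (d₂ ∪ d₃) := by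
    intro h hh
    by_cases h1 : h.halfAt a = h.halfAt u
    · by_cases h2 : h.halfAt b = h.halfAt v
      · exact Or.inr (Or.inr ⟨hh, fun h3 => hab h hh (h1.trans (h3.trans h2.symm))⟩)
      · exact Or.inr (Or.inl ⟨hh, h2⟩)
    · exact Or.inl ⟨hh, h1⟩
  have hle : d.ncard ≤ d₁.ncard + (d₂.ncard + d₃.ncard) :=
    ((Set.ncard_le_ncard hsub ((hf.subset fun h hh => hh.1).union ((hf.subset fun h hh =>
      hh.1).union (hf.subset fun h hh => hh.1)))).trans (Set.ncard_union_le _ _)).trans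
      (Nat.add_le_add_left (Set.ncard_union_le _ _) _)
  have hle' : (d.ncard : ℝ) ≤ d₁.ncard + (d₂.ncard + d₃.ncard) := by exact_mod_cast hle
  have m1 : (gromovProduct a a' u + 2 * K) / (7 * K) ≤ (C / 2 + 2 * K) / (7 * K) := by gcongr
  have m2 : (gromovProduct b b' v + 2 * K) / (7 * K) ≤ (C / 2 + 2 * K) / (7 * K) := by gcongr
  have m3 : (dist u v + 2 * K) / (7 * K) ≤ (D + 2 * K) / (7 * K) := by gcongr
  linarith

variable {X : Type*} [MetricSpace X] {m : ℕ} {T : Fin m → Type w} [∀ i, MetricSpace (T i)]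
  {S : Type*} {π : ∀ i, S → T i} {K : Fin m → ℝ}

/-- The two sets are the smallest oriented halfspace and the complement of the largest: all walls of
the chain lie between them. -/
theorem exists_extreme_halves {S : Type*} {d : Set (Wall S)} (hd : d.Finite) (hc : IsWallChain d)
    (hne : d.Nonempty) : ∃ h ∈ d, ∃ k ∈ d, ∃ A B, h.IsHalf A ∧ k.IsHalf B ∧
      (∀ l ∈ d, ∀ s ∈ A, ∀ t ∈ A, l.halfAt s = l.halfAt t) ∧
      (∀ l ∈ d, ∀ s ∈ B, ∀ t ∈ B, l.halfAt s = l.halfAt t) ∧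
      ∀ l ∈ d, ∀ s ∈ A, ∀ t ∈ B, l.halfAt s ≠ l.halfAt t := by
  obtain ⟨o, ho, hn⟩ := hc
  obtain ⟨h, hh, hmin⟩ := hd.exists_minimalFor o d hne
  obtain ⟨k, hk, hmax⟩ := hd.exists_maximalFor o d hne
  have h1 : ∀ l ∈ d, o h ⊆ o l := fun l hl => (hn h hh l hl).elim id fun h' => hmin hl h'
  have h2 : ∀ l ∈ d, o l ⊆ o k := fun l hl => (hn l hl k hk).elim id fun h' => hmax hl h'
  refine ⟨h, hh, k, hk, o h, (o k)ᶜ, ho h hh, (ho k hk).compl, ?_, ?_, ?_⟩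
  · intro l hl s hs t ht
    exact (Wall.halfAt_eq_iff (ho l hl) s t).2 ⟨fun _ => h1 l hl ht, fun _ => h1 l hl hs⟩
  · intro l hl s hs t ht
    exact (Wall.halfAt_eq_iff (ho l hl) s t).2
      ⟨fun h' => absurd (h2 l hl h') hs, fun h' => absurd (h2 l hl h') ht⟩
  · intro l hl s hs t ht
    exact Wall.halfAt_ne_of_mem_notMem (ho l hl) (h1 l hl hs) fun h' => ht (h2 l hl h')

/-- Surjectivity of `F` gives points of `X` in the four extreme corners of the grid. Two medians of
this quadrilateral are close in `X`. In one of the two factors, one of them is coarsely between two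
corners on one side of the chain and the other between two corners on the opposite side, so
`ncard_le_of_medians` bounds that chain. -/
theorem exists_gridBound {k δ : ℝ} (hXg : RoughlyGeodesic X k) (hX : Hyperbolic X δ)
    (hT : ∀ i, Geodesic (T i)) {μX : X → X → X → X} (hμX : IsCoarseMedian μX)
    {μT : ∀ i, T i → T i → T i → T i} (hμT : ∀ i, IsCoarseMedian (μT i))
    {F : X → S} (hF : Function.Surjective F)
    (hfm : IsQuasimedian μX μT fun x i => π i (F x))
    (hfq : IsQuasiIsometricEmbedding dist l1Dist fun x i => π i (F x))
    (hK : ∀ i, IsAdmissibleRadius (T i) (K i)) : ∃ L₀ : ℕ, GridBound π K L₀ := by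
  obtain ⟨C, hC⟩ := hμX.exists_isMedianUpTo hXg
  obtain ⟨C', hC'⟩ := hfm.exists_isMedianUpTo hT hμT
  obtain ⟨lam, c, hl, hc, hq⟩ := hfq
  set E := 5 / 2 * C + 3 * δ with hE
  set D := lam * E + c with hD
  let b : Fin m → ℝ := fun i =>
    2 * ((C' / 2 + 2 * K i) / (7 * K i) + 1) + ((D + 2 * K i) / (7 * K i) + 1)
  refine ⟨∑ i, ⌈b i⌉₊, fun i j d₁ hd₁ d₂ hd₂ hgrid => ?_⟩
  have hb : ∀ i (d : Set (Wall (T i))), d ∈ disparateChains (K i) → (d.ncard : ℝ) ≤ b i →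
      d.encard ≤ ((∑ i, ⌈b i⌉₊ : ℕ) : ℕ∞) := by
    intro i d hd h
    rw [← hd.1.cast_ncard_eq]
    have h1 : d.ncard ≤ ⌈b i⌉₊ := by exact_mod_cast h.trans (Nat.le_ceil _)
    exact_mod_cast h1.trans
      (Finset.single_le_sum (f := fun i => ⌈b i⌉₊) (fun _ _ => Nat.zero_le _) (Finset.mem_univ i))
  rcases d₁.eq_empty_or_nonempty with rfl | hne₁
  · simp
  rcases d₂.eq_empty_or_nonempty with rfl | hne₂
  · simp
  obtain ⟨h, hh, h', hh', A, A', hA, hA', a1, a2, a3⟩ := exists_extreme_halves hd₁.1 hd₁.2.1 hne₁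
  obtain ⟨l, hl', l', hll, B, B', hB, hB', b1, b2, b3⟩ := exists_extreme_halves hd₂.1 hd₂.2.1 hne₂
  have corner : ∀ h ∈ d₁, ∀ l ∈ d₂, ∀ A B, h.IsHalf A → l.IsHalf B →
      ∃ x, π i (F x) ∈ A ∧ π j (F x) ∈ B := by
    intro h hh l hl A B hA hB
    obtain ⟨s, hs, hs'⟩ := hgrid h hh l hl _ _ (hA.comap (π i)) (hB.comap (π j))
    obtain ⟨x, rfl⟩ := hF s
    exact ⟨x, hs, hs'⟩
  obtain ⟨x00, p1, p2⟩ := corner h hh l hl' A B hA hB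
  obtain ⟨x01, p3, p4⟩ := corner h hh l' hll A B' hA hB'
  obtain ⟨x10, p5, p6⟩ := corner h' hh' l hl' A' B hA' hB
  obtain ⟨x11, p7, p8⟩ := corner h' hh' l' hll A' B' hA' hB'
  have close : ∀ x y, dist x y ≤ E → ∀ i, dist (π i (F x)) (π i (F y)) ≤ D := by
    intro x y hxy i
    exact ((dist_le_l1Dist (fun i => π i (F x)) (fun i => π i (F y)) i).trans
      (hq x y).2).trans (by rw [hD]; gcongr)
  rcases hX.exists_close_medians hC x00 x01 x10 x11 with h1 | h1 | h1
  · refine (min_le_right _ _).trans (hb j d₂ hd₂ ?_)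
    exact ncard_le_of_medians (hT j) (hK j) hd₂ (fun l hl => b1 l hl _ p2 _ p6)
      (fun l hl => b2 l hl _ p4 _ p8) (fun l hl => b3 l hl _ p2 _ p4)
      (by
        have := (hC' x00 x01 x10 j).2.2
        rwa [add_comm, dist_comm _ (π j (F x00)), dist_comm (π j (F x10)),
          dist_comm (π j (F x10)) (π j (F x00))] at this)
      (hC' x00 x01 x11 j).2.1 (close _ _ h1 j)
  · refine (min_le_left _ _).trans (hb i d₁ hd₁ ?_)
    exact ncard_le_of_medians (hT i) (hK i) hd₁ (fun l hl => a1 l hl _ p1 _ p3)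
      (fun l hl => a2 l hl _ p5 _ p7) (fun l hl => a3 l hl _ p1 _ p5)
      (by
        have := (hC' x00 x10 x01 i).2.2
        rwa [add_comm, dist_comm _ (π i (F x00)), dist_comm (π i (F x01)),
          dist_comm (π i (F x01)) (π i (F x00))] at this)
      (hC' x00 x10 x11 i).2.1 (close _ _ h1 i)
  · refine (min_le_left _ _).trans (hb i d₁ hd₁ ?_)
    exact ncard_le_of_medians (hT i) (hK i) hd₁ (fun l hl => a1 l hl _ p1 _ p3)
      (fun l hl => a2 l hl _ p7 _ p5) (fun l hl => a3 l hl _ p1 _ p7)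
      (by
        have := (hC' x00 x11 x01 i).2.2
        rwa [add_comm, dist_comm _ (π i (F x00)), dist_comm (π i (F x01)),
          dist_comm (π i (F x01)) (π i (F x00))] at this)
      (hC' x00 x11 x10 i).2.1 (close _ _ h1 i)

end Grid

/-! ### The quasiisometry to the dual -/

section QuasiIsometry

theorem isQuasiIsometricEmbedding_of_bounds {X Y : Type*} {dX : X → X → ℝ} {dY : Y → Y → ℝ}
    {f : X → Y} {a b a' b' : ℝ} (ha : 0 ≤ a) (hb : 0 ≤ b) (ha' : 0 ≤ a') (hb' : 0 ≤ b')
    (hdX : ∀ x y, 0 ≤ dX x y) (hdY : ∀ x y, 0 ≤ dY x y)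
    (h : ∀ x y, dX x y ≤ a * dY (f x) (f y) + b) (h' : ∀ x y, dY (f x) (f y) ≤ a' * dX x y + b') :
    IsQuasiIsometricEmbedding dX dY f := by
  refine ⟨1 + a + a', b + b', by linarith, by linarith, fun x y => ⟨?_, ?_⟩⟩
  · rw [sub_le_iff_le_add, inv_mul_le_iff₀ (by linarith)]
    have h1 := h x y
    have h2 := hdY (f x) (f y)
    have h3 : 0 ≤ (1 + a') * dY (f x) (f y) := by positivity
    have h4 : 0 ≤ (a + a') * (b + b') := by positivity
    nlinarith
  · have h1 := h' x y
    have h2 : 0 ≤ (1 + a) * dX x y := mul_nonneg (by linarith) (hdX x y)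
    nlinarith

/-- A point of `S`, seen in the dual. -/
noncomputable def principalDual {S : Type*} {𝒟 : WallSystem S} (h𝒟 : 𝒟.IsDualisable) (s : S) :
    𝒟.Dual :=
  ⟨principal 𝒟.walls s, fun t => h𝒟 s t⟩

open WallSystem WallUltrafilter

variable {X : Type*} [MetricSpace X] {m : ℕ} {T : Fin m → Type w} [∀ i, MetricSpace (T i)]
  {S : Type*} [Nonempty S] {π : ∀ i, S → T i} {K : Fin m → ℝ} {L : ℕ}

theorem separates_principalDual_iff (h𝒟 : (lChainSystem π K L).IsDualisable) {c : Set (Wall S)}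
    (hc : c ∈ (lChainSystem π K L).coll) (s t : S) :
    Separates c (principalDual h𝒟 s).1 (principalDual h𝒟 t).1 ↔
      ∀ h ∈ c, h.halfAt s ≠ h.halfAt t :=
  separates_principal_iff ((lChainSystem π K L).subset_walls c hc)

theorem dist_principalDual_le (hT : ∀ i, Geodesic (T i)) (hK : ∀ i, IsAdmissibleRadius (T i) (K i))
    (h𝒟 : (lChainSystem π K L).IsDualisable) (s t : S) :
    dist (principalDual h𝒟 s) (principalDual h𝒟 t) ≤
      ∑ i, ((dist (π i s) (π i t) + 2 * K i) / (7 * K i) + 1) := by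
  have h0 := (lChainSystem_isGluable (π := π) hT (fun i => (hK i).pos (π i s)) L).empty_mem
  refine dist_le_of_forall h0 fun c hc hs => ?_
  rw [separates_principalDual_iff h𝒟 hc] at hs
  simpa only [gromovProduct_self] using ncard_le_sum_gromovProduct hT hK hc.1.1 hs hs

theorem dist_le_dist_principalDual (hT : ∀ i, Geodesic (T i))
    (hK : ∀ i, IsAdmissibleRadius (T i) (K i)) {J : ℝ} (hJ0 : 0 ≤ J)
    (hJ : ∀ (P : S → Prop) (s t : S), P s → ¬ P t →
      ∃ u v, P u ∧ ¬ P v ∧ ∀ i, dist (π i u) (π i v) ≤ J)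
    {L₀ : ℕ} (hL₀ : GridBound π K L₀) (hL : m * L₀ ≤ L)
    (h𝒟 : (lChainSystem π K L).IsDualisable) (s t : S) (i : Fin m) :
    dist (π i s) (π i t) ≤ ((L₀ + 1) * (2 * J + 10 * K i + 1)) *
      (dist (principalDual h𝒟 s) (principalDual h𝒟 t) + 2) := by
  have hK0 := (hK i).pos (π i s)
  set Q := ((L₀ : ℝ) + 1) * (2 * J + 10 * K i + 1) with hQ
  have hQ0 : 0 < Q := by positivity
  rw [mul_comm, ← div_le_iff₀ hQ0]
  have hd : 0 ≤ dist (principalDual h𝒟 s) (principalDual h𝒟 t) := dist_nonneg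
  have hfl := Nat.lt_floor_add_one (dist (π i s) (π i t) / Q)
  rcases Nat.eq_zero_or_pos ⌊dist (π i s) (π i t) / Q⌋₊ with h0 | h0
  · rw [h0, Nat.cast_zero] at hfl
    linarith
  -- The integer part is `N + 1`, while the chain has `N` walls; rounding loses at most one more,
  -- whence the 2 in the statement.
  obtain ⟨N, hN⟩ := Nat.exists_eq_add_of_le' h0
  have hN' : ((N : ℝ) + 1) * Q ≤ dist (π i s) (π i t) := by
    rw [← le_div_iff₀ hQ0]
    refine le_trans ?_ (Nat.floor_le (div_nonneg dist_nonneg hQ0.le))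
    rw [hN]
    push_cast
    exact le_rfl
  obtain ⟨c, hc, hs, hcard⟩ := exists_lChain_separating hT hK hJ0 hJ hL₀ hL i s t hN'
  have h1 := ncard_le_dist (𝒟 := lChainSystem π K L) (x := principalDual h𝒟 s)
    (y := principalDual h𝒟 t) hc ((separates_principalDual_iff h𝒟 hc s t).2 hs)
  rw [hcard] at h1
  rw [hN] at hfl
  push_cast at hfl
  linarith

/-- Points that are coarsely between two others in every factor are so in the dual. -/
theorem dist_principalDual_add_le (hT : ∀ i, Geodesic (T i))
    (hK : ∀ i, IsAdmissibleRadius (T i) (K i)) (h𝒟 : (lChainSystem π K L).IsDualisable) {C : ℝ}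
    {s t u : S}
    (hu : ∀ i, dist (π i s) (π i u) + dist (π i u) (π i t) ≤ dist (π i s) (π i t) + C) :
    dist (principalDual h𝒟 s) (principalDual h𝒟 u) +
      dist (principalDual h𝒟 u) (principalDual h𝒟 t) ≤
      dist (principalDual h𝒟 s) (principalDual h𝒟 t) +
        ((L + 1 + (3 * m : ℕ)) + 2 * ∑ i, ((C / 2 + 2 * K i) / (7 * K i) + 1)) := by
  have hG := lChainSystem_isGluable (π := π) hT (fun i => (hK i).pos (π i s)) L
  have h1 := hG.dist_median_add_le (principalDual h𝒟 s) (principalDual h𝒟 t) (principalDual h𝒟 u)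
  rw [← dualMedian_rotate] at h1
  set v := dualMedian (principalDual h𝒟 u) (principalDual h𝒟 s) (principalDual h𝒟 t)
  -- A wall separating `u` from its median with `s` and `t` separates it from both, and such walls
  -- are counted by Gromov products, here at most `C / 2`.
  have h2 : dist (principalDual h𝒟 u) v ≤ ∑ i, ((C / 2 + 2 * K i) / (7 * K i) + 1) := by
    refine dist_le_of_forall hG.empty_mem fun c hc hs => ?_
    obtain ⟨hs1, hs2⟩ := (separates_median_iff hc).1 hs
    rw [separates_principalDual_iff h𝒟 hc] at hs1 hs2
    refine (ncard_le_sum_gromovProduct hT hK hc.1.1 (fun h hh => (hs1 h hh).symm)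
      (fun h hh => (hs2 h hh).symm)).trans (Finset.sum_le_sum fun i _ => ?_)
    have hK0 := (hK i).pos (π i s)
    gcongr
    have := hu i
    unfold gromovProduct
    rw [dist_comm (π i t) (π i u)]
    linarith
  have h3 := dist_triangle (principalDual h𝒟 s) v (principalDual h𝒟 u)
  have h4 := dist_triangle (principalDual h𝒟 u) v (principalDual h𝒟 t)
  rw [dist_comm v (principalDual h𝒟 u)] at h3
  linarith

/-- A chain realising the distance from the image of `x0` to `z` also separates `x0` from some point
`y0` of `X`, so `z` is coarsely between their images. A rough geodesic from `x0` to `y0` has an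
image that is coarsely between them and moves in bounded steps. Its point at the distance of `z` is
close to `z` by hyperbolicity. -/
theorem principalDual_coarselyDense [Nonempty X] {k : ℝ} (hXg : RoughlyGeodesic X k)
    (hT : ∀ i, Geodesic (T i)) {μX : X → X → X → X} (hμX : IsCoarseMedian μX)
    {μT : ∀ i, T i → T i → T i → T i} (hμT : ∀ i, IsCoarseMedian (μT i))
    {F : X → S} (hF : Function.Surjective F)
    (hfm : IsQuasimedian μX μT fun x i => π i (F x))
    (hfq : IsQuasiIsometricEmbedding dist l1Dist fun x i => π i (F x))
    (hK : ∀ i, IsAdmissibleRadius (T i) (K i)) (h𝒟 : (lChainSystem π K L).IsDualisable)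
    {A B : ℝ} (hA : 0 ≤ A)
    (hAB : ∀ x y, dist (principalDual h𝒟 (F x)) (principalDual h𝒟 (F y)) ≤ A * dist x y + B) :
    ∃ C : ℝ, ∀ z, ∃ x, dist (principalDual h𝒟 (F x)) z ≤ C := by
  have x0 : X := Classical.arbitrary X
  have hk := hXg.nonneg x0
  have hG := lChainSystem_isGluable (π := π) hT (fun i => (hK i).pos (π i (F x0))) L
  obtain ⟨C, hC⟩ := hfm.exists_between hμX hfq hT hμT hXg
  set C₁ : ℝ := (L + 1 + (3 * m : ℕ)) + 2 * ∑ i, ((C / 2 + 2 * K i) / (7 * K i) + 1) with hC₁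
  set E : ℝ := L + 1 + (3 * m : ℕ) with hE
  have hE0 : 0 ≤ E := by positivity
  set δ : ℝ := 2 * E + (L + 1) with hδ
  have hyp : Hyperbolic (lChainSystem π K L).Dual δ := hG.hyperbolic
  have hB0 : 0 ≤ B := by
    have := hAB x0 x0
    rwa [dist_self, dist_self, mul_zero, zero_add] at this
  have hδ0 : 0 ≤ δ := by positivity
  have hJ0 : 0 ≤ A * (1 + k) + B := by positivity
  refine ⟨max C₁ (2 * E) + (A * (1 + k) + B) + 2 * δ, fun z => ?_⟩
  have hmax := le_max_right C₁ (2 * E)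
  obtain ⟨c, hc, hs, hcd⟩ := exists_ncard_eq_dist hG.empty_mem (principalDual h𝒟 (F x0)) z
  rcases c.eq_empty_or_nonempty with rfl | hne
  · rw [Set.ncard_empty, Nat.cast_zero] at hcd
    exact ⟨x0, by rw [← hcd]; linarith⟩
  -- a point of `S` on the far side of all the walls of `c`
  have hcW := (lChainSystem π K L).subset_walls c hc
  obtain ⟨a, ha, hamax⟩ := (principalDual h𝒟 (F x0)).1.exists_greatest z.1 hcW
    (hG.chain c hc) hs (finite_of_separates_dual hc hs) hne
  obtain ⟨t, ht⟩ := z.1.side_nonempty (hcW ha)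
  obtain ⟨y0, rfl⟩ := hF t
  have hs' := (separates_iff hcW).1 hs
  have hst : Separates c (principalDual h𝒟 (F x0)).1 (principalDual h𝒟 (F y0)).1 := by
    rw [separates_principalDual_iff h𝒟 hc]
    intro h hh
    have e1 : (principalDual h𝒟 (F x0)).1.side h = h.halfAt (F x0) := side_principal (hcW hh) _
    refine Wall.halfAt_ne_of_mem_notMem (h.halfAt_isHalf (F x0)) (h.mem_halfAt _) fun h' => ?_
    rw [side_eq_compl _ _ (hcW ha) (hs' a ha)] at ht
    exact ht (hamax h hh (e1 ▸ h'))
  -- The chain `c` separates the image of `x0` from its median with `y0` and `z`, so the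
  -- corresponding Gromov product is nearly the whole distance to `z`.
  have hz : dist (principalDual h𝒟 (F y0)) z + dist z (principalDual h𝒟 (F x0)) ≤
      dist (principalDual h𝒟 (F y0)) (principalDual h𝒟 (F x0)) + 2 * E := by
    have h1 := ncard_le_dist hc ((separates_median_iff hc).2 ⟨hst, hs⟩)
    have h2 := (abs_le.1 (hG.abs_gromovProduct_sub_le (principalDual h𝒟 (F y0)) z
      (principalDual h𝒟 (F x0)))).1
    rw [dist_comm (principalDual h𝒟 (F x0)) z] at hcd
    unfold gromovProduct at h2
    linarith
  -- If `y0` is no farther from `x0` than `z`, betweenness leaves only `2 * E` between `y0` and `z`.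
  by_cases hy : dist (principalDual h𝒟 (F x0)) (principalDual h𝒟 (F y0)) ≤
      dist (principalDual h𝒟 (F x0)) z
  · refine ⟨y0, ?_⟩
    rw [dist_comm z, dist_comm (principalDual h𝒟 (F y0)) (principalDual h𝒟 (F x0))] at hz
    linarith
  obtain ⟨ℓ, γ, hγ⟩ := hXg x0 y0
  obtain ⟨p, hp, q, -, hp1, hq1, hpq⟩ := hγ.exists_step
    (P := fun x => dist (principalDual h𝒟 (F x0)) (principalDual h𝒟 (F x)) ≤
      dist (principalDual h𝒟 (F x0)) z) (by simp) hy
  refine ⟨γ p, ?_⟩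
  have h1 := dist_principalDual_add_le hT hK h𝒟 (hC x0 y0 ℓ γ hγ p hp)
  rw [← hC₁] at h1
  have h2 : dist (principalDual h𝒟 (F (γ p))) (principalDual h𝒟 (F (γ q))) ≤ A * (1 + k) + B :=
    (hAB _ _).trans (by gcongr)
  have h3 := dist_triangle (principalDual h𝒟 (F x0)) (principalDual h𝒟 (F (γ p)))
    (principalDual h𝒟 (F (γ q)))
  have hmax' := le_max_left C₁ (2 * E)
  refine hyp.dist_le_of_between (a := principalDual h𝒟 (F y0)) (b := principalDual h𝒟 (F x0))
    ?_ (hz.trans (by linarith)) ?_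
  · rw [dist_comm (principalDual h𝒟 (F y0)), dist_comm _ (principalDual h𝒟 (F x0)),
      dist_comm (principalDual h𝒟 (F y0))]
    linarith
  · rw [dist_comm _ (principalDual h𝒟 (F x0)), dist_comm z, abs_le]
    constructor <;> linarith

theorem principalDual_isQuasiIsometry [Nonempty X] {k : ℝ} (hXg : RoughlyGeodesic X k)
    (hT : ∀ i, Geodesic (T i)) {μX : X → X → X → X} (hμX : IsCoarseMedian μX)
    {μT : ∀ i, T i → T i → T i → T i} (hμT : ∀ i, IsCoarseMedian (μT i))
    {F : X → S} (hF : Function.Surjective F)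
    (hfm : IsQuasimedian μX μT fun x i => π i (F x))
    (hfq : IsQuasiIsometricEmbedding dist l1Dist fun x i => π i (F x))
    (hK : ∀ i, IsAdmissibleRadius (T i) (K i)) {L₀ : ℕ} (hL₀ : GridBound π K L₀)
    (hL : m * L₀ ≤ L) (h𝒟 : (lChainSystem π K L).IsDualisable) :
    IsQuasiIsometry dist dist fun x => principalDual h𝒟 (F x) := by
  have x0 : X := Classical.arbitrary X
  have hk := hXg.nonneg x0
  have hK0 := fun i => (hK i).pos (π i (F x0))
  obtain ⟨lam, c, hl, hc, hq⟩ := id hfq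
  have hlip : ∀ x y i, dist (π i (F x)) (π i (F y)) ≤ lam * dist x y + c := fun x y i =>
    (dist_le_l1Dist (fun i => π i (F x)) (fun i => π i (F y)) i).trans (hq x y).2
  set A := ∑ i, lam / (7 * K i) with hA
  set B := ∑ i, ((c + 2 * K i) / (7 * K i) + 1) with hB
  have hA0 : 0 ≤ A := Finset.sum_nonneg fun i _ => by
    have := hK0 i
    positivity
  have hB0 : 0 ≤ B := Finset.sum_nonneg fun i _ => by
    have := hK0 i
    positivity
  have hup : ∀ x y, dist (principalDual h𝒟 (F x)) (principalDual h𝒟 (F y)) ≤ A * dist x y + B := by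
    intro x y
    refine (dist_principalDual_le hT hK h𝒟 _ _).trans ?_
    rw [hA, hB, Finset.sum_mul, ← Finset.sum_add_distrib]
    refine Finset.sum_le_sum fun i _ => ?_
    have h1 := hK0 i
    have h2 : (dist (π i (F x)) (π i (F y)) + 2 * K i) / (7 * K i) ≤
        (lam * dist x y + c + 2 * K i) / (7 * K i) := by
      gcongr
      exact hlip x y i
    have h3 : (lam * dist x y + c + 2 * K i) / (7 * K i) =
        lam / (7 * K i) * dist x y + (c + 2 * K i) / (7 * K i) := by ring
    linarith
  -- Sampled rough geodesics of `X` have steps of length at most `1 + k`; `J` bounds the image of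
  -- such a step in every factor, so `S` has no larger gaps.
  set J := lam * (1 + k) + c with hJ
  have hJ0 : 0 ≤ J := by positivity
  have hJ' : ∀ (P : S → Prop) (s t : S), P s → ¬ P t →
      ∃ u v, P u ∧ ¬ P v ∧ ∀ i, dist (π i u) (π i v) ≤ J := by
    intro P s t hs ht
    obtain ⟨x, rfl⟩ := hF s
    obtain ⟨y, rfl⟩ := hF t
    obtain ⟨ℓ, γ, hγ⟩ := hXg x y
    obtain ⟨p, -, q, -, h1, h2, h3⟩ := hγ.exists_step (P := fun x => P (F x)) hs ht
    exact ⟨_, _, h1, h2, fun i => (hlip _ _ i).trans (by rw [hJ]; gcongr)⟩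
  set Q := ∑ i, ((L₀ : ℝ) + 1) * (2 * J + 10 * K i + 1) with hQ
  have hQ0 : 0 ≤ Q := Finset.sum_nonneg fun i _ => by
    have := hK0 i
    positivity
  refine ⟨isQuasiIsometricEmbedding_of_bounds (a := lam * Q) (b := lam * (2 * Q + c)) (a' := A)
    (b' := B) (by positivity) (by positivity) hA0 hB0 (fun _ _ => dist_nonneg)
    (fun _ _ => dist_nonneg) (fun x y => ?_) hup,
    principalDual_coarselyDense hXg hT hμX hμT hF hfm hfq hK h𝒟 hA0 hup⟩
  have h1 := (hq x y).1
  have h2 : l1Dist (fun i => π i (F x)) (fun i => π i (F y)) ≤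
      Q * (dist (principalDual h𝒟 (F x)) (principalDual h𝒟 (F y)) + 2) := by
    rw [hQ, Finset.sum_mul]
    exact Finset.sum_le_sum fun i _ =>
      dist_le_dist_principalDual hT hK hJ0 hJ' hL₀ hL h𝒟 (F x) (F y) i
  have h3 : lam⁻¹ * dist x y ≤
      Q * (dist (principalDual h𝒟 (F x)) (principalDual h𝒟 (F y)) + 2) + c := by linarith
  rw [inv_mul_le_iff₀ (by linarith)] at h3
  linarith

end QuasiIsometry

/-! ### Group actions -/

section Action

variable {G : Type*} [Group G] {S : Type*} [MulAction G S]

namespace Wall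

theorem IsHalf.smul {h : Wall S} {A : Set S} (g : G) (hA : h.IsHalf A) :
    (h.smul g).IsHalf (g • A) :=
  ⟨A, hA, rfl⟩

theorem smul_smul_wall (a b : G) (h : Wall S) : (h.smul a).smul b = h.smul (b * a) := by
  obtain ⟨A, hA⟩ := h.exists_isHalf
  refine eq_of_isHalf ((hA.smul a).smul b) ?_
  rw [smul_smul]
  exact hA.smul (b * a)

theorem one_smul_wall (h : Wall S) : h.smul (1 : G) = h := by
  obtain ⟨A, hA⟩ := h.exists_isHalf
  refine eq_of_isHalf (hA.smul 1) ?_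
  rwa [one_smul]

theorem inv_smul_smul_wall (g : G) (h : Wall S) : (h.smul g).smul g⁻¹ = h := by
  rw [smul_smul_wall, inv_mul_cancel, one_smul_wall]

theorem smul_inv_smul_wall (g : G) (h : Wall S) : (h.smul g⁻¹).smul g = h := by
  rw [smul_smul_wall, mul_inv_cancel, one_smul_wall]

theorem smul_wall_injective (g : G) : Function.Injective (Wall.smul (S := S) g) := fun h k hhk => by
  rw [← inv_smul_smul_wall g h, hhk, inv_smul_smul_wall]

theorem isHalf_smul_inv {h : Wall S} {A : Set S} (g : G) (hA : (h.smul g⁻¹).IsHalf A) :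
    h.IsHalf (g • A) := by
  have := hA.smul g
  rwa [smul_inv_smul_wall] at this

theorem isHalf_inv_smul {h : Wall S} {A : Set S} (g : G) (hA : (h.smul g).IsHalf A) :
    h.IsHalf (g⁻¹ • A) := by
  have := hA.smul g⁻¹
  rwa [inv_smul_smul_wall] at this

theorem Crosses.smul {h k : Wall S} (g : G) (hc : h.Crosses k) : (h.smul g).Crosses (k.smul g) := by
  intro A B hA hB
  obtain ⟨s, hs, hs'⟩ := hc _ _ (isHalf_inv_smul g hA) (isHalf_inv_smul g hB)
  exact ⟨g • s, Set.mem_inv_smul_set_iff.1 hs, Set.mem_inv_smul_set_iff.1 hs'⟩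

end Wall

theorem IsWallChain.smul {c : Set (Wall S)} (g : G) (hc : IsWallChain c) :
    IsWallChain (Wall.smul g '' c) := by
  obtain ⟨o, ho, hn⟩ := hc
  refine ⟨fun h => g • o (h.smul g⁻¹), ?_, ?_⟩
  · rintro _ ⟨h, hh, rfl⟩
    beta_reduce
    rw [Wall.inv_smul_smul_wall]
    exact (ho h hh).smul g
  · rintro _ ⟨h, hh, rfl⟩ _ ⟨k, hk, rfl⟩
    beta_reduce
    rw [Wall.inv_smul_smul_wall, Wall.inv_smul_smul_wall, Set.smul_set_subset_smul_set_iff,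
      Set.smul_set_subset_smul_set_iff]
    exact hn h hh k hk

namespace WallUltrafilter

variable {W : Set (Wall S)} (hW : ∀ (g : G), ∀ h ∈ W, h.smul g ∈ W)

/-- The translate of an ultrafilter. -/
def translateBy (g : G) (x : WallUltrafilter W) : WallUltrafilter W where
  half h := g • x.half ⟨h.1.smul g⁻¹, hW g⁻¹ h.1 h.2⟩
  isHalf h := Wall.isHalf_smul_inv g (x.isHalf ⟨h.1.smul g⁻¹, hW g⁻¹ h.1 h.2⟩)
  upward h k B hB hsub := by
    rw [x.upward ⟨h.1.smul g⁻¹, hW g⁻¹ h.1 h.2⟩ ⟨k.1.smul g⁻¹, hW g⁻¹ k.1 k.2⟩ (g⁻¹ • B)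
      (hB.smul g⁻¹) fun s hs => Set.mem_inv_smul_set_iff.2 (hsub (Set.smul_mem_smul_set hs)),
      smul_inv_smul]

theorem side_translateBy (g : G) (x : WallUltrafilter W) {h : Wall S} (hh : h ∈ W) :
    (translateBy hW g x).side h = g • x.side (h.smul g⁻¹) := by
  rw [side_of_mem _ hh, x.side_of_mem (hW g⁻¹ h hh)]
  rfl

theorem half_translateBy (g : G) (x : WallUltrafilter W) (h : W) :
    (translateBy hW g x).half ⟨h.1.smul g, hW g h.1 h.2⟩ = g • x.half h :=
  congrArg (fun k => g • x.half k) (Subtype.ext (Wall.inv_smul_smul_wall g h.1))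

theorem translateBy_one (x : WallUltrafilter W) : translateBy hW 1 x = x := by
  -- Extensionality is stated for wall systems; any system with walls `W` serves, such as that of
  -- all subsets.
  refine WallSystem.ext_side (𝒟 := ⟨W, {c | c ⊆ W}, fun _ h => h, fun _ h _ h' => h'.trans h,
    fun _ h => Set.singleton_subset_iff.2 h⟩) fun h hh => ?_
  rw [side_translateBy hW 1 x hh, one_smul, inv_one, Wall.one_smul_wall]

theorem translateBy_mul (a b : G) (x : WallUltrafilter W) :
    translateBy hW (a * b) x = translateBy hW a (translateBy hW b x) := by
  refine WallSystem.ext_side (𝒟 := ⟨W, {c | c ⊆ W}, fun _ h => h, fun _ h _ h' => h'.trans h,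
    fun _ h => Set.singleton_subset_iff.2 h⟩) fun h hh => ?_
  rw [side_translateBy hW _ _ hh, side_translateBy hW _ _ hh, side_translateBy hW _ _ (hW a⁻¹ h hh),
    Wall.smul_smul_wall, smul_smul, mul_inv_rev]

theorem translateBy_principal (g : G) (s : S) :
    translateBy hW g (principal W s) = principal W (g • s) := by
  apply WallUltrafilter.ext
  funext h
  exact h.1.eq_halfAt (g • s) _ (Wall.isHalf_smul_inv g (Wall.halfAt_isHalf _ _))
    (Set.smul_mem_smul_set (Wall.mem_halfAt _ _))

end WallUltrafilter

namespace WallSystem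

open WallUltrafilter

variable {𝒟 : WallSystem S} (hW : ∀ (g : G), ∀ h ∈ 𝒟.walls, h.smul g ∈ 𝒟.walls)

theorem edist_translateBy_le
    (hC : ∀ (g : G), ∀ c ∈ 𝒟.coll, Wall.smul g '' c ∈ 𝒟.coll)
    (g : G) (x y : WallUltrafilter 𝒟.walls) :
    𝒟.edist (translateBy hW g x) (translateBy hW g y) ≤ 𝒟.edist x y := by
  refine iSup₂_le ?_
  rintro c ⟨hc, hs⟩
  have hcW := 𝒟.subset_walls c hc
  rw [← (Wall.smul_wall_injective g⁻¹).encard_image]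
  refine encard_le_edist (hC g⁻¹ c hc) ?_
  rw [separates_iff hcW] at hs
  rw [separates_iff (𝒟.subset_walls _ (hC g⁻¹ c hc))]
  rintro _ ⟨h, hh, rfl⟩ heq
  refine hs h hh ?_
  rw [side_translateBy hW g x (hcW hh), side_translateBy hW g y (hcW hh), heq]

theorem edist_translateBy
    (hC : ∀ (g : G), ∀ c ∈ 𝒟.coll, Wall.smul g '' c ∈ 𝒟.coll)
    (g : G) (x y : WallUltrafilter 𝒟.walls) :
    𝒟.edist (translateBy hW g x) (translateBy hW g y) = 𝒟.edist x y := by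
  refine (edist_translateBy_le hW hC g x y).antisymm ?_
  have := edist_translateBy_le hW hC g⁻¹ (translateBy hW g x) (translateBy hW g y)
  rwa [← translateBy_mul, ← translateBy_mul, inv_mul_cancel, translateBy_one, translateBy_one] at this

/-- The action on the dual induced by an action that preserves the system of walls. -/
@[reducible]
def dualMulAction
    (hC : ∀ (g : G), ∀ c ∈ 𝒟.coll, Wall.smul g '' c ∈ 𝒟.coll) :
    MulAction G 𝒟.Dual where
  smul g x := ⟨translateBy hW g x.1, fun s => by
    rw [← smul_inv_smul g s, ← translateBy_principal hW, edist_translateBy hW hC]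
    exact x.2 _⟩
  one_smul x := Subtype.ext (translateBy_one hW x.1)
  mul_smul a b x := Subtype.ext (translateBy_mul hW a b x.1)

end WallSystem

end Action

/-! ### Transport of ball walls and disparate chains by isometries. -/

section Transport

variable {T T' : Type*} [MetricSpace T] [MetricSpace T'] (e : T ≃ᵢ T') {K : ℝ}

theorem Wall.comap_comap {S S' S'' : Type*} (f : S' → S) (g : S'' → S') (h : Wall S) :
    (h.comap f).comap g = h.comap (f ∘ g) := by
  obtain ⟨A, hA⟩ := h.exists_isHalf
  exact Wall.eq_of_isHalf ((hA.comap f).comap g) (hA.comap (f ∘ g))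

theorem Wall.comap_id {S : Type*} (h : Wall S) : h.comap id = h := by
  obtain ⟨A, hA⟩ := h.exists_isHalf
  exact Wall.eq_of_isHalf (hA.comap id) hA

theorem Wall.comap_symm_comap (h : Wall T) : (h.comap e.symm).comap e = h := by
  rw [Wall.comap_comap, e.symm_comp_self, Wall.comap_id]

/-- Pulling back along `e.symm` pushes a wall forward by `e`, and an isometry carries balls to balls
and components of complements to components. -/
theorem comap_symm_mem_ballWalls {p : T} {h : Wall T} (hh : h ∈ ballWalls K p) :
    h.comap e.symm ∈ ballWalls K (e p) := by
  obtain ⟨q, hq, hhq⟩ := hh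
  have hball : Metric.closedBall (e p) K = e '' Metric.closedBall p K := by
    rw [e.image_closedBall]
  have hcompl : (Metric.closedBall (e p) K)ᶜ = e '' (Metric.closedBall p K)ᶜ := by
    rw [hball, Set.image_compl_eq e.bijective]
  have hcc : connectedComponentIn (Metric.closedBall (e p) K)ᶜ (e q) =
      e '' connectedComponentIn (Metric.closedBall p K)ᶜ q := by
    rw [hcompl]
    exact (e.toHomeomorph.image_connectedComponentIn hq).symm
  have hset : ∀ A : Set T, (Wall.ofSet A).comap e.symm = Wall.ofSet (e '' A) := by
    intro A
    refine Wall.eq_of_isHalf (A := e '' A) ?_ (Wall.isHalf_ofSet.2 (Or.inl rfl))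
    rw [← e.preimage_symm]
    exact (Wall.isHalf_ofSet.2 (Or.inl rfl)).comap _
  refine ⟨e q, fun h => hq ?_, ?_⟩
  · rw [hball] at h
    exact (e.injective.mem_set_image).1 h
  · rw [hcc, hball, ← Set.image_union, ← hset, ← hset]
    exact hhq.imp (congrArg _) (congrArg _)

theorem image_comap_symm_mem_disparateChains {d : Set (Wall T)} (hd : d ∈ disparateChains K) :
    Wall.comap e.symm '' d ∈ disparateChains K := by
  obtain ⟨hf, ⟨o, ho, hn⟩, p, hp, hfar⟩ := hd
  refine ⟨hf.image _, ⟨fun h => e.symm ⁻¹' o (h.comap e), ?_, ?_⟩, fun h => e (p (h.comap e)),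
    ?_, ?_⟩
  · rintro _ ⟨h, hh, rfl⟩
    beta_reduce
    rw [Wall.comap_symm_comap]
    exact (ho h hh).comap _
  · rintro _ ⟨h, hh, rfl⟩ _ ⟨k, hk, rfl⟩
    beta_reduce
    rw [Wall.comap_symm_comap, Wall.comap_symm_comap]
    exact (hn h hh k hk).imp (fun h => Set.preimage_mono h) (fun h => Set.preimage_mono h)
  · rintro _ ⟨h, hh, rfl⟩
    beta_reduce
    rw [Wall.comap_symm_comap]
    exact comap_symm_mem_ballWalls e (hp h hh)
  · rintro _ ⟨h, hh, rfl⟩ _ ⟨k, hk, rfl⟩ hne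
    beta_reduce
    rw [Wall.comap_symm_comap, Wall.comap_symm_comap, e.dist_eq]
    exact hfar h hh k hk fun heq => hne (heq ▸ rfl)

end Transport

/-! ### Invariance of the walls and the `L`-chains under the action. -/

section Invariance

variable {G : Type*} [Group G] {m : ℕ} {T : Fin m → Type w} [∀ i, MetricSpace (T i)] {S : Type*}
  [MulAction G S] {π : ∀ i, S → T i} {K : Fin m → ℝ} {σ : G → Equiv.Perm (Fin m)}
  {ρ : ∀ g i, T i ≃ᵢ T (σ g i)}

theorem smul_comap_eq (hρ : ∀ (g : G) (s : S) (i : Fin m), π (σ g i) (g • s) = ρ g i (π i s))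
    (g : G) (i : Fin m) (k : Wall (T i)) :
    (k.comap (π i)).smul g = (k.comap (ρ g i).symm).comap (π (σ g i)) := by
  obtain ⟨A, hA⟩ := k.exists_isHalf
  refine Wall.eq_of_isHalf ((hA.comap _).smul g) ?_
  have : g • (π i ⁻¹' A) = π (σ g i) ⁻¹' ((ρ g i).symm ⁻¹' A) := by
    ext s
    obtain ⟨t, rfl⟩ : ∃ t, g • t = s := ⟨g⁻¹ • s, smul_inv_smul g s⟩
    rw [Set.smul_mem_smul_set_iff, Set.mem_preimage, Set.mem_preimage, Set.mem_preimage, hρ,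
      IsometryEquiv.symm_apply_apply]
  rw [this]
  exact (hA.comap _).comap _

theorem smul_mem_inducedWalls
    (hρ : ∀ (g : G) (s : S) (i : Fin m), π (σ g i) (g • s) = ρ g i (π i s))
    (hK : ∀ g i, K (σ g i) = K i) (g : G) {h : Wall S} (hh : h ∈ inducedWalls π K) :
    h.smul g ∈ inducedWalls π K := by
  obtain ⟨i, p, k, hk, rfl⟩ := hh
  refine ⟨σ g i, ρ g i p, k.comap (ρ g i).symm, ?_, smul_comap_eq hρ g i k⟩
  rw [hK]
  exact comap_symm_mem_ballWalls (ρ g i) hk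

theorem smul_mem_chainUnions
    (hρ : ∀ (g : G) (s : S) (i : Fin m), π (σ g i) (g • s) = ρ g i (π i s))
    (hK : ∀ g i, K (σ g i) = K i) (g : G) {c : Set (Wall S)} (hc : c ∈ chainUnions π K) :
    Wall.smul g '' c ∈ chainUnions π K := by
  obtain ⟨⟨d, hd, rfl⟩, hchain⟩ := hc
  refine ⟨?_, hchain.smul g⟩
  -- The chain of the translate in the factor `j` comes from the factor that `g` sends to `j`; the
  -- two radii agree by `hK`.
  have key : ∀ j, ∃ d' ∈ disparateChains (T := T j) (K j), Wall.comap (π j) '' d' =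
      Wall.smul g '' (Wall.comap (π ((σ g).symm j)) '' d ((σ g).symm j)) := by
    intro j
    obtain ⟨i, rfl⟩ := (σ g).surjective j
    rw [Equiv.symm_apply_apply]
    refine ⟨Wall.comap (ρ g i).symm '' d i, ?_, ?_⟩
    · rw [hK]
      exact image_comap_symm_mem_disparateChains (ρ g i) (hd i)
    · rw [Set.image_image, Set.image_image]
      exact Set.image_congr fun k _ => (smul_comap_eq hρ g i k).symm
  choose d' hd' heq using key
  refine ⟨d', hd', ?_⟩
  simp only [heq]
  rw [Set.image_iUnion]
  exact ((σ g).symm.surjective.iUnion_comp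
    fun i => Wall.smul g '' (Wall.comap (π i) '' d i)).symm

theorem smul_mem_lChains
    (hρ : ∀ (g : G) (s : S) (i : Fin m), π (σ g i) (g • s) = ρ g i (π i s))
    (hK : ∀ g i, K (σ g i) = K i) {L : ℕ} (g : G) {c : Set (Wall S)} (hc : c ∈ lChains π K L) :
    Wall.smul g '' c ∈ lChains π K L := by
  refine ⟨smul_mem_chainUnions hρ hK g hc.1, ?_⟩
  rintro _ ⟨h, hh, rfl⟩ _ ⟨k, hk, rfl⟩ hne d hd hl
  rw [← (Wall.smul_wall_injective g⁻¹).encard_image]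
  refine hc.2 h hh k hk (fun heq => hne (heq ▸ rfl)) _ (smul_mem_chainUnions hρ hK g⁻¹ hd) ?_
  rintro _ ⟨l, hld, rfl⟩
  have h1 := (hl l hld).1.smul g⁻¹
  have h2 := (hl l hld).2.smul g⁻¹
  rw [Wall.inv_smul_smul_wall] at h1 h2
  exact ⟨h1, h2⟩

end Invariance

end DualQT

theorem mainTheorem9
    {X : Type u} [MetricSpace X] [Nonempty X] {G : Type v} [Group G] [MulAction G X]
    [IsIsometricSMul G X]
    -- `X` is a roughly geodesic hyperbolic space
    (hXg : ∃ k : ℝ, DualQT.RoughlyGeodesic X k) (hXh : ∃ δ : ℝ, DualQT.Hyperbolic X δ)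
    -- a product of `m` quasitrees, on which `G` acts by isometries that may permute the factors
    {m : ℕ} {T : Fin m → Type w} [∀ i, MetricSpace (T i)] (hT : ∀ i, DualQT.IsQuasitree (T i))
    [MulAction G (∀ i, T i)] (σ : G → Equiv.Perm (Fin m)) (ρ : ∀ g i, T i ≃ᵢ T (σ g i))
    (hρ : ∀ (g : G) (t : ∀ i, T i) (i : Fin m), (g • t) (σ g i) = ρ g i (t i))
    -- an equivariant, quasimedian, quasiisometric embedding
    (μX : X → X → X → X) (hμX : DualQT.IsCoarseMedian μX)
    (μT : ∀ i, T i → T i → T i → T i) (hμT : ∀ i, DualQT.IsCoarseMedian (μT i))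
    (f : X → ∀ i, T i) (hfG : ∀ (g : G) (x : X), f (g • x) = g • f x)
    (hfm : DualQT.IsQuasimedian μX μT f)
    (hfq : DualQT.IsQuasiIsometricEmbedding dist DualQT.l1Dist f) :
    -- all sufficiently large radii are admissible
    (∀ i, ∃ K₀ : ℝ, ∀ K ≥ K₀, DualQT.IsAdmissibleRadius (T i) K) ∧
    ∀ K : Fin m → ℝ, (∀ i, DualQT.IsAdmissibleRadius (T i) (K i)) →
      (∀ g i, K (σ g i) = K i) →
      -- there is a bound on the sizes of square grids
      (∃ L₀ : ℕ, DualQT.GridBound (fun i (s : DualQT.image f hfG) => s.1 i) K L₀) ∧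
      ∀ L₀ L : ℕ, DualQT.GridBound (fun i (s : DualQT.image f hfG) => s.1 i) K L₀ →
        m * L₀ ≤ L →
        ∀ 𝒞 : DualQT.WallSystem (DualQT.image f hfG),
          𝒞 = DualQT.lChainSystem (fun i (s : DualQT.image f hfG) => s.1 i) K L →
          𝒞.IsDualisable ∧
          DualQT.RoughlyGeodesic 𝒞.Dual (3 * m) ∧
          (∃ δ : ℝ, DualQT.Hyperbolic 𝒞.Dual δ) ∧
          -- the action of `G` on the walls induces an isometric action on the dual space
          ∃ hW : ∀ (g : G), ∀ h ∈ 𝒞.walls, h.smul g ∈ 𝒞.walls,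
          ∃ _ : MulAction G 𝒞.Dual,
            (∀ (g : G) (x : 𝒞.Dual) (h : 𝒞.walls),
              (g • x).1.half ⟨h.1.smul g, hW g h.1 h.2⟩ = g • x.1.half h) ∧
            (∀ (g : G) (x y : 𝒞.Dual), dist (g • x) (g • y) = dist x y) ∧
            -- the natural map from `X` is an equivariant quasiisometry
            ∃ φ : X → 𝒞.Dual,
              (∀ x, (φ x).1 = DualQT.principal 𝒞.walls (DualQT.toImage f hfG x)) ∧
              (∀ (g : G) (x : X), φ (g • x) = g • φ x) ∧
              DualQT.IsQuasiIsometry dist dist φ := by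
  refine ⟨fun i => (hT i).exists_isAdmissibleRadius, fun K hK hKσ => ?_⟩
  obtain ⟨k, hXk⟩ := hXg
  obtain ⟨δ, hXδ⟩ := hXh
  have hTg := fun i => (hT i).1
  have hF : Function.Surjective (DualQT.toImage f hfG) := by
    rintro ⟨_, x, rfl⟩
    exact ⟨x, rfl⟩
  have hρ' : ∀ (g : G) (s : DualQT.image f hfG) (i : Fin m),
      (g • s).1 (σ g i) = ρ g i (s.1 i) := fun g s i => hρ g s.1 i
  refine ⟨DualQT.exists_gridBound hXk hXδ hTg hμX hμT hF hfm hfq hK, ?_⟩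
  rintro L₀ L hL₀ hL 𝒞 rfl
  have h𝒞 := DualQT.lChainSystem_isDualisable
    (π := fun i (s : DualQT.image f hfG) => s.1 i) hTg hK L
  have hG := DualQT.lChainSystem_isGluable (π := fun i (s : DualQT.image f hfG) => s.1 i) hTg
    (fun i => (hK i).pos (f (Classical.arbitrary X) i)) L
  refine ⟨h𝒞, ?_, ⟨_, hG.hyperbolic⟩, fun g h hh => DualQT.smul_mem_inducedWalls hρ' hKσ g hh,
    DualQT.WallSystem.dualMulAction (fun g h hh => DualQT.smul_mem_inducedWalls hρ' hKσ g hh)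
      (fun g c hc => DualQT.smul_mem_lChains hρ' hKσ g hc), ?_, ?_,
    fun x => DualQT.principalDual h𝒞 (DualQT.toImage f hfG x), fun _ => rfl, ?_, ?_⟩
  -- For `m = 0` the gluing constant `3 * m` is not at least 1, but then there are no walls and the
  -- dual is a point.
  · rcases Nat.eq_zero_or_pos m with rfl | hm
    · refine fun x y => ⟨0, fun _ => x, le_rfl, rfl, Subtype.ext (DualQT.WallSystem.ext_side ?_),
        fun s hs t ht => ?_⟩
      · rintro h ⟨i, -⟩
        exact i.elim0
      · rw [Set.Icc_self, Set.mem_singleton_iff] at hs ht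
        simp [hs, ht]
    · have := hG.roughlyGeodesic (by omega)
      push_cast at this
      exact this
  · intro g x h
    exact DualQT.WallUltrafilter.half_translateBy
      (fun g h hh => DualQT.smul_mem_inducedWalls hρ' hKσ g hh) g x.1 h
  · intro g x y
    rw [DualQT.WallSystem.dist_eq_toNat, DualQT.WallSystem.dist_eq_toNat]
    exact congrArg _ (congrArg _ (DualQT.WallSystem.edist_translateBy
      (fun g h hh => DualQT.smul_mem_inducedWalls hρ' hKσ g hh)
      (fun g c hc => DualQT.smul_mem_lChains hρ' hKσ g hc) g x.1 y.1))
  · intro g x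
    have h1 : DualQT.toImage f hfG (g • x) = g • DualQT.toImage f hfG x := Subtype.ext (hfG g x)
    exact (congrArg (DualQT.principalDual h𝒞) h1).trans
      (Subtype.ext (DualQT.WallUltrafilter.translateBy_principal
        (fun g h hh => DualQT.smul_mem_inducedWalls hρ' hKσ g hh) g _).symm)
  · exact DualQT.principalDual_isQuasiIsometry hXk hTg hμX hμT hF hfm hfq hK hL₀ hL h𝒞
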